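/- **Polynomials.** Fix a set $V$ of variables, all subject to $y^2=y$, so that every polynomial has a unique expanded multilinear form; $\operatorname{Var}$ denotes the variables and $\operatorname{mon}$ the number of monomials occurring in that form. Boolean polynomials have coefficients in $\mathbb F_2$ (sum written $\oplus$); phase polynomials have coefficients in $\mathbb R/\mathbb Z$. For a boolean polynomial $Q$ let $\widehat Q$ be the integer polynomial with $\widehat y=y$, $\widehat{pq}=\widehat p\,\widehat q$, $\widehat{p\oplus q}=\widehat p+\widehat q-2\widehat p\,\widehat q$. **Morphisms.** A morphism $t:n\to m$ of $\mathbf{SOP}^{⏚}$ is a term $$t=s\sum_{\vec y}e^{2i\pi P}\,|\vec O\rangle\,!\vec D\,\langle\vec I|,$$ where $s\in\mathbb R$, $\vec y\subseteq V$ is a finite set of summation variables, $P$ is a phase polynomial, $\vec O$ and $\vec I$ are lists of $m$ and $n$ boolean polynomials and $\vec D$ is a finite set of boolean polynomials, all in the variables $\vec y$. It is a morphism of $\mathbf{SOP}^{⏚}_{\mathrm{Clif}}$ if $s=\sqrt2^{\,-p}$ with $p\in\mathbb Z$, $P=\frac18P^{(0)}+\frac14P^{(1)}+\frac12P^{(2)}$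 with $P^{(i)}$ of integer coefficients and degree at most $i$, and all polynomials in $\vec O,\vec D,\vec I$ have degree at most $1$. Two terms are equal up to $\alpha$-conversion if they differ by a renaming of the summation variables. **Interpretation.** For a term without discards, $[\![s\sum_{\vec y}e^{2i\pi P}|\vec O\rangle\langle\vec I|]\!]=s\sum_{\vec y\in\{0,1\}^k}e^{2i\pi P(\vec y)}|\vec O(\vec y)\rangle\langle\vec I(\vec y)|$, a linear map between tensor powers of $\mathbb C^2$. In general $[\![t]\!]:=[\![\mathrm{CPM}(t)]\!]$, where $\mathrm{CPM}(t)$ is $$\frac{s^2}{2^{|\vec D|}}\sum_{\vec y_1,\vec y_2,\vec z}e^{2i\pi\left(P(\vec y_1)-P(\vec y_2)+\frac{\widehat{\vec D}(\vec y_1)\cdot\vec z+\widehat{\vec D}(\vec y_2)\cdot\vec z}{2}\right)}|\vec O(\vec y_1),\vec O(\vec y_2)\rangle\langle\vec I(\vec y_1),\vec I(\vec y_2)|.$$ **Rewrite system $\mathrm{Clif}^{⏚}$.** The rules are the following; $y_0\neq y_0'$ are summation variables, every factor on the right multiplies $s$, and $p\ge0$, the empty product being $1$. A sum in a left-hand side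 is a splitting of the expanded polynomial into summands without common monomials. * (Elim) $\sum_{\vec y}e^{2i\pi P}|\vec O\rangle!\vec D\langle\vec I|\to2\sum_{\vec y\setminus\{y_0\}}e^{2i\pi P}|\vec O\rangle!\vec D\langle\vec I|$ if $y_0\notin\operatorname{Var}(P,\vec D,\vec O,\vec I)$. * (HH) $\sum_{\vec y}e^{2i\pi(\frac{y_0}2(y_0'+\widehat Q)+R)}|\vec O\rangle!\vec D\langle\vec I|\to2\sum_{\vec y\setminus\{y_0,y_0'\}}e^{2i\pi R[y_0'\leftarrow\widehat Q]}(|\vec O\rangle!\vec D\langle\vec I|)[y_0'\leftarrow Q]$ if $y_0\notin\operatorname{Var}(R,Q,\vec D,\vec O,\vec I)$ and $y_0'\notin\operatorname{Var}(Q)$. * ($\omega$) $\sum_{\vec y}e^{2i\pi(\frac{y_0}4+\frac{y_0}2\widehat Q+R)}|\vec O\rangle!\vec D\langle\vec I|\to\sqrt2\sum_{\vec y\setminus\{y_0\}}e^{2i\pi(\frac18-\frac14\widehat Q+R)}|\vec O\rangle!\vec D\langle\vec I|$ if $y_0\notin\operatorname{Var}(Q,R,\vec D,\vec O,\vec I)$.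 * (Z⏚) $\sum e^{2i\pi(P+\alpha\widehat{D_1\cdots D_p})}|\vec O\rangle!\vec D\langle\vec I|\to\sum e^{2i\pi P}|\vec O\rangle!\vec D\langle\vec I|$ if $D_1,\dots,D_p\in\vec D$ and $\alpha\widehat{D_1\cdots D_p}\ne0$ modulo $1$. * (H⏚) $\sum_{\vec y}e^{2i\pi(P+\frac{y_0}2\widehat Q)}|\vec O\rangle!(\vec D\cup\{y_0\})\langle\vec I|\to\sqrt2\sum_{\vec y\setminus\{y_0\}}e^{2i\pi P}|\vec O\rangle!(\vec D\cup\{Q\})\langle\vec I|$ if $y_0\notin\operatorname{Var}(P,Q,\vec O,\vec I,\vec D)$. * ($\oplus$⏚) in the discarded set, replace an element $D_1\cdots D_p\oplus E$ by $E$, if $D_1,\dots,D_p$ are other elements of the set and $D_1\cdots D_p\neq0$. * (Cst⏚) remove a constant $c\in\{0,1\}$ from the discarded set. * (disc) if the discarded set is $\vec D\cup\{D_i\}$ with $D_i\notin\vec D$, $D_i=y_0\oplus D_i'$, $D_i'\ne0$, $y_0\notin\operatorname{Var}(D_i')$, and $\vec D[y_0\leftarrow D_i]$ has at most as many elements with $\operatorname{mon}\ge2$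 as $\vec D$: substitute $y_0\leftarrow\widehat{D_i}$ in $P$ and $y_0\leftarrow D_i$ in $\vec O$, $\vec D\cup\{D_i\}$ and $\vec I$. * (ket) if $O_i=y_0\oplus O_i'\oplus O_i''$ with $O_i'\ne0$, $y_0\notin\operatorname{Var}(O_1,\dots,O_{i-1},O_i',O_i'')$, and $y_0\notin\operatorname{Var}(\vec D)$ or $\{y_0,O_i'\}\subseteq\vec D\cup\{1\}$: substitute $y_0\leftarrow\widehat{y_0\oplus O_i'}$ in $P$ and $y_0\leftarrow y_0\oplus O_i'$ in $\vec O$ and $\vec I$, leaving $\vec D$ unchanged. * (bra) if $I_i=y_0\oplus I_i'\oplus I_i''$ with $I_i'\ne0$, $y_0\notin\operatorname{Var}(\vec O,I_1,\dots,I_{i-1},I_i',I_i'')$, and $y_0\notin\operatorname{Var}(\vec D)$ or $\{y_0,I_i'\}\subseteq\vec D\cup\{1\}$: substitute $y_0\leftarrow\widehat{y_0\oplus I_i'}$ in $P$ and $y_0\leftarrow y_0\oplus I_i'$ in $\vec I$, leaving $\vec O$ and $\vec D$ unchanged. * (Z) $s\sum_{\vec y}e^{2i\pi(\frac{y_0}2+R)}|\vec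 O\rangle!\vec D\langle\vec I|\to\sum_{y_0}e^{2i\pi\frac{y_0}2}|0,\dots,0\rangle!\{\}\langle0,\dots,0|$ if $y_0\notin\operatorname{Var}(R,\vec D,\vec O,\vec I)$ and ($s\ne1$ or $R\neq0$ or $\vec O\vec I\ne\vec0$). A term is terminal if no rule applies to it; $\to^*$ denotes reduction in finitely many (possibly zero) steps. **Theorem (Completeness for Clifford).** Let $t_1,t_2:n\to m$ be morphisms of $\mathbf{SOP}^{⏚}_{\mathrm{Clif}}$ such that $[\![t_1]\!]=[\![t_2]\!]$. If $t_1'$ and $t_2'$ are terminal with $t_1\to^*t_1'$ and $t_2\to^*t_2'$, then $t_1'=t_2'$ up to $\alpha$-conversion. -/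

import Mathlib

noncomputable section

open scoped Classical

namespace SumOverPaths

universe u w

/-! ### Multilinear polynomials -/

/-- A monomial in variables that satisfy `X ^ 2 = X`: the finite set of variables in it. -/
def Mon (V : Type u) : Type u := Finset V

/-- The monomial whose variables are the elements of a finite set. -/
def Mon.of {V : Type u} (S : Finset V) : Mon V := S

/-- The variables of a monomial. -/
def Mon.vars {V : Type u} (S : Mon V) : Finset V := S

instance (V : Type u) : CommMonoid (Mon V) where
  mul S T := Mon.of (S.vars ∪ T.vars)
  one := Mon.of ∅
  mul_assoc S T U := Finset.union_assoc (α := V) S T U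
  mul_comm S T := Finset.union_comm (α := V) S T
  one_mul S := Finset.empty_union (α := V) S
  mul_one S := Finset.union_empty (α := V) S

/-- `R[X_v : v ∈ V] / (X_v ^ 2 - X_v)`: the algebra of the monoid of multilinear monomials. An
element is given by its coefficients, i.e. in expanded and simplified form. -/
abbrev Poly (V : Type u) (R : Type w) [CommRing R] : Type (max u w) := MonoidAlgebra R (Mon V)

/-- Boolean polynomials; their sum is the exclusive or. -/
abbrev BPoly (V : Type u) : Type u := Poly V (ZMod 2)

/-- Polynomials with integer coefficients. -/
abbrev IPoly (V : Type u) : Type u := Poly V ℤ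

/-- Phase polynomials: `ℝ[X_v : v ∈ V] / (1, X_v ^ 2 - X_v)`, that is, multilinear polynomials
whose coefficients are real numbers modulo `1`. -/
abbrev Phase (V : Type u) : Type u := Mon V →₀ UnitAddCircle

/-- The variables that occur in a family of coefficients. -/
def coeffVars {V : Type u} {R : Type w} [Zero R] (f : Mon V →₀ R) : Finset V :=
  f.support.biUnion Mon.vars

namespace Poly

variable {V W : Type u} {R : Type w} [CommRing R]

/-- The variables of a polynomial. -/
def vars (p : Poly V R) : Finset V := coeffVars p.coeff

/-- The set of monomials of a polynomial (those with a nonzero coefficient). -/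
def monomials (p : Poly V R) : Finset (Mon V) := p.coeff.support

/-- The number of monomials of a polynomial. -/
def mon (p : Poly V R) : ℕ := (monomials p).card

/-- The degree of `p` is at most `d`. -/
def DegreeLE (p : Poly V R) (d : ℕ) : Prop := ∀ S ∈ monomials p, S.vars.card ≤ d

/-- The polynomial `X_v`. -/
def X (v : V) : Poly V R := MonoidAlgebra.single (Mon.of {v}) 1

/-- Simultaneous substitution of polynomials for the variables. -/
def bind (f : V → Poly W R) (p : Poly V R) : Poly W R :=
  p.coeff.sum fun S c => c • ∏ v ∈ S.vars, f v

/-- `p[y ← q]`. -/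
def subst (y : V) (q : Poly V R) (p : Poly V R) : Poly V R := bind (Function.update X y q) p

/-- Renaming of variables. -/
def rename (f : V → W) (p : Poly V R) : Poly W R := bind (fun v => X (f v)) p

/-- The value of a polynomial. -/
def eval (a : V → R) (p : Poly V R) : R := p.coeff.sum fun S c => c * ∏ v ∈ S.vars, a v

end Poly

/-- The operation `p + q - 2 p q` that represents the exclusive or. -/
def xorOp {V : Type u} (p q : IPoly V) : IPoly V := p + q - 2 * (p * q)

instance (V : Type u) : Std.Commutative (xorOp (V := V)) := ⟨fun p q => by unfold xorOp; ring⟩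

instance (V : Type u) : Std.Associative (xorOp (V := V)) := ⟨fun p q r => by unfold xorOp; ring⟩

/-- The integer polynomial `Q̂` of a boolean polynomial `Q`: monomials are kept, and `⊕` becomes
`p + q - 2 p q`. -/
def BPoly.hat {V : Type u} (Q : BPoly V) : IPoly V :=
  (Poly.monomials Q).fold xorOp 0 fun S => MonoidAlgebra.single S 1

namespace Phase

variable {V W : Type u}

/-- The phase polynomial `α p`, for a polynomial `p` with integer coefficients. -/
def scale (α : UnitAddCircle) (p : IPoly V) : Phase V :=
  p.coeff.mapRange (fun z : ℤ => z • α) (zero_smul ℤ α)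

/-- The variables of a phase polynomial. -/
def vars (P : Phase V) : Finset V := coeffVars P

/-- Simultaneous substitution of integer polynomials for the variables. -/
def bind (f : V → IPoly W) (P : Phase V) : Phase W :=
  P.sum fun S c => scale c (∏ v ∈ S.vars, f v)

/-- `P[y ← q]`. -/
def subst (y : V) (q : IPoly V) (P : Phase V) : Phase V := bind (Function.update Poly.X y q) P

/-- Renaming of variables. -/
def rename (f : V → W) (P : Phase V) : Phase W := bind (fun v => Poly.X (f v)) P

/-- The value, modulo `1`, of a phase polynomial at bits. -/
def eval (a : V → ZMod 2) (P : Phase V) : UnitAddCircle :=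
  P.sum fun S c => (∏ v ∈ S.vars, (a v).val) • c

end Phase

/-! ### Bookkeeping of variables -/

section VarLemmas

variable {V W : Type u} {R : Type w}

theorem mem_coeffVars [Zero R] {f : Mon V →₀ R} {v : V} :
    v ∈ coeffVars f ↔ ∃ S, f S ≠ 0 ∧ v ∈ S.vars := by
  simp [coeffVars]

theorem coeffVars_zero [Zero R] : coeffVars (0 : Mon V →₀ R) = ∅ := by
  simp [coeffVars]

theorem coeffVars_add [AddZeroClass R] (f g : Mon V →₀ R) :
    coeffVars (f + g) ⊆ coeffVars f ∪ coeffVars g := by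
  intro v hv
  obtain ⟨S, hS, hvS⟩ := mem_coeffVars.1 hv
  rw [Finset.mem_union, mem_coeffVars, mem_coeffVars]
  by_cases hf : f S = 0
  · exact Or.inr ⟨S, fun hg => hS (by rw [Finsupp.add_apply, hf, hg, add_zero]), hvS⟩
  · exact Or.inl ⟨S, hf, hvS⟩

theorem coeffVars_neg [AddGroup R] (f : Mon V →₀ R) : coeffVars (-f) = coeffVars f := by
  simp [coeffVars]

theorem coeffVars_sum [AddCommMonoid R] {ι : Type*} (s : Finset ι) (f : ι → Mon V →₀ R)
    (A : Finset V) (h : ∀ i ∈ s, coeffVars (f i) ⊆ A) : coeffVars (∑ i ∈ s, f i) ⊆ A := by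
  induction s using Finset.induction_on with
  | empty => simp [coeffVars_zero]
  | insert i s hi ih =>
    rw [Finset.sum_insert hi]
    exact (coeffVars_add _ _).trans (Finset.union_subset (h i (Finset.mem_insert_self i s))
      (ih fun j hj => h j (Finset.mem_insert_of_mem hj)))

theorem Poly.vars_single [CommRing R] (S : Mon V) (c : R) :
    Poly.vars (MonoidAlgebra.single S c : Poly V R) ⊆ S.vars := by
  intro v hv
  obtain ⟨T, hT, hvT⟩ := mem_coeffVars.1 hv
  rw [MonoidAlgebra.coeff_single, Finsupp.single_apply] at hT
  split_ifs at hT with h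
  · rwa [h]
  · exact absurd rfl hT

theorem Poly.vars_X [CommRing R] (v : V) : Poly.vars (Poly.X v : Poly V R) ⊆ {v} :=
  Poly.vars_single _ _

theorem Poly.vars_add [CommRing R] (p q : Poly V R) :
    Poly.vars (p + q) ⊆ Poly.vars p ∪ Poly.vars q := by
  simpa [Poly.vars] using coeffVars_add p.coeff q.coeff

theorem Poly.vars_neg [CommRing R] (p : Poly V R) : Poly.vars (-p) = Poly.vars p := by
  simpa [Poly.vars] using coeffVars_neg p.coeff

theorem Poly.vars_sum [CommRing R] {ι : Type*} (s : Finset ι) (f : ι → Poly V R)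
    (A : Finset V) (h : ∀ i ∈ s, Poly.vars (f i) ⊆ A) : Poly.vars (∑ i ∈ s, f i) ⊆ A := by
  induction s using Finset.induction_on with
  | empty => simp [Poly.vars, coeffVars_zero]
  | insert i s hi ih =>
    rw [Finset.sum_insert hi]
    exact (Poly.vars_add _ _).trans (Finset.union_subset (h i (Finset.mem_insert_self i s))
      (ih fun j hj => h j (Finset.mem_insert_of_mem hj)))

theorem Poly.vars_mul [CommRing R] (p q : Poly V R) :
    Poly.vars (p * q) ⊆ Poly.vars p ∪ Poly.vars q := by
  rw [MonoidAlgebra.mul_def]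
  refine Poly.vars_sum _ _ _ fun S hS => Poly.vars_sum _ _ _ fun T hT => ?_
  refine (Poly.vars_single _ _).trans ?_
  exact Finset.union_subset_union (Finset.subset_biUnion_of_mem Mon.vars hS)
    (Finset.subset_biUnion_of_mem Mon.vars hT)

theorem Poly.vars_prod [CommRing R] {ι : Type*} (s : Finset ι) (f : ι → Poly V R)
    (A : Finset V) (h : ∀ i ∈ s, Poly.vars (f i) ⊆ A) : Poly.vars (∏ i ∈ s, f i) ⊆ A := by
  induction s using Finset.induction_on with
  | empty =>
    rw [Finset.prod_empty, MonoidAlgebra.one_def]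
    exact (Poly.vars_single _ _).trans (Finset.empty_subset A)
  | insert i s hi ih =>
    rw [Finset.prod_insert hi]
    exact (Poly.vars_mul _ _).trans (Finset.union_subset (h i (Finset.mem_insert_self i s))
      (ih fun j hj => h j (Finset.mem_insert_of_mem hj)))

theorem Poly.vars_smul [CommRing R] (c : R) (p : Poly V R) :
    Poly.vars (c • p) ⊆ Poly.vars p := by
  intro v hv
  obtain ⟨S, hS, hvS⟩ := mem_coeffVars.1 hv
  refine mem_coeffVars.2 ⟨S, fun h => hS ?_, hvS⟩
  simp [h]

theorem Poly.vars_rename [CommRing R] (f : V → W) (p : Poly V R) (B : Finset W)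
    (h : ∀ v ∈ Poly.vars p, f v ∈ B) : Poly.vars (Poly.rename f p) ⊆ B := by
  refine Poly.vars_sum _ _ _ fun S hS => (Poly.vars_smul _ _).trans ?_
  refine Poly.vars_prod _ _ _ fun v hv => (Poly.vars_X _).trans ?_
  exact Finset.singleton_subset_iff.2 (h v (Finset.mem_biUnion.2 ⟨S, hS, hv⟩))

theorem Phase.vars_scale (α : UnitAddCircle) (p : IPoly V) :
    Phase.vars (Phase.scale α p) ⊆ Poly.vars p := by
  intro v hv
  obtain ⟨S, hS, hvS⟩ := mem_coeffVars.1 hv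
  refine mem_coeffVars.2 ⟨S, fun h => hS ?_, hvS⟩
  simp [Phase.scale, h]

theorem Phase.vars_rename (f : V → W) (P : Phase V) (B : Finset W)
    (h : ∀ v ∈ P.vars, f v ∈ B) : Phase.vars (Phase.rename f P) ⊆ B := by
  refine coeffVars_sum _ _ _ fun S hS => (Phase.vars_scale _ _).trans ?_
  refine Poly.vars_prod _ _ _ fun v hv => (Poly.vars_X _).trans ?_
  exact Finset.singleton_subset_iff.2 (h v (Finset.mem_biUnion.2 ⟨S, hS, hv⟩))

theorem vars_xorOp (p q : IPoly V) : Poly.vars (xorOp p q) ⊆ Poly.vars p ∪ Poly.vars q := by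
  have h2 : Poly.vars (2 * (p * q)) ⊆ Poly.vars p ∪ Poly.vars q := by
    rw [two_mul]
    exact (Poly.vars_add _ _).trans (Finset.union_subset (Poly.vars_mul p q) (Poly.vars_mul p q))
  unfold xorOp
  rw [sub_eq_add_neg]
  refine (Poly.vars_add _ _).trans (Finset.union_subset (Poly.vars_add p q) ?_)
  rwa [Poly.vars_neg]

theorem BPoly.vars_hat (Q : BPoly V) : Poly.vars (BPoly.hat Q) ⊆ Poly.vars Q := by
  have key : ∀ s : Finset (Mon V), s ⊆ Poly.monomials Q →
      Poly.vars (s.fold xorOp 0 fun S => (MonoidAlgebra.single S 1 : IPoly V)) ⊆ Poly.vars Q := by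
    intro s
    induction s using Finset.induction_on with
    | empty => intro _; simp [Poly.vars, coeffVars_zero]
    | insert S s hS ih =>
      intro h
      rw [Finset.fold_insert hS]
      refine (vars_xorOp _ _).trans (Finset.union_subset ((Poly.vars_single _ _).trans ?_)
        (ih fun T hT => h (Finset.mem_insert_of_mem hT)))
      exact Finset.subset_biUnion_of_mem Mon.vars (h (Finset.mem_insert_self S s))
  exact key _ (Finset.Subset.refl _)

end VarLemmas

/-! ### Sums over paths -/

/-- A morphism `s ∑_y e^{2iπP} |O⟩⟨I|` from `n` to `m`, with variables taken in `V`; the sum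
ranges over the variables in `bound`. -/
structure SOP (V : Type u) (n m : ℕ) where
  s : ℝ
  bound : Finset V
  P : Phase V
  O : Fin m → BPoly V
  I : Fin n → BPoly V
  vars_P : P.vars ⊆ bound
  vars_O : ∀ i, Poly.vars (O i) ⊆ bound
  vars_I : ∀ i, Poly.vars (I i) ⊆ bound

/-- An assignment of bits to the variables of a finite set, extended by `0`. -/
def extend {V : Type u} (B : Finset V) (a : B → ZMod 2) : V → ZMod 2 :=
  fun v => if h : v ∈ B then a ⟨v, h⟩ else 0

/-- The interpretation `s ∑_{y ∈ {0,1}^k} e^{2iπP(y)} |O(y)⟩⟨I(y)|`, as the matrix of a linear map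
from `ℂ^(2^n)` to `ℂ^(2^m)` in the computational bases. -/
def SOP.interp {V : Type u} {n m : ℕ} (t : SOP V n m) :
    Matrix (Fin m → ZMod 2) (Fin n → ZMod 2) ℂ :=
  (t.s : ℂ) • ∑ a : t.bound → ZMod 2,
    Matrix.single (fun i => Poly.eval (extend t.bound a) (t.O i))
      (fun i => Poly.eval (extend t.bound a) (t.I i))
      (AddCircle.toCircle (Phase.eval (extend t.bound a) t.P) : ℂ)

/-- A morphism `s ∑_y e^{2iπP} |O⟩ !D ⟨I|` from `n` to `m` of sums over paths with discards; `D` is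
the set of discarded polynomials. -/
structure DSOP (V : Type u) (n m : ℕ) where
  s : ℝ
  bound : Finset V
  P : Phase V
  O : Fin m → BPoly V
  D : Finset (BPoly V)
  I : Fin n → BPoly V
  vars_P : P.vars ⊆ bound
  vars_O : ∀ i, Poly.vars (O i) ⊆ bound
  vars_D : ∀ d ∈ D, Poly.vars d ⊆ bound
  vars_I : ∀ i, Poly.vars (I i) ⊆ bound

/-- The phase `1/2` modulo `1`. -/
def half : UnitAddCircle := ((1 / 2 : ℝ) : UnitAddCircle)

/-- The phase `1/4` modulo `1`. -/
def quarter : UnitAddCircle := ((1 / 4 : ℝ) : UnitAddCircle)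

/-- The phase `1/8` modulo `1`. -/
def eighth : UnitAddCircle := ((1 / 8 : ℝ) : UnitAddCircle)

namespace DSOP

variable {V : Type u} {n m : ℕ}

/-- The variables of the CPM construction: two copies of those of the morphism, and a fresh one for
each discarded polynomial. -/
def CPMVar (V : Type u) : Type u := V ⊕ V ⊕ BPoly V

/-- The first copy of a variable. -/
def copy₁ (v : V) : CPMVar V := Sum.inl v

/-- The second copy of a variable. -/
def copy₂ (v : V) : CPMVar V := Sum.inr (Sum.inl v)

/-- The fresh variable of a discarded polynomial. -/
def fresh (d : BPoly V) : CPMVar V := Sum.inr (Sum.inr d)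

/-- The summation variables of the CPM construction. -/
def cpmBound (t : DSOP V n m) : Finset (CPMVar V) := t.bound.disjSum (t.bound.disjSum t.D)

/-- `P(y₁) - P(y₂) + (D(y₁) ⬝ y + D(y₂) ⬝ y) / 2`. -/
def cpmPhase (t : DSOP V n m) : Phase (CPMVar V) :=
  t.P.rename copy₁ - t.P.rename copy₂ +
    ∑ d ∈ t.D, Phase.scale half
      (Poly.rename copy₁ (BPoly.hat d) * Poly.X (fresh d) +
        Poly.rename copy₂ (BPoly.hat d) * Poly.X (fresh d))

theorem copy₁_mem (t : DSOP V n m) {A : Finset V} (h : A ⊆ t.bound) :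
    ∀ v ∈ A, copy₁ v ∈ t.cpmBound :=
  fun _ hv => Finset.inl_mem_disjSum.2 (h hv)

theorem copy₂_mem (t : DSOP V n m) {A : Finset V} (h : A ⊆ t.bound) :
    ∀ v ∈ A, copy₂ v ∈ t.cpmBound :=
  fun _ hv => Finset.inr_mem_disjSum.2 (Finset.inl_mem_disjSum.2 (h hv))

theorem vars_cpmPhase (t : DSOP V n m) : t.cpmPhase.vars ⊆ t.cpmBound := by
  refine (coeffVars_add _ _).trans (Finset.union_subset ?_ ?_)
  · rw [sub_eq_add_neg]
    refine (coeffVars_add _ _).trans (Finset.union_subset ?_ ?_)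
    · exact Phase.vars_rename _ _ _ (t.copy₁_mem t.vars_P)
    · rw [coeffVars_neg]
      exact Phase.vars_rename _ _ _ (t.copy₂_mem t.vars_P)
  · refine coeffVars_sum _ _ _ fun d hd => (Phase.vars_scale _ _).trans ?_
    have hf : Poly.vars (Poly.X (fresh d) : IPoly (CPMVar V)) ⊆ t.cpmBound :=
      (Poly.vars_X _).trans (Finset.singleton_subset_iff.2
        (Finset.inr_mem_disjSum.2 (Finset.inr_mem_disjSum.2 hd)))
    have hd' := (BPoly.vars_hat d).trans (t.vars_D d hd)
    refine (Poly.vars_add _ _).trans (Finset.union_subset ?_ ?_)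
    · exact (Poly.vars_mul _ _).trans (Finset.union_subset
        (Poly.vars_rename _ _ _ (t.copy₁_mem hd')) hf)
    · exact (Poly.vars_mul _ _).trans (Finset.union_subset
        (Poly.vars_rename _ _ _ (t.copy₂_mem hd')) hf)

theorem vars_append (t : DSOP V n m) {k : ℕ} (A : Fin k → BPoly V)
    (h : ∀ i, Poly.vars (A i) ⊆ t.bound) (i : Fin (k + k)) :
    Poly.vars (Fin.append (fun j => Poly.rename copy₁ (A j))
      (fun j => Poly.rename copy₂ (A j)) i) ⊆ t.cpmBound := by
  refine Fin.addCases (fun j => ?_) (fun j => ?_) i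
  · rw [Fin.append_left]
    exact Poly.vars_rename _ _ _ (t.copy₁_mem (h j))
  · rw [Fin.append_right]
    exact Poly.vars_rename _ _ _ (t.copy₂_mem (h j))

/-- The CPM construction. -/
def cpm (t : DSOP V n m) : SOP (CPMVar V) (n + n) (m + m) where
  s := t.s ^ 2 / 2 ^ t.D.card
  bound := t.cpmBound
  P := t.cpmPhase
  O := Fin.append (fun j => Poly.rename copy₁ (t.O j)) (fun j => Poly.rename copy₂ (t.O j))
  I := Fin.append (fun j => Poly.rename copy₁ (t.I j)) (fun j => Poly.rename copy₂ (t.I j))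
  vars_P := t.vars_cpmPhase
  vars_O := t.vars_append t.O t.vars_O
  vars_I := t.vars_append t.I t.vars_I

/-- The standard interpretation of morphisms with discards. -/
def interp (t : DSOP V n m) : Matrix (Fin (m + m) → ZMod 2) (Fin (n + n) → ZMod 2) ℂ :=
  t.cpm.interp

/-- The morphisms of the Clifford fragment with discards:
`1 / √2 ^ p ∑ e^{2iπ(P₀/8 + P₁/4 + P₂/2)} |O⟩ !D ⟨I|` where `p` is an integer, `Pᵢ` has integer
coefficients and degree at most `i`, and all polynomials of `O`, `D` and `I` are linear (of degree
at most one, constants being allowed). -/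
def IsClifford (t : DSOP V n m) : Prop :=
  (∃ p : ℤ, t.s = 1 / Real.sqrt 2 ^ p) ∧
  (∃ P₀ P₁ P₂ : IPoly V, Poly.DegreeLE P₀ 0 ∧ Poly.DegreeLE P₁ 1 ∧ Poly.DegreeLE P₂ 2 ∧
    t.P = Phase.scale eighth P₀ + Phase.scale quarter P₁ + Phase.scale half P₂) ∧
  (∀ i, Poly.DegreeLE (t.O i) 1) ∧ (∀ d ∈ t.D, Poly.DegreeLE d 1) ∧
  (∀ i, Poly.DegreeLE (t.I i) 1)

/-- `y` does not occur in `D`. -/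
def FreshD (y : V) (D : Finset (BPoly V)) : Prop := ∀ d ∈ D, y ∉ Poly.vars d

/-- `y` does not occur in a list of polynomials. -/
def FreshL {k : ℕ} (y : V) (A : Fin k → BPoly V) : Prop := ∀ i, y ∉ Poly.vars (A i)

/-- The number of polynomials in `D` that have at least two monomials. -/
def compound (D : Finset (BPoly V)) : ℕ := (D.filter fun d => 2 ≤ Poly.mon d).card

/-- One step of the rewrite system `Clif⏚`. A sum on the left-hand side of a rule is a splitting of
the expanded polynomial: the summands have no monomial in common (where a variable occurs in only
one of them this is automatic, otherwise it is stated), and a summand that the rule removes is not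
zero. -/
inductive Step : DSOP V n m → DSOP V n m → Prop
  | elim (t t' : DSOP V n m) (y₀ : V) (hy₀ : y₀ ∈ t.bound)
      (freshP : y₀ ∉ t.P.vars) (freshD : FreshD y₀ t.D)
      (freshO : FreshL y₀ t.O) (freshI : FreshL y₀ t.I)
      (s' : t'.s = 2 * t.s) (bound' : t'.bound = t.bound.erase y₀)
      (P' : t'.P = t.P) (O' : t'.O = t.O) (D' : t'.D = t.D) (I' : t'.I = t.I) : Step t t'
  | hh (t t' : DSOP V n m) (y₀ y₁ : V) (Q : BPoly V) (R : Phase V)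
      (hy₀ : y₀ ∈ t.bound) (hy₁ : y₁ ∈ t.bound) (hne : y₀ ≠ y₁)
      (hP : t.P = Phase.scale half (Poly.X y₀ * (Poly.X y₁ + BPoly.hat Q)) + R)
      (freshR : y₀ ∉ R.vars) (freshQ : y₀ ∉ Poly.vars Q) (freshD : FreshD y₀ t.D)
      (freshO : FreshL y₀ t.O) (freshI : FreshL y₀ t.I) (freshQ₁ : y₁ ∉ Poly.vars Q)
      (s' : t'.s = 2 * t.s) (bound' : t'.bound = (t.bound.erase y₀).erase y₁)
      (P' : t'.P = R.subst y₁ (BPoly.hat Q))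
      (O' : t'.O = fun i => Poly.subst y₁ Q (t.O i))
      (D' : t'.D = t.D.image (Poly.subst y₁ Q))
      (I' : t'.I = fun i => Poly.subst y₁ Q (t.I i)) : Step t t'
  | omega (t t' : DSOP V n m) (y₀ : V) (Q : BPoly V) (R : Phase V) (hy₀ : y₀ ∈ t.bound)
      (hP : t.P = Phase.scale quarter (Poly.X y₀) +
        Phase.scale half (Poly.X y₀ * BPoly.hat Q) + R)
      (freshQ : y₀ ∉ Poly.vars Q) (freshR : y₀ ∉ R.vars) (freshD : FreshD y₀ t.D)
      (freshO : FreshL y₀ t.O) (freshI : FreshL y₀ t.I)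
      (s' : t'.s = Real.sqrt 2 * t.s) (bound' : t'.bound = t.bound.erase y₀)
      (P' : t'.P = Phase.scale eighth 1 - Phase.scale quarter (BPoly.hat Q) + R)
      (O' : t'.O = t.O) (D' : t'.D = t.D) (I' : t'.I = t.I) : Step t t'
  | zGround (t t' : DSOP V n m) (E : Finset (BPoly V)) (α : UnitAddCircle) (R : Phase V)
      (hE : E ⊆ t.D)
      (hP : t.P = R + Phase.scale α (BPoly.hat (∏ d ∈ E, d)))
      (hne : Phase.scale α (BPoly.hat (∏ d ∈ E, d)) ≠ 0)
      (split : Disjoint R.support (Phase.scale α (BPoly.hat (∏ d ∈ E, d))).support)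
      (s' : t'.s = t.s) (bound' : t'.bound = t.bound)
      (P' : t'.P = R) (O' : t'.O = t.O) (D' : t'.D = t.D) (I' : t'.I = t.I) : Step t t'
  | hGround (t t' : DSOP V n m) (y₀ : V) (Q : BPoly V) (R : Phase V) (D₀ : Finset (BPoly V))
      (hy₀ : y₀ ∈ t.bound)
      (hP : t.P = R + Phase.scale half (Poly.X y₀ * BPoly.hat Q))
      (hD : t.D = insert (Poly.X y₀) D₀)
      (freshQ : y₀ ∉ Poly.vars Q) (freshR : y₀ ∉ R.vars) (freshO : FreshL y₀ t.O)
      (freshI : FreshL y₀ t.I) (freshD : FreshD y₀ D₀)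
      (s' : t'.s = Real.sqrt 2 * t.s) (bound' : t'.bound = t.bound.erase y₀)
      (P' : t'.P = R) (O' : t'.O = t.O) (D' : t'.D = insert Q D₀) (I' : t'.I = t.I) : Step t t'
  | xorGround (t t' : DSOP V n m) (E : Finset (BPoly V)) (d q : BPoly V)
      (hd : d ∈ t.D) (hE : E ⊆ t.D.erase d)
      (hsum : d = ∏ e ∈ E, e + q) (hne : ∏ e ∈ E, e ≠ 0)
      (split : Disjoint (Poly.monomials (∏ e ∈ E, e)) (Poly.monomials q))
      (s' : t'.s = t.s) (bound' : t'.bound = t.bound) (P' : t'.P = t.P) (O' : t'.O = t.O)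
      (D' : t'.D = insert q (t.D.erase d)) (I' : t'.I = t.I) : Step t t'
  | cstGround (t t' : DSOP V n m) (c : BPoly V) (hc : c = 0 ∨ c = 1) (hcD : c ∈ t.D)
      (s' : t'.s = t.s) (bound' : t'.bound = t.bound) (P' : t'.P = t.P) (O' : t'.O = t.O)
      (D' : t'.D = t.D.erase c) (I' : t'.I = t.I) : Step t t'
  | disc (t t' : DSOP V n m) (y₀ : V) (d q : BPoly V) (hy₀ : y₀ ∈ t.bound)
      (hd : d ∈ t.D) (hsum : d = Poly.X y₀ + q) (hne : q ≠ 0) (freshq : y₀ ∉ Poly.vars q)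
      (hcount : compound ((t.D.erase d).image (Poly.subst y₀ d)) ≤ compound (t.D.erase d))
      (s' : t'.s = t.s) (bound' : t'.bound = t.bound)
      (P' : t'.P = t.P.subst y₀ (BPoly.hat d))
      (O' : t'.O = fun i => Poly.subst y₀ d (t.O i))
      (D' : t'.D = t.D.image (Poly.subst y₀ d))
      (I' : t'.I = fun i => Poly.subst y₀ d (t.I i)) : Step t t'
  | ket (t t' : DSOP V n m) (y₀ : V) (i : Fin m) (q r : BPoly V) (hy₀ : y₀ ∈ t.bound)
      (hsum : t.O i = Poly.X y₀ + q + r) (hne : q ≠ 0)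
      (split : Disjoint (Poly.monomials q) (Poly.monomials r))
      (freshO : ∀ j < i, y₀ ∉ Poly.vars (t.O j))
      (freshq : y₀ ∉ Poly.vars q) (freshr : y₀ ∉ Poly.vars r)
      (hD : FreshD y₀ t.D ∨ (Poly.X y₀ ∈ insert 1 t.D ∧ q ∈ insert 1 t.D))
      (s' : t'.s = t.s) (bound' : t'.bound = t.bound)
      (P' : t'.P = t.P.subst y₀ (BPoly.hat (Poly.X y₀ + q)))
      (O' : t'.O = fun j => Poly.subst y₀ (Poly.X y₀ + q) (t.O j))
      (D' : t'.D = t.D)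
      (I' : t'.I = fun j => Poly.subst y₀ (Poly.X y₀ + q) (t.I j)) : Step t t'
  | bra (t t' : DSOP V n m) (y₀ : V) (i : Fin n) (q r : BPoly V) (hy₀ : y₀ ∈ t.bound)
      (hsum : t.I i = Poly.X y₀ + q + r) (hne : q ≠ 0)
      (split : Disjoint (Poly.monomials q) (Poly.monomials r))
      (freshO : FreshL y₀ t.O) (freshI : ∀ j < i, y₀ ∉ Poly.vars (t.I j))
      (freshq : y₀ ∉ Poly.vars q) (freshr : y₀ ∉ Poly.vars r)
      (hD : FreshD y₀ t.D ∨ (Poly.X y₀ ∈ insert 1 t.D ∧ q ∈ insert 1 t.D))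
      (s' : t'.s = t.s) (bound' : t'.bound = t.bound)
      (P' : t'.P = t.P.subst y₀ (BPoly.hat (Poly.X y₀ + q)))
      (O' : t'.O = t.O) (D' : t'.D = t.D)
      (I' : t'.I = fun j => Poly.subst y₀ (Poly.X y₀ + q) (t.I j)) : Step t t'
  | zero (t t' : DSOP V n m) (y₀ : V) (R : Phase V) (hy₀ : y₀ ∈ t.bound)
      (hP : t.P = Phase.scale half (Poly.X y₀) + R)
      (hne : t.s ≠ 1 ∨ R ≠ 0 ∨ t.O ≠ 0 ∨ t.I ≠ 0)
      (freshR : y₀ ∉ R.vars) (freshD : FreshD y₀ t.D)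
      (freshO : FreshL y₀ t.O) (freshI : FreshL y₀ t.I)
      (s' : t'.s = 1) (bound' : t'.bound = {y₀}) (P' : t'.P = Phase.scale half (Poly.X y₀))
      (O' : t'.O = 0) (D' : t'.D = ∅) (I' : t'.I = 0) : Step t t'

/-- Reduction in any number of steps. -/
def Reduces : DSOP V n m → DSOP V n m → Prop := Relation.ReflTransGen Step

/-- No rule applies. -/
def IsTerminal (t : DSOP V n m) : Prop := ∀ t', ¬ Step t t'

/-- Equality up to `α`-conversion, i.e. up to a renaming of the summation variables. -/
def AlphaEq (t t' : DSOP V n m) : Prop :=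
  ∃ σ : Equiv.Perm V, t'.s = t.s ∧ t'.bound = t.bound.image σ ∧ t'.P = t.P.rename σ ∧
    (t'.O = fun i => Poly.rename σ (t.O i)) ∧ t'.D = t.D.image (Poly.rename σ) ∧
    (t'.I = fun i => Poly.rename σ (t.I i))

end DSOP

end SumOverPaths

end

/-!
The entries of the interpretation are sums over the pairs of paths that have the given bits at the
legs and agree on the discarded polynomials. Every rule preserves these sums: it sums over `y₀`,
changes the summation variables, or affects neither the phases nor the agreement of two paths. It
also keeps the phase quadratic and the other polynomials affine. For the phase, use that it is
quadratic exactly when its third iterated differences vanish, a condition that is stable under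
affine substitutions.

A quadratic phase splits at each variable `y` as `y (c + Q / 2) + R` with `c ∈ {0, 1 / 4}`. Hence in
a terminal term every variable occurs in a leg, unless the term is the zero form: otherwise one of
(Elim), (HH), (ω), (Z), (H⏚) applies. The other rules force the discarded polynomials to be
variables and the first leg in which `y` occurs to be `y` itself, up to variables that are not
discarded if `y` is discarded. So the legs determine the path, and an entry of the interpretation is
either zero or a single phase. It then records which paths agree on the discarded variables and how
their phases differ; as (Z⏚) has removed the monomials in discarded variables, this determines the
phase. Matching variables with the same first leg is the required renaming.
-/

noncomputable section

open scoped Classical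

namespace SumOverPaths

universe u w

section Bits

theorem bit_eq_zero_or_one (x : ZMod 2) : x = 0 ∨ x = 1 := by
  revert x; decide

theorem bit_ne_one {x : ZMod 2} : x ≠ 1 ↔ x = 0 := by
  revert x; decide

theorem bit_ne_zero {x : ZMod 2} : x ≠ 0 ↔ x = 1 := by
  revert x; decide

end Bits

section Evaluation

variable {V : Type u} {M : Type w}

/-- A monomial holds at an assignment of bits when it takes the value `1` there. -/
def Mon.Holds (a : V → ZMod 2) (S : Mon V) : Prop := ∀ v ∈ S.vars, a v = 1

/-- The assignment of bits whose ones are the elements of a finite set. -/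
def bitsOf (T : Finset V) : V → ZMod 2 := fun v => if v ∈ T then 1 else 0

theorem Mon.holds_congr {a b : V → ZMod 2} {S : Mon V} (h : ∀ v ∈ S.vars, a v = b v) :
    S.Holds a ↔ S.Holds b :=
  forall₂_congr fun v hv => by rw [h v hv]

theorem Mon.holds_bitsOf {S : Mon V} {T : Finset V} : S.Holds (bitsOf T) ↔ S.vars ⊆ T :=
  forall₂_congr fun v _ => by simp [bitsOf]

theorem Mon.holds_one (a : V → ZMod 2) : (1 : Mon V).Holds a :=
  fun v hv => absurd hv (Finset.notMem_empty v)

theorem Mon.holds_mul {a : V → ZMod 2} {S T : Mon V} :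
    (S * T).Holds a ↔ S.Holds a ∧ T.Holds a :=
  Finset.forall_mem_union

theorem Mon.holds_of_singleton {a : V → ZMod 2} {v : V} : (Mon.of {v}).Holds a ↔ a v = 1 :=
  ⟨fun h => h v (Finset.mem_singleton_self v), fun h x hx => by
    rw [Finset.mem_singleton.1 hx, h]⟩

theorem Mon.holds_update_zero (a : V → ZMod 2) {v : V} {S : Mon V} :
    S.Holds (Function.update a v 0) ↔ v ∉ S.vars ∧ S.Holds a := by
  refine ⟨fun h => ?_, fun ⟨hv, h⟩ x hx => ?_⟩
  · have hv : v ∉ S.vars := fun hv => by simpa using h v hv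
    exact ⟨hv, fun x hx => by
      simpa [Function.update_of_ne (ne_of_mem_of_not_mem hx hv)] using h x hx⟩
  · rw [Function.update_of_ne (ne_of_mem_of_not_mem hx hv), h x hx]

theorem Mon.holds_update_one (a : V → ZMod 2) {v : V} {S : Mon V} :
    S.Holds (Function.update a v 1) ↔ (Mon.of (S.vars.erase v)).Holds a := by
  refine ⟨fun h x hx => ?_, fun h x hx => ?_⟩
  · obtain ⟨hne, hx⟩ := Finset.mem_erase.1 hx
    rw [← h x hx, Function.update_of_ne hne]
  · rcases eq_or_ne x v with rfl | hne
    · exact Function.update_self ..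
    · rw [Function.update_of_ne hne, h x (Finset.mem_erase.2 ⟨hne, hx⟩)]

theorem Mon.prod_bit_eq_ite {R : Type w} [CommSemiring R] (a : V → ZMod 2) (S : Mon V) :
    ∏ v ∈ S.vars, ((a v).val : R) = if S.Holds a then 1 else 0 := by
  split_ifs with h
  · exact Finset.prod_eq_one fun v hv => by simp [h v hv, ZMod.val_one]
  · obtain ⟨v, hv, hne⟩ : ∃ v ∈ S.vars, a v ≠ 1 := by simpa [Mon.Holds] using h
    exact Finset.prod_eq_zero hv (by simp [bit_ne_one.1 hne])

section AddCommMonoid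

variable [AddCommMonoid M]

/-- Evaluation at bits of the multilinear polynomial with given coefficients. The coefficients are
taken in an arbitrary commutative monoid, so as to cover polynomials as well as phases. -/
def evalBits (a : V → ZMod 2) : (Mon V →₀ M) →+ M :=
  Finsupp.liftAddHom fun S => if S.Holds a then AddMonoidHom.id M else 0

theorem evalBits_apply (a : V → ZMod 2) (f : Mon V →₀ M) :
    evalBits a f = f.sum fun S c => if S.Holds a then c else 0 :=
  Finsupp.sum_congr fun S _ => by beta_reduce; split_ifs <;> rfl

theorem evalBits_single (a : V → ZMod 2) (S : Mon V) (c : M) :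
    evalBits a (Finsupp.single S c) = if S.Holds a then c else 0 := by
  rw [evalBits_apply, Finsupp.sum_single_index]
  exact ite_self 0

theorem evalBits_congr {a b : V → ZMod 2} {f : Mon V →₀ M} (h : ∀ v ∈ coeffVars f, a v = b v) :
    evalBits a f = evalBits b f := by
  rw [evalBits_apply, evalBits_apply]
  refine Finset.sum_congr rfl fun S hS => ?_
  have hHolds : S.Holds a ↔ S.Holds b :=
    Mon.holds_congr fun v hv => h v (Finset.mem_biUnion.2 ⟨S, hS, hv⟩)
  simp only [hHolds]

theorem evalBits_eq_zero_of_forall_holds {f : Mon V →₀ M} {a : V → ZMod 2}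
    (h : ∀ S : Mon V, S.Holds a → f S = 0) : evalBits a f = 0 := by
  rw [evalBits_apply]
  refine Finset.sum_eq_zero fun S _ => ?_
  exact ite_eq_right_iff.2 (h S)

theorem eq_zero_of_evalBits_eq_zero {f : Mon V →₀ M} (h : ∀ a, evalBits a f = 0) : f = 0 := by
  by_contra hf
  obtain ⟨S, hS, hmin⟩ := Finset.exists_min_image f.support (fun S => S.vars.card)
    (Finsupp.support_nonempty_iff.2 hf)
  refine Finsupp.mem_support_iff.1 hS ?_
  -- By minimality, `S` is the only monomial of `f` that holds at `bitsOf S.vars`.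
  rw [← h (bitsOf S.vars), evalBits_apply, Finsupp.sum, Finset.sum_eq_single_of_mem S hS,
    if_pos (Mon.holds_bitsOf.2 subset_rfl)]
  intro T hT hne
  exact if_neg fun hle =>
    hne (Finset.eq_of_subset_of_card_le (Mon.holds_bitsOf.1 hle) (hmin T hT))

/-- The cofactor of the variable `v` in a multilinear polynomial `f = g + v * cofactor v f`: the
boolean partial derivative. -/
def cofactor (v : V) : (Mon V →₀ M) →+ (Mon V →₀ M) :=
  Finsupp.liftAddHom fun S =>
    if v ∈ S.vars then Finsupp.singleAddHom (Mon.of (S.vars.erase v)) else 0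

theorem cofactor_single (v : V) (S : Mon V) (c : M) :
    cofactor v (Finsupp.single S c) =
      if v ∈ S.vars then Finsupp.single (Mon.of (S.vars.erase v)) c else 0 := by
  rw [cofactor, Finsupp.liftAddHom_apply_single]
  split_ifs <;> rfl

theorem cofactor_apply (v : V) (f : Mon V →₀ M) (S : Mon V) :
    cofactor v f S = if v ∈ S.vars then 0 else f (Mon.of (insert v S.vars)) := by
  induction f using Finsupp.induction_linear with
  | zero => simp
  | add f g hf hg => rw [map_add, Finsupp.add_apply, hf, hg, Finsupp.add_apply]; split_ifs <;> simp
  | single T c =>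
    rw [cofactor_single]
    by_cases hT : v ∈ T.vars
    · rw [if_pos hT, Finsupp.single_apply, Finsupp.single_apply, ← ite_not (v ∈ S.vars), ← ite_and]
      refine if_congr ⟨?_, ?_⟩ rfl rfl
      · rintro rfl
        exact ⟨Finset.notMem_erase v _, (Finset.insert_erase hT).symm⟩
      · rintro ⟨hv, rfl⟩
        exact Finset.erase_insert hv
    · have hne : T ≠ Mon.of (insert v S.vars) := by
        rintro rfl
        exact hT (Finset.mem_insert_self v _)
      simp [hT, hne]

theorem apply_eq_cofactor {v : V} {S : Mon V} (hv : v ∈ S.vars) (f : Mon V →₀ M) :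
    f S = cofactor v f (Mon.of (S.vars.erase v)) := by
  refine Eq.trans ?_ ((cofactor_apply v f _).trans (if_neg (Finset.notMem_erase v _))).symm
  exact congrArg f (Finset.insert_erase hv).symm

end AddCommMonoid

section AddCommGroup

variable [AddCommGroup M]

theorem evalBits_injective {f g : Mon V →₀ M} (h : ∀ a, evalBits a f = evalBits a g) : f = g :=
  sub_eq_zero.1 (eq_zero_of_evalBits_eq_zero fun a => by rw [map_sub, h a, sub_self])

theorem evalBits_cofactor (a : V → ZMod 2) (v : V) (f : Mon V →₀ M) :
    evalBits a (cofactor v f) =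
      evalBits (Function.update a v 1) f - evalBits (Function.update a v 0) f := by
  induction f using Finsupp.induction_linear with
  | zero => simp
  | add f g hf hg => simp only [map_add, hf, hg]; abel
  | single S c =>
    simp only [cofactor_single, evalBits_single, Mon.holds_update_zero, Mon.holds_update_one]
    by_cases hv : v ∈ S.vars
    · simp [hv, evalBits_single]
    · have hS : Mon.of (S.vars.erase v) = S := Finset.erase_eq_of_notMem hv
      simp only [hv, hS, if_false, map_zero, not_false_eq_true, true_and, sub_self]

theorem notMem_coeffVars_iff {f : Mon V →₀ M} {v : V} :
    v ∉ coeffVars f ↔ ∀ a c, evalBits (Function.update a v c) f = evalBits a f := by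
  refine ⟨fun h a c => evalBits_congr fun x hx => ?_, fun h hv => ?_⟩
  · exact Function.update_of_ne (ne_of_mem_of_not_mem hx h) ..
  · have hcofactor : cofactor v f = 0 :=
      eq_zero_of_evalBits_eq_zero fun a => by rw [evalBits_cofactor, h, h, sub_self]
    obtain ⟨S, hS, hvS⟩ := mem_coeffVars.1 hv
    exact hS (by rw [apply_eq_cofactor hvS, hcofactor, Finsupp.zero_apply])

theorem coeffVars_subset_iff {f : Mon V →₀ M} {B : Finset V} :
    coeffVars f ⊆ B ↔
      ∀ a b : V → ZMod 2, (∀ v ∈ B, a v = b v) → evalBits a f = evalBits b f := by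
  refine ⟨fun h a b hab => evalBits_congr fun v hv => hab v (h hv), fun h v hv => ?_⟩
  by_contra hvB
  refine notMem_coeffVars_iff.2 (fun a c => h _ _ fun x hx => ?_) hv
  exact Function.update_of_ne (ne_of_mem_of_not_mem hx hvB) ..

end AddCommGroup

end Evaluation

namespace Poly

variable {V W : Type u} {R : Type w} [CommRing R]

/-- Evaluation of polynomials at bits, as a homomorphism of algebras. -/
def value (a : V → ZMod 2) : Poly V R →ₐ[R] R :=
  MonoidAlgebra.lift R R (Mon V)
    { toFun := fun S => if S.Holds a then 1 else 0
      map_one' := if_pos (Mon.holds_one a)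
      map_mul' := fun S T => by simp only [Mon.holds_mul, ite_and]; split_ifs <;> simp }

theorem value_eq_evalBits (a : V → ZMod 2) (p : Poly V R) : value a p = evalBits a p.coeff := by
  rw [value, MonoidAlgebra.lift_apply, evalBits_apply]
  exact Finsupp.sum_congr fun S _ => smul_ite_zero .. |>.trans (by simp)

theorem value_single (a : V → ZMod 2) (S : Mon V) (c : R) :
    value a (MonoidAlgebra.single S c) = if S.Holds a then c else 0 := by
  rw [value_eq_evalBits, MonoidAlgebra.coeff_single, evalBits_single]

theorem value_injective {p q : Poly V R} (h : ∀ a, value a p = value a q) : p = q :=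
  MonoidAlgebra.coeff_injective <| evalBits_injective fun a => by
    rw [← value_eq_evalBits, ← value_eq_evalBits, h]

theorem value_X (a : V → ZMod 2) (v : V) : value a (X v : Poly V R) = ((a v).val : R) := by
  rw [X, value_single]
  rcases bit_eq_zero_or_one (a v) with h | h <;> simp [Mon.holds_of_singleton, h, ZMod.val_one]

theorem value_X_bit (a : V → ZMod 2) (v : V) : value a (X v : BPoly V) = a v := by
  rw [value_X, ZMod.natCast_zmod_val]

theorem value_congr {a b : V → ZMod 2} {p : Poly V R} (h : ∀ v ∈ vars p, a v = b v) :
    value a p = value b p := by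
  rw [value_eq_evalBits, value_eq_evalBits]; exact evalBits_congr h

theorem notMem_vars_iff {p : Poly V R} {v : V} :
    v ∉ vars p ↔ ∀ a c, value (Function.update a v c) p = value a p := by
  simp only [value_eq_evalBits]; exact notMem_coeffVars_iff

theorem vars_subset_iff {p : Poly V R} {B : Finset V} :
    vars p ⊆ B ↔ ∀ a b : V → ZMod 2, (∀ v ∈ B, a v = b v) → value a p = value b p := by
  simp only [value_eq_evalBits]; exact coeffVars_subset_iff

theorem mem_monomials {p : Poly V R} {S : Mon V} : S ∈ monomials p ↔ p.coeff S ≠ 0 :=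
  Finsupp.mem_support_iff

theorem mem_vars {p : Poly V R} {v : V} : v ∈ vars p ↔ ∃ S, p.coeff S ≠ 0 ∧ v ∈ S.vars :=
  mem_coeffVars

theorem value_prod_eq_ite {a : W → ZMod 2} {f : V → Poly W R} {b : V → ZMod 2}
    (hf : ∀ v, value a (f v) = ((b v).val : R)) (S : Mon V) :
    value a (∏ v ∈ S.vars, f v) = if S.Holds b then 1 else 0 := by
  rw [map_prod, Finset.prod_congr rfl fun v _ => hf v, Mon.prod_bit_eq_ite]

theorem value_bind {a : W → ZMod 2} {f : V → Poly W R} {b : V → ZMod 2}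
    (hf : ∀ v, value a (f v) = ((b v).val : R)) (p : Poly V R) :
    value a (bind f p) = value b p := by
  rw [bind, Finsupp.sum, map_sum, value_eq_evalBits b, evalBits_apply]
  exact Finset.sum_congr rfl fun S _ => by simp [value_prod_eq_ite hf]

theorem value_rename (a : W → ZMod 2) (f : V → W) (p : Poly V R) :
    value a (rename f p) = value (fun v => a (f v)) p :=
  value_bind (fun _ => value_X ..) p

theorem value_subst (a : V → ZMod 2) (y : V) (q p : BPoly V) :
    value a (subst y q p) = value (Function.update a y (value a q)) p := by
  refine value_bind (fun v => ?_) p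
  rcases eq_or_ne v y with rfl | h
  · simp
  · simp [h, value_X_bit]

theorem eval_eq_value (a : V → ZMod 2) (p : BPoly V) : eval a p = value a p := by
  rw [value_eq_evalBits, evalBits_apply, eval]
  refine Finsupp.sum_congr fun S _ => ?_
  have hprod : ∏ v ∈ S.vars, a v = if S.Holds a then 1 else 0 := by
    simpa only [ZMod.natCast_zmod_val] using Mon.prod_bit_eq_ite (R := ZMod 2) a S
  simp [hprod]

end Poly

open SumOverPaths.Poly

section Hat

variable {V W : Type u}

theorem BPoly.eq_sum_monomials (p : BPoly V) :
    p = ∑ S ∈ monomials p, MonoidAlgebra.single S 1 := by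
  conv_lhs => rw [← MonoidAlgebra.sum_coeff_single p]
  exact Finset.sum_congr rfl fun S hS => by rw [bit_ne_zero.1 (mem_monomials.1 hS)]

theorem value_xorOp {a : V → ZMod 2} {p q : IPoly V} {x y : ZMod 2}
    (hp : value a p = (x.val : ℤ)) (hq : value a q = (y.val : ℤ)) :
    value a (xorOp p q) = ((x + y).val : ℤ) := by
  rw [xorOp, map_sub, map_add, map_mul, map_mul, map_ofNat, hp, hq]
  clear hp hq
  revert x y; decide

theorem BPoly.value_hat (a : V → ZMod 2) (Q : BPoly V) :
    value a (BPoly.hat Q) = ((value a Q).val : ℤ) := by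
  have hfold : ∀ s : Finset (Mon V),
      value a (s.fold xorOp 0 fun S => (MonoidAlgebra.single S 1 : IPoly V)) =
        ((value a (∑ S ∈ s, (MonoidAlgebra.single S 1 : BPoly V))).val : ℤ) := by
    intro s
    induction s using Finset.induction_on with
    | empty => simp
    | insert S s hS ih =>
      rw [Finset.fold_insert hS, Finset.sum_insert hS, map_add]
      refine value_xorOp ?_ ih
      rw [value_single, value_single]
      split_ifs <;> simp [ZMod.val_one]
  conv_rhs => rw [BPoly.eq_sum_monomials Q]
  exact hfold _

theorem Phase.eval_eq_evalBits (a : V → ZMod 2) (P : Phase V) :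
    Phase.eval a P = evalBits a P := by
  rw [evalBits_apply, Phase.eval]
  refine Finsupp.sum_congr fun S _ => ?_
  have hprod := Mon.prod_bit_eq_ite (R := ℕ) a S
  simp only [Nat.cast_id] at hprod
  simp [hprod]

theorem Phase.evalBits_scale (a : V → ZMod 2) (α : UnitAddCircle) (p : IPoly V) :
    evalBits a (Phase.scale α p) = value a p • α := by
  rw [value_eq_evalBits, evalBits_apply, evalBits_apply, Phase.scale,
    Finsupp.sum_mapRange_index (fun _ => by simp), Finsupp.sum, Finsupp.sum, Finset.sum_smul]
  exact Finset.sum_congr rfl fun S _ => by split_ifs <;> simp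

theorem Phase.evalBits_bind {a : W → ZMod 2} {f : V → IPoly W} {b : V → ZMod 2}
    (hf : ∀ v, value a (f v) = ((b v).val : ℤ)) (P : Phase V) :
    evalBits a (Phase.bind f P) = evalBits b P := by
  rw [Phase.bind, Finsupp.sum, map_sum, evalBits_apply b]
  exact Finset.sum_congr rfl fun S _ => by simp [Phase.evalBits_scale, value_prod_eq_ite hf]

theorem Phase.evalBits_subst (a : V → ZMod 2) (y : V) (q : BPoly V) (P : Phase V) :
    evalBits a (Phase.subst y (BPoly.hat q) P) =
      evalBits (Function.update a y (value a q)) P := by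
  refine Phase.evalBits_bind (fun v => ?_) P
  rcases eq_or_ne v y with rfl | h
  · simp [BPoly.value_hat]
  · simp [h, value_X]

theorem Phase.evalBits_rename (a : W → ZMod 2) (f : V → W) (P : Phase V) :
    evalBits a (Phase.rename f P) = evalBits (fun v => a (f v)) P :=
  Phase.evalBits_bind (fun _ => value_X ..) P

end Hat

section PhaseChar

/-- The character `x ↦ e ^ (2 π i x)` by which phases act on amplitudes. -/
def phaseChar : AddChar UnitAddCircle ℂ := Circle.coeHom.compAddChar AddCircle.toCircle_addChar

theorem phaseChar_coe (x : ℝ) :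
    phaseChar (x : UnitAddCircle) = Complex.exp (2 * Real.pi * x * Complex.I) := by
  change ((AddCircle.toCircle (x : UnitAddCircle) : Circle) : ℂ) = _
  rw [AddCircle.toCircle_apply_mk, Circle.coe_exp]
  norm_num

theorem phaseChar_mul_conj (x y : UnitAddCircle) :
    phaseChar x * (starRingEnd ℂ) (phaseChar y) = phaseChar (x - y) := by
  have hconj : (starRingEnd ℂ) (phaseChar y) = phaseChar (-y) := by
    change (starRingEnd ℂ) (AddCircle.toCircle y : ℂ) = (AddCircle.toCircle (-y) : ℂ)
    rw [AddCircle.toCircle_neg, Circle.coe_inv_eq_conj]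
  rw [hconj, ← AddChar.map_add_eq_mul, sub_eq_add_neg]

theorem phaseChar_ne_zero (x : UnitAddCircle) : phaseChar x ≠ 0 := Circle.coe_ne_zero _

theorem phaseChar_injective : Function.Injective phaseChar := fun _ _ h =>
  AddCircle.injective_toCircle one_ne_zero (Circle.coe_injective h)

theorem phaseChar_sum {ι : Type*} (s : Finset ι) (f : ι → UnitAddCircle) :
    phaseChar (∑ i ∈ s, f i) = ∏ i ∈ s, phaseChar (f i) :=
  map_prod phaseChar.toMonoidHom (fun i => Multiplicative.ofAdd (f i)) s

theorem half_add_half : half + half = 0 := by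
  rw [half, ← AddCircle.coe_add]
  norm_num

theorem two_nsmul_half : 2 • half = 0 := by rw [two_nsmul, half_add_half]

theorem two_nsmul_quarter : 2 • quarter = half := by
  rw [two_nsmul, quarter, half, ← AddCircle.coe_add]
  norm_num

theorem four_nsmul_quarter : 4 • quarter = 0 := by
  rw [show 4 = 2 * 2 from rfl, mul_nsmul', two_nsmul_quarter, two_nsmul_half]

theorem eight_nsmul_eighth : 8 • eighth = 0 := by
  have htwo : 2 • eighth = quarter := by
    rw [two_nsmul, eighth, quarter, ← AddCircle.coe_add]
    norm_num
  rw [show 8 = 4 * 2 from rfl, mul_nsmul', htwo, four_nsmul_quarter]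

theorem phaseChar_half : phaseChar half = -1 := by
  have hangle : (2 * Real.pi * (1 / 2 : ℝ) * Complex.I : ℂ) = Real.pi * Complex.I := by
    push_cast; ring
  rw [half, phaseChar_coe, hangle, Complex.exp_pi_mul_I]

theorem phaseChar_quarter : phaseChar quarter = Complex.I := by
  have hangle : (2 * Real.pi * (1 / 4 : ℝ) * Complex.I : ℂ) = Real.pi / 2 * Complex.I := by
    push_cast; ring
  rw [quarter, phaseChar_coe, hangle, Complex.exp_pi_div_two_mul_I]

theorem sqrt_two_mul_phaseChar_eighth :
    (Real.sqrt 2 : ℂ) * phaseChar eighth = 1 + Complex.I := by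
  have hangle : (2 * Real.pi * (1 / 8 : ℝ) * Complex.I : ℂ) =
      ((Real.pi / 4 : ℝ) : ℂ) * Complex.I := by push_cast; ring
  have hsqrt : (Real.sqrt 2 : ℂ) * (Real.sqrt 2 : ℂ) = 2 := by
    exact_mod_cast Real.mul_self_sqrt zero_le_two
  rw [eighth, phaseChar_coe, hangle, Complex.exp_mul_I, ← Complex.ofReal_cos,
    ← Complex.ofReal_sin, Real.cos_pi_div_four, Real.sin_pi_div_four]
  push_cast
  linear_combination (1 + Complex.I) / 2 * hsqrt

theorem half_ne_zero : half ≠ 0 := fun h => by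
  have hneg := phaseChar_half
  rw [h, AddChar.map_zero_eq_one] at hneg
  norm_num at hneg

theorem eq_zero_or_eq_half {c : UnitAddCircle} (h : 2 • c = 0) : c = 0 ∨ c = half := by
  have hsq : phaseChar c * phaseChar c = 1 := by
    rw [← AddChar.map_add_eq_mul, ← two_nsmul, h, AddChar.map_zero_eq_one]
  rcases mul_self_eq_one_iff.1 hsq with hone | hneg
  · exact Or.inl (phaseChar_injective (hone.trans (AddChar.map_zero_eq_one _).symm))
  · exact Or.inr (phaseChar_injective (hneg.trans phaseChar_half.symm))

/-- The embedding of bits into phases that sends `1` to `1 / 2`. -/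
def halfHom : ZMod 2 →+ UnitAddCircle where
  toFun x := x.val • half
  map_zero' := by simp
  map_add' x y := by
    rw [← add_nsmul, ZMod.val_add, ← nsmul_eq_mod_nsmul _ two_nsmul_half]

theorem halfHom_apply (x : ZMod 2) : halfHom x = x.val • half := rfl

theorem halfHom_one : halfHom 1 = half := by rw [halfHom_apply, ZMod.val_one, one_smul]

theorem halfHom_injective : Function.Injective halfHom := by
  refine (injective_iff_map_eq_zero _).2 fun x hx => ?_
  by_contra hne
  rw [bit_ne_zero.1 hne, halfHom_one] at hx
  exact half_ne_zero hx

theorem one_add_phaseChar_halfHom (x y : ZMod 2) :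
    1 + phaseChar (halfHom (x + y)) = if x = y then 2 else 0 := by
  split_ifs with h
  · rw [h, CharTwo.add_self_eq_zero, map_zero, AddChar.map_zero_eq_one, one_add_one_eq_two]
  · have hone : x + y = 1 := by revert x y; decide
    rw [hone, halfHom_one, phaseChar_half, add_neg_cancel]

theorem one_add_phaseChar_quarter (x : ZMod 2) :
    1 + phaseChar (quarter + halfHom x) =
      (Real.sqrt 2 : ℂ) * phaseChar (eighth - x.val • quarter) := by
  rcases bit_eq_zero_or_one x with rfl | rfl
  · simp [phaseChar_quarter, sqrt_two_mul_phaseChar_eighth]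
  · rw [halfHom_one, ZMod.val_one, one_smul, AddChar.map_add_eq_mul, ← phaseChar_mul_conj,
      ← mul_assoc, sqrt_two_mul_phaseChar_eighth, phaseChar_quarter, phaseChar_half,
      Complex.conj_I]
    linear_combination Complex.I_mul_I

end PhaseChar

section SumPaths

variable {V : Type u}

section AddCommMonoid

variable {M : Type w} [AddCommMonoid M]

/-- The sum of `g` over the assignments of bits to the variables in `B`, the other variables being
set to `0`. -/
def sumPaths (B : Finset V) (g : (V → ZMod 2) → M) : M := ∑ T ∈ B.powerset, g (bitsOf T)

theorem bitsOf_filter_eq_one {B : Finset V} {b : V → ZMod 2} (h : ∀ v ∉ B, b v = 0) :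
    bitsOf (B.filter fun v => b v = 1) = b := by
  funext v
  by_cases hv : v ∈ B
  · rcases bit_eq_zero_or_one (b v) with hb | hb <;> simp [bitsOf, hv, hb]
  · simp [bitsOf, hv, h v hv]

theorem sumPaths_eq_single {B : Finset V} {a : V → ZMod 2} {g : (V → ZMod 2) → M}
    (h₀ : ∀ b, ¬ Set.EqOn b a B → g b = 0) (h₁ : ∀ b, Set.EqOn b a B → g b = g a) :
    sumPaths B g = g a := by
  have heqOn : Set.EqOn (bitsOf (B.filter fun v => a v = 1)) a B := fun v hv => by
    rcases bit_eq_zero_or_one (a v) with h | h <;> simp [bitsOf, Finset.mem_coe.1 hv, h]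
  refine (Finset.sum_eq_single (B.filter fun v => a v = 1) (fun T hT hne => h₀ _ fun h => hne ?_)
    fun hB => absurd (Finset.mem_powerset.2 (Finset.filter_subset _ _)) hB).trans (h₁ _ heqOn)
  refine Finset.ext fun v => ⟨fun hv => ?_, fun hv => ?_⟩
  · have hvB := Finset.mem_powerset.1 hT hv
    exact Finset.mem_filter.2 ⟨hvB, (h hvB).symm.trans (if_pos hv)⟩
  · obtain ⟨hvB, hone⟩ := Finset.mem_filter.1 hv
    by_contra hvT
    exact zero_ne_one (((if_neg hvT).symm.trans (h hvB)).trans hone)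

theorem sum_extend (B : Finset V) (g : (V → ZMod 2) → M) :
    ∑ a : B → ZMod 2, g (extend B a) = sumPaths B g := by
  have hbits : ∀ a : B → ZMod 2, bitsOf (B.filter fun v => extend B a v = 1) = extend B a :=
    fun a => bitsOf_filter_eq_one fun v hv => dif_neg hv
  refine Finset.sum_bij' (fun a _ => B.filter fun v => extend B a v = 1) (fun T _ v => bitsOf T v)
    (fun a _ => Finset.mem_powerset.2 (Finset.filter_subset _ _)) (fun _ _ => Finset.mem_univ _)
    (fun a _ => ?_) (fun T hT => ?_) fun a _ => by rw [hbits]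
  · funext v
    rw [hbits, extend, dif_pos v.2]
  · refine Finset.ext fun v => Finset.mem_filter.trans ⟨fun ⟨hv, h⟩ => ?_, fun hv => ?_⟩
    · simpa [extend, bitsOf, hv] using h
    · simp [extend, bitsOf, hv, Finset.mem_powerset.1 hT hv]

theorem sumPaths_zero (B : Finset V) : (sumPaths B fun _ => (0 : M)) = 0 :=
  Finset.sum_const_zero

theorem sumPaths_add (B : Finset V) (g g' : (V → ZMod 2) → M) :
    (sumPaths B fun a => g a + g' a) = sumPaths B g + sumPaths B g' := Finset.sum_add_distrib

theorem sumPaths_congr {B : Finset V} {g g' : (V → ZMod 2) → M} (h : ∀ a, g a = g' a) :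
    sumPaths B g = sumPaths B g' := congrArg (sumPaths B) (funext h)

theorem bitsOf_insert (T : Finset V) (y : V) :
    bitsOf (insert y T) = Function.update (bitsOf T) y 1 := by
  funext v
  rcases eq_or_ne v y with rfl | h <;> simp [bitsOf, *]

theorem sumPaths_erase {B : Finset V} {y : V} (hy : y ∈ B) (g : (V → ZMod 2) → M) :
    sumPaths B g =
      sumPaths (B.erase y) fun a => g (Function.update a y 0) + g (Function.update a y 1) := by
  conv_lhs => rw [sumPaths, ← Finset.insert_erase hy,
    Finset.sum_powerset_insert (Finset.notMem_erase y B), ← Finset.sum_add_distrib]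
  refine Finset.sum_congr rfl fun T hT => ?_
  have hyT : y ∉ T := fun h => Finset.notMem_erase y B (Finset.mem_powerset.1 hT h)
  have hzero : Function.update (bitsOf T) y 0 = bitsOf T :=
    Function.update_eq_self_iff.2 (if_neg hyT).symm
  beta_reduce
  rw [bitsOf_insert, hzero]

theorem sumPaths_disjSum {V₁ V₂ : Type u} (A : Finset V₁) (B : Finset V₂)
    (g : (V₁ ⊕ V₂ → ZMod 2) → M) :
    sumPaths (A.disjSum B) g = sumPaths A fun a => sumPaths B fun b => g (Sum.elim a b) := by
  refine Eq.trans (Finset.sum_bij' (fun T _ => (T.toLeft, T.toRight)) (fun p _ => p.1.disjSum p.2)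
    (fun T hT => ?_) (fun p hp => ?_) (fun T _ => Finset.toLeft_disjSum_toRight)
    (fun p _ => by simp) fun T _ => ?_) (Finset.sum_product' A.powerset B.powerset fun S T =>
      g (Sum.elim (bitsOf S) (bitsOf T)))
  · obtain ⟨hA, hB⟩ := Finset.subset_disjSum.1 (Finset.mem_powerset.1 hT)
    exact Finset.mk_mem_product (Finset.mem_powerset.2 hA) (Finset.mem_powerset.2 hB)
  · obtain ⟨hA, hB⟩ := Finset.mem_product.1 hp
    exact Finset.mem_powerset.2
      (Finset.disjSum_mono (Finset.mem_powerset.1 hA) (Finset.mem_powerset.1 hB))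
  · congr 1
    funext v
    rcases v with v | v <;> simp [bitsOf]

theorem sumPaths_shift {B : Finset V} {y : V} (hy : y ∈ B) {q : BPoly V} (hq : y ∉ vars q)
    (g : (V → ZMod 2) → M) :
    (sumPaths B fun a => g (Function.update a y (a y + value a q))) = sumPaths B g := by
  rw [sumPaths_erase hy, sumPaths_erase hy g]
  refine sumPaths_congr fun a => ?_
  simp only [notMem_vars_iff.1 hq, Function.update_self, Function.update_idem]
  rcases bit_eq_zero_or_one (value a q) with h | h
  · simp [h]
  · rw [h, zero_add, CharTwo.add_self_eq_zero, add_comm]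

end AddCommMonoid

theorem sumPaths_mul_left {R : Type w} [NonUnitalNonAssocSemiring R] (B : Finset V) (c : R)
    (g : (V → ZMod 2) → R) : (sumPaths B fun a => c * g a) = c * sumPaths B g :=
  (Finset.mul_sum ..).symm

theorem map_sumPaths {M N F : Type*} [AddCommMonoid M] [AddCommMonoid N] [FunLike F M N]
    [AddMonoidHomClass F M N] (φ : F) (B : Finset V) (g : (V → ZMod 2) → M) :
    φ (sumPaths B g) = sumPaths B fun a => φ (g a) := map_sum ..

theorem sumPaths_prod {R : Type w} [CommSemiring R] (B : Finset V) (x : V → R) :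
    (sumPaths B fun a => ∏ v ∈ B, if a v = 1 then x v else 1) = ∏ v ∈ B, (1 + x v) := by
  rw [Finset.prod_one_add]
  refine Finset.sum_congr rfl fun T hT => ?_
  beta_reduce
  rw [← Finset.prod_subset (Finset.mem_powerset.1 hT) fun v _ hv => by simp [bitsOf, hv]]
  exact Finset.prod_congr rfl fun v hv => by simp [bitsOf, hv]

end SumPaths

theorem SOP.interp_apply {V : Type u} {n m : ℕ} (t : SOP V n m) (z : Fin m → ZMod 2)
    (w : Fin n → ZMod 2) :
    t.interp z w = (t.s : ℂ) * sumPaths t.bound fun a =>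
      if (∀ i, value a (t.O i) = z i) ∧ (∀ i, value a (t.I i) = w i)
        then phaseChar (evalBits a t.P) else 0 := by
  rw [SOP.interp, Matrix.smul_apply, Matrix.sum_apply, ← sum_extend, smul_eq_mul]
  congr 1
  refine Finset.sum_congr rfl fun a _ => ?_
  rw [Matrix.single_apply]
  simp only [funext_iff, eval_eq_value, Phase.eval_eq_evalBits]
  rfl

namespace DSOP

section Density

variable {V : Type u} {n m : ℕ}

/-- The outputs of a morphism followed by its inputs. -/
def legs (t : DSOP V n m) : Fin (m + n) → BPoly V := Fin.append t.O t.I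

theorem legs_castAdd (t : DSOP V n m) (i : Fin m) : t.legs (Fin.castAdd n i) = t.O i :=
  Fin.append_left ..

theorem legs_natAdd (t : DSOP V n m) (i : Fin n) : t.legs (Fin.natAdd m i) = t.I i :=
  Fin.append_right ..

/-- The pairs of paths `a`, `b` that contribute to the entry of index `x₁`, `x₂` of the
interpretation: their legs are `x₁` and `x₂`, and they agree on the discarded polynomials. -/
def Contributes (t : DSOP V n m) (x₁ x₂ : Fin (m + n) → ZMod 2) (a b : V → ZMod 2) : Prop :=
  (∀ i, value a (t.legs i) = x₁ i) ∧ (∀ i, value b (t.legs i) = x₂ i) ∧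
    ∀ d ∈ t.D, value a d = value b d

/-- The entries of the interpretation, indexed by the bits of the legs of the two copies of the
morphism, and with the fresh variables of the CPM construction summed out. -/
def density (t : DSOP V n m) (x₁ x₂ : Fin (m + n) → ZMod 2) : ℂ :=
  (t.s : ℂ) ^ 2 * sumPaths t.bound fun a => sumPaths t.bound fun b =>
    phaseChar (evalBits a t.P) * (starRingEnd ℂ) (phaseChar (evalBits b t.P)) *
      if t.Contributes x₁ x₂ a b then 1 else 0

/-- The assignment of the variables of the CPM construction made of two paths and of the bits of
the fresh variables. -/
def cpmPath (a b : V → ZMod 2) (z : BPoly V → ZMod 2) : CPMVar V → ZMod 2 :=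
  Sum.elim a (Sum.elim b z)

theorem sumPaths_cpmBound (t : DSOP V n m) (g : (CPMVar V → ZMod 2) → ℂ) :
    sumPaths t.cpmBound g = sumPaths t.bound fun a => sumPaths t.bound fun b =>
      sumPaths t.D fun z => g (cpmPath a b z) :=
  (sumPaths_disjSum t.bound (t.bound.disjSum t.D) g).trans <| sumPaths_congr fun a =>
    sumPaths_disjSum t.bound t.D fun b => g (Sum.elim a b)

theorem value_cpmPath_append_iff {k : ℕ} (f : Fin k → BPoly V) (a b : V → ZMod 2)
    (z : BPoly V → ZMod 2) (z₁ z₂ : Fin k → ZMod 2) :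
    (∀ i, value (cpmPath a b z) (Fin.append (fun j => Poly.rename copy₁ (f j))
      (fun j => Poly.rename copy₂ (f j)) i) = Fin.append z₁ z₂ i) ↔
    (∀ j, value a (f j) = z₁ j) ∧ ∀ j, value b (f j) = z₂ j := by
  rw [Fin.forall_fin_add]
  simp only [Fin.append_left, Fin.append_right, value_rename]
  rfl

theorem evalBits_cpmPhase (t : DSOP V n m) (a b : V → ZMod 2) (z : BPoly V → ZMod 2) :
    evalBits (cpmPath a b z) t.cpmPhase = evalBits a t.P - evalBits b t.P +
      ∑ d ∈ t.D, if z d = 1 then halfHom (value a d + value b d) else 0 := by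
  have ha : (fun v => cpmPath a b z (copy₁ v)) = a := rfl
  have hb : (fun v => cpmPath a b z (copy₂ v)) = b := rfl
  have hz : ∀ d, cpmPath a b z (fresh d) = z d := fun _ => rfl
  rw [cpmPhase, map_add, map_sub, Phase.evalBits_rename, Phase.evalBits_rename, map_sum, ha, hb]
  congr 1
  refine Finset.sum_congr rfl fun d _ => ?_
  rw [Phase.evalBits_scale, map_add, map_mul, map_mul, value_rename, value_rename, value_X,
    BPoly.value_hat, BPoly.value_hat, ha, hb, hz, map_add, halfHom_apply, halfHom_apply]
  rcases bit_eq_zero_or_one (z d) with h | h <;>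
    simp [h, ZMod.val_one, add_smul, -ZMod.natCast_val]

theorem sumPaths_fresh (t : DSOP V n m) (a b : V → ZMod 2) :
    (sumPaths t.D fun z => phaseChar (evalBits (cpmPath a b z) t.cpmPhase)) =
      2 ^ t.D.card * (phaseChar (evalBits a t.P) * (starRingEnd ℂ) (phaseChar (evalBits b t.P)) *
        if ∀ d ∈ t.D, value a d = value b d then 1 else 0) := by
  simp only [evalBits_cpmPhase, AddChar.map_add_eq_mul, ← phaseChar_mul_conj, phaseChar_sum,
    apply_ite phaseChar, AddChar.map_zero_eq_one]
  rw [sumPaths_mul_left, sumPaths_prod,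
    Finset.prod_congr rfl fun d _ => one_add_phaseChar_halfHom _ _]
  split_ifs with hD
  · rw [Finset.prod_congr rfl fun d hd => if_pos (hD d hd), Finset.prod_const]
    ring
  · push Not at hD
    obtain ⟨d, hd, hne⟩ := hD
    rw [Finset.prod_eq_zero hd (if_neg hne)]
    ring

theorem contributes_iff (t : DSOP V n m) (x₁ x₂ : Fin (m + n) → ZMod 2) (a b : V → ZMod 2) :
    t.Contributes x₁ x₂ a b ↔
      (((∀ j, value a (t.O j) = x₁ (Fin.castAdd n j)) ∧
          ∀ j, value b (t.O j) = x₂ (Fin.castAdd n j)) ∧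
        (∀ j, value a (t.I j) = x₁ (Fin.natAdd m j)) ∧
          ∀ j, value b (t.I j) = x₂ (Fin.natAdd m j)) ∧
      ∀ d ∈ t.D, value a d = value b d := by
  rw [Contributes, Fin.forall_fin_add, Fin.forall_fin_add]
  simp only [legs_castAdd, legs_natAdd]
  tauto

theorem interp_append (t : DSOP V n m) (x₁ x₂ : Fin (m + n) → ZMod 2) :
    t.interp (Fin.append (fun i => x₁ (Fin.castAdd n i)) fun i => x₂ (Fin.castAdd n i))
      (Fin.append (fun i => x₁ (Fin.natAdd m i)) fun i => x₂ (Fin.natAdd m i)) =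
      t.density x₁ x₂ := by
  have hs : ((t.s ^ 2 / 2 ^ t.D.card : ℝ) : ℂ) * 2 ^ t.D.card = (t.s : ℂ) ^ 2 := by
    push_cast
    field_simp
  rw [interp, SOP.interp_apply]
  simp only [cpm]
  rw [sumPaths_cpmBound, density, ← hs, mul_assoc, ← sumPaths_mul_left _ (2 ^ t.D.card)]
  congr 1
  refine sumPaths_congr fun a => ?_
  rw [← sumPaths_mul_left _ (2 ^ t.D.card)]
  refine sumPaths_congr fun b => ?_
  simp only [value_cpmPath_append_iff, contributes_iff]
  split_ifs with hlegs hD hD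
  · rw [sumPaths_fresh, if_pos hD.2]
  · rw [sumPaths_fresh, if_neg fun h => hD ⟨hlegs, h⟩]
  · exact absurd hD.1 hlegs
  · simp only [mul_zero, sumPaths_zero]

theorem density_eq_of_interp_eq {t t' : DSOP V n m} (h : t.interp = t'.interp) :
    t.density = t'.density := by
  funext x₁ x₂
  rw [← interp_append, ← interp_append, h]

end Density

end DSOP

section DiffDegree

open scoped fwdDiff

variable {A M N : Type*} [AddCommGroup A] [AddCommGroup M] [AddCommGroup N]

/-- `F` is a nonclassical polynomial of degree less than `k`: its iterated differences of order `k`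
vanish. -/
def DiffDegreeLT : ℕ → (A → M) → Prop
  | 0, F => F = 0
  | k + 1, F => ∀ h, DiffDegreeLT k (Δ_[h] F)

namespace DiffDegreeLT

variable {k : ℕ} {F G : A → M}

theorem zero (k : ℕ) : DiffDegreeLT k fun _ : A => (0 : M) := by
  induction k with
  | zero => exact rfl
  | succ k ih => exact fun h => (fwdDiff_const h (0 : M)).symm ▸ ih

theorem mono {l : ℕ} (hkl : k ≤ l) (hF : DiffDegreeLT k F) : DiffDegreeLT l F := by
  induction k generalizing l F with
  | zero =>
    rw [show F = 0 from hF]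
    exact zero l
  | succ k ih =>
    obtain ⟨l, rfl⟩ := Nat.exists_eq_add_of_le' hkl
    exact fun h => ih (Nat.le_of_succ_le_succ hkl) (hF h)

theorem const (c : M) : DiffDegreeLT 1 fun _ : A => c := fun h => fwdDiff_const h c

theorem eq_const (hF : DiffDegreeLT 1 F) (x y : A) : F x = F y := by
  have hdiff := congrFun (hF (y - x)) x
  rw [fwdDiff, add_sub_cancel, Pi.zero_apply, sub_eq_zero] at hdiff
  exact hdiff.symm

theorem of_addMonoidHom (φ : A →+ M) : DiffDegreeLT 2 φ := fun h => by
  have hconst : Δ_[h] φ = fun _ => φ h :=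
    funext fun x => by rw [fwdDiff, map_add, add_sub_cancel_left]
  rw [hconst]
  exact const _

theorem add (hF : DiffDegreeLT k F) (hG : DiffDegreeLT k G) :
    DiffDegreeLT k fun x => F x + G x := by
  induction k generalizing F G with
  | zero => exact (congrArg₂ (· + ·) hF hG).trans (add_zero 0)
  | succ k ih =>
    intro h
    rw [show (fun x => F x + G x) = F + G from rfl, fwdDiff_add]
    exact ih (hF h) (hG h)

theorem map (φ : M →+ N) (hF : DiffDegreeLT k F) : DiffDegreeLT k fun x => φ (F x) := by
  induction k generalizing F with
  | zero => exact funext fun x => (congrArg φ (congrFun hF x)).trans (map_zero φ)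
  | succ k ih =>
    intro h
    have hdiff : (Δ_[h] fun x => φ (F x)) = fun x => φ (Δ_[h] F x) :=
      funext fun x => (map_sub φ _ _).symm
    rw [hdiff]
    exact ih (hF h)

theorem of_map {φ : M →+ N} (hφ : Function.Injective φ)
    (hF : DiffDegreeLT k fun x => φ (F x)) : DiffDegreeLT k F := by
  induction k generalizing F with
  | zero => exact funext fun x => hφ ((congrFun hF x).trans (map_zero φ).symm)
  | succ k ih =>
    refine fun h => ih ?_
    have hdiff : (fun x => φ (Δ_[h] F x)) = Δ_[h] fun x => φ (F x) :=
      funext fun x => map_sub φ _ _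
    rw [hdiff]
    exact hF h

theorem sub (hF : DiffDegreeLT k F) (hG : DiffDegreeLT k G) :
    DiffDegreeLT k fun x => F x - G x := by
  simp only [sub_eq_add_neg]
  exact hF.add (hG.map negAddMonoidHom)

theorem sum {ι : Type*} {s : Finset ι} {f : ι → A → M} (h : ∀ i ∈ s, DiffDegreeLT k (f i)) :
    DiffDegreeLT k fun x => ∑ i ∈ s, f i x := by
  rw [show (fun x => ∑ i ∈ s, f i x) = ∑ i ∈ s, f i from funext fun x => (s.sum_apply x f).symm]
  exact Finset.sum_induction f (DiffDegreeLT k) (fun _ _ => add) (zero k) h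

theorem pi {ι : Type*} {f : A → ι → M} (h : ∀ i, DiffDegreeLT k fun x => f x i) :
    DiffDegreeLT k f := by
  induction k generalizing f with
  | zero => exact funext fun x => funext fun i => congrFun (h i) x
  | succ k ih => exact fun d => ih fun i => h i d

theorem comp {B : Type*} [AddCommGroup B] {φ : B → A} (hF : DiffDegreeLT k F)
    (hφ : DiffDegreeLT 2 φ) : DiffDegreeLT k fun x => F (φ x) := by
  induction k generalizing F with
  | zero => exact funext fun x => congrFun hF (φ x)
  | succ k ih =>
    intro h
    have hdiff : (Δ_[h] fun x => F (φ x)) = fun x => Δ_[Δ_[h] φ 0] F (φ x) := funext fun x => by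
      rw [(hφ h).eq_const 0 x, fwdDiff, fwdDiff, fwdDiff, add_sub_cancel]
    rw [hdiff]
    exact ih (hF _)

theorem two_pow_nsmul_fwdDiff (hF : DiffDegreeLT (k + 1) F) {h : A} (hh : h + h = 0) (x : A) :
    2 ^ k • Δ_[h] F x = 0 := by
  induction k generalizing F with
  | zero => rw [hF h, Pi.zero_apply, smul_zero]
  | succ k ih =>
    have hdiff : Δ_[h] (Δ_[h] F) x = -(2 • Δ_[h] F x) := by
      rw [fwdDiff, fwdDiff, fwdDiff, add_assoc, hh, add_zero]
      abel
    rw [pow_succ, mul_smul, ← neg_eq_zero, ← smul_neg, ← hdiff]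
    exact ih (hF h)

/-- Multiplication by an affine bit raises the degree by one, provided that each multiplication of
`F` by `2` lowers it by one: the difference of `b • F` can involve `2 • F`. -/
theorem val_smul {b : A → ZMod 2} (hb : DiffDegreeLT 2 b)
    (hF : ∀ i j, i + j = k → DiffDegreeLT j fun x => 2 ^ i • F x) :
    DiffDegreeLT (k + 1) fun x => (b x).val • F x := by
  induction k generalizing F with
  | zero =>
    have hzero : ∀ x, F x = 0 := fun x => by simpa using congrFun (hF 0 0 rfl) x
    simpa only [hzero, smul_zero] using zero 1
  | succ k ih =>
    intro h
    have hF₁ : DiffDegreeLT (k + 1) F := by simpa using hF 0 (k + 1) (zero_add _)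
    have hdiff : DiffDegreeLT (k + 1) fun x => (b x).val • Δ_[h] F x := ih fun i j hij =>
      Eq.mp (congrArg (DiffDegreeLT j) (fwdDiff_const_smul h (2 ^ i) F))
        (hF i (j + 1) (by omega) h)
    have hb' : ∀ x, b (x + h) = Δ_[h] b 0 + b x := fun x => by
      rw [(hb h).eq_const 0 x, fwdDiff, sub_add_cancel]
    rcases bit_eq_zero_or_one (Δ_[h] b 0) with hβ | hβ
    · convert hdiff using 2 with x
      rw [fwdDiff, fwdDiff, hb', hβ, zero_add, smul_sub]
    · have hdouble : DiffDegreeLT (k + 1) fun x => (b x).val • 2 • F x := ih fun i j hij => by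
        simpa only [smul_smul, ← pow_succ] using hF (i + 1) j (by omega)
      convert ((hF₁.add ((hF₁ h).mono k.le_succ)).sub hdiff).sub hdouble using 2 with x
      rw [fwdDiff, fwdDiff, hb', hβ]
      rcases bit_eq_zero_or_one (b x) with hx | hx
      · simp [hx, ZMod.val_one]
      · simp [hx, ZMod.val_one, CharTwo.add_self_eq_zero]
        abel

end DiffDegreeLT

end DiffDegree

section Coefficients

open scoped fwdDiff

variable {V : Type u} {M : Type w} [AddCommGroup M]

theorem diffDegreeLT_apply (v : V) : DiffDegreeLT 2 fun a : V → ZMod 2 => a v :=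
  DiffDegreeLT.of_addMonoidHom (Pi.evalAddMonoidHom (fun _ : V => ZMod 2) v)

theorem diffDegreeLT_update {b : (V → ZMod 2) → ZMod 2} (hb : DiffDegreeLT 2 b) (y : V) :
    DiffDegreeLT 2 fun a => Function.update a y (b a) := by
  refine DiffDegreeLT.pi fun v => ?_
  rcases eq_or_ne v y with rfl | h
  · simpa only [Function.update_self] using hb
  · simpa only [Function.update_of_ne h] using diffDegreeLT_apply v

theorem fwdDiff_update_zero {N : Type*} [AddCommGroup N] (F : (V → ZMod 2) → N)
    (a : V → ZMod 2) (v : V) :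
    Δ_[Pi.single v 1] F (Function.update a v 0) =
      F (Function.update a v 1) - F (Function.update a v 0) := by
  have hadd : Function.update a v 0 + Pi.single v 1 = Function.update a v 1 := by
    funext x
    rcases eq_or_ne x v with rfl | h <;> simp [*]
  rw [fwdDiff, hadd]

theorem DiffDegreeLT.slope {k : ℕ} {F : (V → ZMod 2) → M} (hF : DiffDegreeLT (k + 1) F) (v : V) :
    DiffDegreeLT k fun a => F (Function.update a v 1) - F (Function.update a v 0) := by
  simpa only [fwdDiff_update_zero] using
    (hF (Pi.single v 1)).comp (diffDegreeLT_update ((DiffDegreeLT.const 0).mono one_le_two) v)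

theorem diffDegreeLT_evalBits_single {k : ℕ} (S : Finset V) {c : M} (hc : 2 ^ k • c = 0) :
    DiffDegreeLT (k + S.card) fun a => evalBits a (Finsupp.single (Mon.of S) c) := by
  simp only [evalBits_single]
  induction S using Finset.induction_on generalizing k c with
  | empty =>
    simp only [show ∀ a : V → ZMod 2, (Mon.of ∅).Holds a from Mon.holds_one, if_true]
    rcases k with - | k
    · exact funext fun _ => by simpa using hc
    · exact (DiffDegreeLT.const c).mono (by simp)
  | insert v S hv ih =>
    have hbit : (fun a : V → ZMod 2 => if (Mon.of (insert v S)).Holds a then c else 0) =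
        fun a => (a v).val • if (Mon.of S).Holds a then c else 0 := funext fun a => by
      have hholds : (Mon.of (insert v S)).Holds a ↔ a v = 1 ∧ (Mon.of S).Holds a :=
        Finset.forall_mem_insert ..
      rcases bit_eq_zero_or_one (a v) with h | h <;> simp [hholds, h, ZMod.val_one]
    rw [hbit, Finset.card_insert_of_notMem hv, ← add_assoc]
    refine (diffDegreeLT_apply v).val_smul fun i j hij => ?_
    simp only [smul_ite, smul_zero]
    rcases le_or_gt i k with hik | hki
    · convert ih (k := k - i) (c := 2 ^ i • c) ?_ using 1
      · omega
      · rwa [smul_smul, ← pow_add, Nat.sub_add_cancel hik]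
    · have hzero : 2 ^ i • c = 0 := by
        rw [← Nat.sub_add_cancel hki.le, pow_add, mul_smul, hc, smul_zero]
      simpa only [hzero, ite_self] using DiffDegreeLT.zero (A := V → ZMod 2) (M := M) j

theorem diffDegreeLT_evalBits {k : ℕ} {f : Mon V →₀ M}
    (h : ∀ S : Mon V, S.vars.Nonempty → 2 ^ (k + 1 - S.vars.card) • f S = 0) :
    DiffDegreeLT (k + 1) fun a => evalBits a f := by
  have hsum : (fun a => evalBits a f) =
      fun a : V → ZMod 2 => ∑ S ∈ f.support, evalBits a (Finsupp.single S (f S)) :=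
    funext fun a => by rw [← map_sum]; exact congrArg _ f.sum_single.symm
  rw [hsum]
  refine DiffDegreeLT.sum fun S hS => ?_
  rcases S.vars.eq_empty_or_nonempty with hempty | hne
  · have hone : S = 1 := hempty
    simp only [evalBits_single, hone, Mon.holds_one, if_true]
    exact (DiffDegreeLT.const _).mono (Nat.le_add_left 1 k)
  · have hcard : S.vars.card ≤ k + 1 := by
      by_contra! hlt
      refine Finsupp.mem_support_iff.1 hS ?_
      simpa [Nat.sub_eq_zero_of_le hlt.le] using h S hne
    exact Nat.sub_add_cancel hcard ▸ diffDegreeLT_evalBits_single S.vars (h S hne)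

theorem evalBits_zero (f : Mon V →₀ M) : evalBits 0 f = f 1 := by
  induction f using Finsupp.induction_linear with
  | zero => simp
  | add f g hf hg => rw [map_add, hf, hg, Finsupp.add_apply]
  | single S c =>
    have hholds : S.Holds 0 ↔ S = 1 :=
      ⟨fun h => Finset.eq_empty_of_forall_notMem fun v hv => zero_ne_one (h v hv),
        fun h => h ▸ Mon.holds_one 0⟩
    rw [evalBits_single, Finsupp.single_apply, if_congr hholds rfl rfl]

theorem DiffDegreeLT.two_pow_nsmul_coeff {k : ℕ} {f : Mon V →₀ M}
    (h : DiffDegreeLT (k + 1) fun a => evalBits a f) {S : Mon V} (hS : S.vars.Nonempty) :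
    2 ^ (k + 1 - S.vars.card) • f S = 0 := by
  induction k using Nat.strong_induction_on generalizing f S with | _ k ih
  obtain ⟨v, hv⟩ := hS
  have hcofactor : ∀ a, evalBits a (cofactor v f) =
      evalBits (Function.update a v 1) f - evalBits (Function.update a v 0) f :=
    fun a => evalBits_cofactor a v f
  have hcard : k + 1 - S.vars.card = k - (S.vars.erase v).card := by
    rw [Finset.card_erase_of_mem hv]
    have := Finset.card_pos.2 ⟨v, hv⟩
    omega
  rw [apply_eq_cofactor hv, hcard]
  rcases (S.vars.erase v).eq_empty_or_nonempty with hempty | hne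
  · rw [hempty, Finset.card_empty, Nat.sub_zero]
    change 2 ^ k • cofactor v f 1 = 0
    rw [← evalBits_zero, hcofactor, ← fwdDiff_update_zero fun a => evalBits a f]
    refine h.two_pow_nsmul_fwdDiff ?_ _
    rw [← Pi.single_add, CharTwo.add_self_eq_zero, Pi.single_zero]
  · have hslope : DiffDegreeLT k fun a => evalBits a (cofactor v f) := by
      simpa only [hcofactor] using h.slope v
    rcases k with - | k
    · rw [eq_zero_of_evalBits_eq_zero fun a => congrFun hslope a, Finsupp.zero_apply, smul_zero]
    · exact ih k k.lt_succ_self hslope hne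

end Coefficients

section LowDegree

variable {V : Type u}

theorem Poly.DegreeLE.coeff_eq_zero {R : Type w} [CommRing R] {p : Poly V R} {d : ℕ}
    (hp : DegreeLE p d) {S : Mon V} (hS : d < S.vars.card) : p.coeff S = 0 := by
  by_contra hne
  exact (hp S (mem_monomials.2 hne)).not_gt hS

theorem BPoly.add_self (p : BPoly V) : p + p = 0 := by
  rw [← two_nsmul, ← Nat.cast_smul_eq_nsmul (ZMod 2)]
  exact zero_smul _ p

theorem Poly.degreeLE_zero (d : ℕ) : DegreeLE (0 : BPoly V) d :=
  fun _ hS => absurd rfl (mem_monomials.1 hS)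

theorem Poly.DegreeLE.add {p q : BPoly V} {d : ℕ} (hp : DegreeLE p d) (hq : DegreeLE q d) :
    DegreeLE (p + q) d := fun S hS => by
  by_contra! hlt
  refine mem_monomials.1 hS ?_
  rw [MonoidAlgebra.coeff_add, Finsupp.add_apply, hp.coeff_eq_zero hlt, hq.coeff_eq_zero hlt,
    add_zero]

theorem Poly.DegreeLE.right_of_add {p q : BPoly V} {d : ℕ} (h : DegreeLE (p + q) d)
    (hpq : Disjoint (monomials p) (monomials q)) : DegreeLE q d := fun S hS => by
  refine h S (mem_monomials.2 ?_)
  have hp : p.coeff S = 0 := by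
    by_contra hne
    exact Finset.disjoint_left.1 hpq (mem_monomials.2 hne) hS
  rw [MonoidAlgebra.coeff_add, Finsupp.add_apply, hp, zero_add]
  exact mem_monomials.1 hS

theorem Poly.degreeLE_one_iff {p : BPoly V} :
    DegreeLE p 1 ↔ DiffDegreeLT 2 fun a => value a p := by
  simp only [value_eq_evalBits]
  refine ⟨fun hp => diffDegreeLT_evalBits fun S hS => ?_, fun h S hS => ?_⟩
  · rcases le_or_gt S.vars.card 1 with hle | hlt
    · rw [le_antisymm hle hS.card_pos, pow_one, two_nsmul, CharTwo.add_self_eq_zero]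
    · rw [hp.coeff_eq_zero hlt, smul_zero]
  · by_contra! hlt
    refine mem_monomials.1 hS ?_
    simpa [Nat.sub_eq_zero_of_le hlt] using
      h.two_pow_nsmul_coeff (Finset.card_pos.1 (zero_lt_one.trans hlt))

theorem Poly.degreeLE_X {R : Type w} [CommRing R] (v : V) : DegreeLE (X v : Poly V R) 1 :=
  fun _ hS => (Finset.card_le_card fun _ hx => vars_X v (mem_vars.2
    ⟨_, mem_monomials.1 hS, hx⟩)).trans_eq (Finset.card_singleton v)

theorem Poly.DegreeLE.subst {p q : BPoly V} (hp : DegreeLE p 1) (hq : DegreeLE q 1) (y : V) :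
    DegreeLE (subst y q p) 1 := by
  rw [degreeLE_one_iff] at *
  simpa only [value_subst] using hp.comp (diffDegreeLT_update hq y)

theorem Poly.DegreeLE.value_add {p : BPoly V} (hp : DegreeLE p 1) (a h : V → ZMod 2) :
    value (a + h) p = value a p + (value h p - value 0 p) := by
  have hconst := (degreeLE_one_iff.1 hp h).eq_const a 0
  simp only [fwdDiff, zero_add] at hconst
  rw [← hconst, add_sub_cancel]

/-- The phases of degree two of the Clifford hierarchy: the coefficients of the monomials of degree
`1`, of degree `2` and of higher degree are killed by `4`, `2` and `1`. The constant coefficient is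
arbitrary. -/
def Phase.IsQuadratic (P : Phase V) : Prop :=
  ∀ S : Mon V, S.vars.Nonempty → 2 ^ (3 - S.vars.card) • P S = 0

theorem Phase.isQuadratic_iff {P : Phase V} :
    P.IsQuadratic ↔ DiffDegreeLT 3 fun a => evalBits a P :=
  ⟨diffDegreeLT_evalBits, fun h _ => h.two_pow_nsmul_coeff⟩

namespace Phase.IsQuadratic

variable {P R : Phase V}

theorem add (hP : P.IsQuadratic) (hR : R.IsQuadratic) : (P + R).IsQuadratic := fun S hS => by
  rw [Finsupp.add_apply, smul_add, hP S hS, hR S hS, add_zero]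

theorem sub (hP : P.IsQuadratic) (hR : R.IsQuadratic) : (P - R).IsQuadratic := fun S hS => by
  rw [Finsupp.sub_apply, smul_sub, hP S hS, hR S hS, sub_zero]

theorem subst {Q : BPoly V} (hP : P.IsQuadratic) (hQ : Poly.DegreeLE Q 1) (y : V) :
    (P.subst y (BPoly.hat Q)).IsQuadratic := by
  rw [isQuadratic_iff] at *
  simpa only [Phase.evalBits_subst] using
    hP.comp (diffDegreeLT_update (Poly.degreeLE_one_iff.1 hQ) y)

theorem of_disjoint_add (h : (R + P).IsQuadratic) (hRP : Disjoint R.support P.support) :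
    R.IsQuadratic := fun S hS => by
  by_cases hR : R S = 0
  · rw [hR, smul_zero]
  · have hP : P S = 0 := Finsupp.notMem_support_iff.1 <|
      Finset.disjoint_left.1 hRP (Finsupp.mem_support_iff.2 hR)
    simpa only [Finsupp.add_apply, hP, add_zero] using h S hS

theorem scale {p : IPoly V} {k : ℕ} (hp : Poly.DegreeLE p k) {c : UnitAddCircle}
    (hc : 2 ^ (3 - k) • c = 0) : (Phase.scale c p).IsQuadratic := fun S _ => by
  change _ • p.coeff S • c = 0
  rcases lt_or_ge k S.vars.card with hlt | hle
  · rw [hp.coeff_eq_zero hlt, zero_smul, smul_zero]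
  · obtain ⟨r, hr⟩ := pow_dvd_pow 2 (Nat.sub_le_sub_left hle 3)
    rw [smul_comm, hr, mul_comm, mul_smul, hc, smul_zero, smul_zero]

theorem constant (c : UnitAddCircle) : (Phase.scale c (1 : IPoly V)).IsQuadratic :=
  isQuadratic_iff.2 <| by
    simp only [Phase.evalBits_scale, map_one, one_smul]
    exact (DiffDegreeLT.const c).mono (by norm_num)

theorem scale_hat {Q : BPoly V} (hQ : Poly.DegreeLE Q 1) {c : UnitAddCircle}
    (hc : 4 • c = 0) : (Phase.scale c (BPoly.hat Q)).IsQuadratic := by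
  rw [isQuadratic_iff]
  simp only [Phase.evalBits_scale, BPoly.value_hat, natCast_zsmul]
  refine (Poly.degreeLE_one_iff.1 hQ).val_smul fun i j hij => ?_
  rcases j with - | j
  · obtain rfl : i = 2 := hij
    exact funext fun _ => hc
  · exact (DiffDegreeLT.const _).mono (Nat.le_add_left 1 j)

end Phase.IsQuadratic

/-- `P` takes the value `y · (c + Q / 2) + R`, with `y` occurring neither in `Q` nor in `R`: the
form of the phases on which summing over `y` can be carried out. -/
structure Phase.SplitsAt (P : Phase V) (y : V) (c : UnitAddCircle) (Q : BPoly V) (R : Phase V) :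
    Prop where
  evalBits_eq : ∀ a, evalBits a P = (if a y = 1 then c + halfHom (value a Q) else 0) + evalBits a R
  notMem_vars : y ∉ Poly.vars Q
  notMem_rest : y ∉ R.vars

namespace Phase.SplitsAt

variable {P R : Phase V} {y : V} {c : UnitAddCircle} {Q : BPoly V}

theorem evalBits_update (h : P.SplitsAt y c Q R) (a : V → ZMod 2) (x : ZMod 2) :
    evalBits (Function.update a y x) P =
      (if x = 1 then c + halfHom (value a Q) else 0) + evalBits a R := by
  rw [h.evalBits_eq, notMem_coeffVars_iff.1 h.notMem_rest, notMem_vars_iff.1 h.notMem_vars,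
    Function.update_self]

theorem isQuadratic (h : P.SplitsAt y c Q R) (hP : P.IsQuadratic) : R.IsQuadratic := by
  have heval : (fun a => evalBits a R) = fun a => evalBits (Function.update a y 0) P :=
    funext fun a => by rw [h.evalBits_update, if_neg zero_ne_one, zero_add]
  rw [isQuadratic_iff, heval]
  exact (isQuadratic_iff.1 hP).comp (diffDegreeLT_update ((DiffDegreeLT.const 0).mono one_le_two) y)

theorem degreeLE (h : P.SplitsAt y c Q R) (hP : P.IsQuadratic) : Poly.DegreeLE Q 1 := by
  have hslope := (isQuadratic_iff.1 hP).slope y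
  simp only [h.evalBits_update, if_true, if_neg zero_ne_one, zero_add, add_sub_cancel_right]
    at hslope
  refine Poly.degreeLE_one_iff.2 (DiffDegreeLT.of_map halfHom_injective ?_)
  simpa only [add_sub_cancel_left] using hslope.sub ((DiffDegreeLT.const c).mono one_le_two)

theorem sumPaths_eq (h : P.SplitsAt y c Q R) {B : Finset V} (hy : y ∈ B)
    {g : (V → ZMod 2) → ℂ} (hg : ∀ a x, g (Function.update a y x) = g a) :
    (sumPaths B fun a => phaseChar (evalBits a P) * g a) = sumPaths (B.erase y) fun a =>
      (1 + phaseChar (c + halfHom (value a Q))) * (phaseChar (evalBits a R) * g a) := by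
  rw [sumPaths_erase hy]
  refine sumPaths_congr fun a => ?_
  rw [hg, hg, h.evalBits_update, h.evalBits_update, if_neg zero_ne_one, if_pos rfl, zero_add,
    AddChar.map_add_eq_mul]
  ring

theorem of_notMem_vars (h : y ∉ P.vars) : P.SplitsAt y 0 0 P where
  evalBits_eq a := by rw [map_zero, map_zero, add_zero, ite_self, zero_add]
  notMem_vars := by simp [Poly.vars, coeffVars_zero]
  notMem_rest := h

end Phase.SplitsAt

theorem BPoly.hat_smul_half (a : V → ZMod 2) (Q : BPoly V) :
    value a (BPoly.hat Q) • half = halfHom (value a Q) := by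
  rw [BPoly.value_hat, natCast_zsmul, halfHom_apply]

theorem Phase.evalBits_scale_half_X (a : V → ZMod 2) (y : V) :
    evalBits a (Phase.scale half (Poly.X y)) = halfHom (a y) := by
  rw [Phase.evalBits_scale, Poly.value_X, natCast_zsmul, halfHom_apply]

theorem Phase.evalBits_scale_half_X_mul (a : V → ZMod 2) (y : V) (p : IPoly V) :
    evalBits a (Phase.scale half (Poly.X y * p)) =
      if a y = 1 then value a p • half else 0 := by
  rw [Phase.evalBits_scale, map_mul, Poly.value_X]
  rcases bit_eq_zero_or_one (a y) with h | h <;> simp [h, ZMod.val_one]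

namespace Phase.SplitsAt

variable {R : Phase V} {y : V} {Q : BPoly V}

theorem scale_half_X_add (hR : y ∉ R.vars) :
    (Phase.scale half (Poly.X y) + R).SplitsAt y 0 1 R where
  evalBits_eq a := by
    rw [map_add, evalBits_scale_half_X, map_one, halfHom_one, zero_add]
    rcases bit_eq_zero_or_one (a y) with h | h <;> simp [h, halfHom_one]
  notMem_vars := notMem_vars_iff.2 fun a x => by rw [map_one, map_one]
  notMem_rest := hR

theorem scale_half_X_mul_hat_add (hQ : y ∉ Poly.vars Q) (hR : y ∉ R.vars) :
    (Phase.scale half (Poly.X y * BPoly.hat Q) + R).SplitsAt y 0 Q R where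
  evalBits_eq a := by
    rw [map_add, evalBits_scale_half_X_mul, BPoly.hat_smul_half, zero_add]
  notMem_vars := hQ
  notMem_rest := hR

theorem scale_half_X_mul_X_add_hat_add {v : V} (hv : y ≠ v) (hQ : y ∉ Poly.vars Q)
    (hR : y ∉ R.vars) :
    (Phase.scale half (Poly.X y * (Poly.X v + BPoly.hat Q)) + R).SplitsAt y 0 (X v + Q) R where
  evalBits_eq a := by
    rw [map_add, evalBits_scale_half_X_mul, map_add (value a), add_smul, BPoly.hat_smul_half,
      Poly.value_X, natCast_zsmul, ← halfHom_apply, ← map_add, map_add (value a),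
      value_X_bit, zero_add]
  notMem_vars := notMem_vars_iff.2 fun a x => by
    rw [map_add, map_add, notMem_vars_iff.1 hQ, value_X_bit, value_X_bit,
      Function.update_of_ne hv.symm]
  notMem_rest := hR

theorem scale_quarter_X_add_scale_half_X_mul_hat_add (hQ : y ∉ Poly.vars Q) (hR : y ∉ R.vars) :
    (Phase.scale quarter (Poly.X y) + Phase.scale half (Poly.X y * BPoly.hat Q) + R).SplitsAt
      y quarter Q R where
  evalBits_eq a := by
    rw [map_add, map_add, evalBits_scale_half_X_mul, BPoly.hat_smul_half, Phase.evalBits_scale,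
      Poly.value_X]
    rcases bit_eq_zero_or_one (a y) with h | h <;> simp [h, ZMod.val_one]
  notMem_vars := hQ
  notMem_rest := hR

end Phase.SplitsAt

end LowDegree

namespace DSOP

section CliffordUpToScalar

variable {V : Type u} {n m : ℕ}

/-- The morphisms of the Clifford fragment, except that the scalar is any positive real and that the
phase has any constant coefficient. -/
structure IsCliffordUpToScalar (t : DSOP V n m) : Prop where
  scalar_pos : 0 < t.s
  phase : t.P.IsQuadratic
  legs : ∀ i, Poly.DegreeLE (t.legs i) 1
  discards : ∀ d ∈ t.D, Poly.DegreeLE d 1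

theorem forall_legs {t : DSOP V n m} {p : BPoly V → Prop} :
    (∀ i, p (t.legs i)) ↔ (∀ i, p (t.O i)) ∧ ∀ i, p (t.I i) := by
  rw [Fin.forall_fin_add]
  simp only [legs_castAdd, legs_natAdd]

theorem IsClifford.isCliffordUpToScalar {t : DSOP V n m} (h : t.IsClifford) :
    t.IsCliffordUpToScalar := by
  obtain ⟨⟨p, hp⟩, ⟨P₀, P₁, P₂, h₀, h₁, h₂, hP⟩, hO, hD, hI⟩ := h
  refine ⟨by rw [hp]; positivity, ?_, forall_legs (p := (DegreeLE · 1)).2 ⟨hO, hI⟩, hD⟩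
  rw [hP]
  exact ((Phase.IsQuadratic.scale h₀ eight_nsmul_eighth).add
    (Phase.IsQuadratic.scale h₁ four_nsmul_quarter)).add
      (Phase.IsQuadratic.scale h₂ two_nsmul_half)

theorem legs_eq {t t' : DSOP V n m} (hO : t'.O = t.O) (hI : t'.I = t.I) : t'.legs = t.legs := by
  rw [legs, legs, hO, hI]

theorem legs_eq_map {t t' : DSOP V n m} (f : BPoly V → BPoly V) (hO : t'.O = fun i => f (t.O i))
    (hI : t'.I = fun i => f (t.I i)) (i : Fin (m + n)) : t'.legs i = f (t.legs i) := by
  rw [legs, legs, hO, hI]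
  refine Fin.addCases (fun j => ?_) (fun j => ?_) i <;> simp

theorem notMem_vars_legs {t : DSOP V n m} {y : V} (hO : FreshL y t.O) (hI : FreshL y t.I) :
    ∀ i, y ∉ vars (t.legs i) :=
  forall_legs (p := fun p => y ∉ vars p).2 ⟨hO, hI⟩

end CliffordUpToScalar

section Indistinguishable

variable {V : Type u} {n m : ℕ}

/-- The legs and the discarded polynomials of `t` take the same values on the paths `a` and `a'`. -/
def Indistinguishable (t : DSOP V n m) (a a' : V → ZMod 2) : Prop :=
  (∀ i, value a (t.legs i) = value a' (t.legs i)) ∧ ∀ d ∈ t.D, value a d = value a' d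

theorem Indistinguishable.refl (t : DSOP V n m) (a : V → ZMod 2) : t.Indistinguishable a a :=
  ⟨fun _ => rfl, fun _ _ => rfl⟩

theorem indistinguishable_update {t : DSOP V n m} {y : V} (hL : ∀ i, y ∉ vars (t.legs i))
    (hD : FreshD y t.D) (a : V → ZMod 2) (x : ZMod 2) :
    t.Indistinguishable (Function.update a y x) a :=
  ⟨fun i => notMem_vars_iff.1 (hL i) a x, fun d hd => notMem_vars_iff.1 (hD d hd) a x⟩

theorem Indistinguishable.contributes_iff {t : DSOP V n m} {a a' b b' : V → ZMod 2}
    (ha : t.Indistinguishable a a') (hb : t.Indistinguishable b b')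
    (x₁ x₂ : Fin (m + n) → ZMod 2) : t.Contributes x₁ x₂ a b ↔ t.Contributes x₁ x₂ a' b' := by
  simp only [Contributes, ha.1, hb.1]
  refine and_congr_right fun _ => and_congr_right fun _ => forall₂_congr fun d hd => ?_
  rw [ha.2 d hd, hb.2 d hd]

end Indistinguishable

section DensityInvariance

variable {V : Type u} {n m : ℕ}

theorem density_eq_sumPaths_mul (t : DSOP V n m) (x₁ x₂ : Fin (m + n) → ZMod 2) :
    t.density x₁ x₂ = (t.s : ℂ) ^ 2 * sumPaths t.bound fun a => phaseChar (evalBits a t.P) *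
      sumPaths t.bound fun b => (starRingEnd ℂ) (phaseChar (evalBits b t.P)) *
        if t.Contributes x₁ x₂ a b then 1 else 0 := by
  simp only [density, mul_assoc, sumPaths_mul_left]

theorem density_eq_of_sumPaths {t t' : DSOP V n m} (κ : ℝ) (φ : (V → ZMod 2) → V → ZMod 2)
    (hs : t'.s = κ * t.s)
    (hsum : ∀ g : (V → ZMod 2) → ℂ, (∀ a a', t.Indistinguishable a a' → g a = g a') →
      (sumPaths t.bound fun a => phaseChar (evalBits a t.P) * g a) =
        κ * sumPaths t'.bound fun a => phaseChar (evalBits a t'.P) * g (φ a))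
    (hcontr : ∀ x₁ x₂ a b, t'.Contributes x₁ x₂ a b ↔ t.Contributes x₁ x₂ (φ a) (φ b)) :
    t'.density = t.density := by
  funext x₁ x₂
  have hinner : ∀ a, (sumPaths t.bound fun b => (starRingEnd ℂ) (phaseChar (evalBits b t.P)) *
      if t.Contributes x₁ x₂ a b then 1 else 0) =
      κ * sumPaths t'.bound fun b => (starRingEnd ℂ) (phaseChar (evalBits b t'.P)) *
        if t.Contributes x₁ x₂ a (φ b) then 1 else 0 := fun a => by
    have hconj := congrArg (starRingEnd ℂ) <|
      hsum (fun b => if t.Contributes x₁ x₂ a b then 1 else 0) fun b b' hb => by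
        simp only [(Indistinguishable.refl t a).contributes_iff hb]
    simpa only [map_mul, map_sumPaths, Complex.conj_ofReal, apply_ite (starRingEnd ℂ), map_one,
      map_zero] using hconj
  rw [density_eq_sumPaths_mul, density_eq_sumPaths_mul, hsum _ fun a a' ha => by
    simp only [ha.contributes_iff (Indistinguishable.refl t _)]]
  simp only [hinner, hcontr, hs, mul_left_comm _ (κ : ℂ), sumPaths_mul_left]
  push_cast
  ring

theorem density_eq_of_splitsAt {t t' : DSOP V n m} {y : V} {c : UnitAddCircle} {Q : BPoly V}
    {R : Phase V} (hP : t.P.SplitsAt y c Q R) (hy : y ∈ t.bound)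
    (hL : ∀ i, y ∉ vars (t.legs i)) (hD : FreshD y t.D) (κ : ℝ)
    (φ : (V → ZMod 2) → V → ZMod 2) (hs : t'.s = κ * t.s)
    (hsum : ∀ g : (V → ZMod 2) → ℂ, (sumPaths (t.bound.erase y) fun a =>
      (1 + phaseChar (c + halfHom (value a Q))) * (phaseChar (evalBits a R) * g a)) =
        κ * sumPaths t'.bound fun a => phaseChar (evalBits a t'.P) * g (φ a))
    (hcontr : ∀ x₁ x₂ a b, t'.Contributes x₁ x₂ a b ↔ t.Contributes x₁ x₂ (φ a) (φ b)) :
    t'.density = t.density :=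
  density_eq_of_sumPaths κ φ hs (fun g hg => (hP.sumPaths_eq hy fun a x =>
    hg _ _ (indistinguishable_update hL hD a x)).trans (hsum g)) hcontr

theorem density_eq_zero_of_splitsAt {t : DSOP V n m} {y : V} {R : Phase V}
    (hP : t.P.SplitsAt y 0 1 R) (hy : y ∈ t.bound) (hL : ∀ i, y ∉ vars (t.legs i))
    (hD : FreshD y t.D) : t.density = 0 := by
  funext x₁ x₂
  have hcancel : 1 + phaseChar (0 + halfHom 1) = 0 := by
    rw [zero_add, halfHom_one, phaseChar_half, add_neg_cancel]
  rw [density_eq_sumPaths_mul, hP.sumPaths_eq hy fun a x => by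
    simp only [(indistinguishable_update hL hD a x).contributes_iff (Indistinguishable.refl t _)]]
  simp only [map_one, hcancel, zero_mul, sumPaths_zero, mul_zero, Pi.zero_apply]

theorem density_eq_of_shift {t t' : DSOP V n m} {y : V} {q : BPoly V} (hy : y ∈ t.bound)
    (hq : y ∉ vars q) (hs : t'.s = t.s) (hb : t'.bound = t.bound)
    (hP : ∀ a, evalBits a t'.P = evalBits (Function.update a y (a y + value a q)) t.P)
    (hcontr : ∀ x₁ x₂ a b, t'.Contributes x₁ x₂ a b ↔ t.Contributes x₁ x₂
      (Function.update a y (a y + value a q)) (Function.update b y (b y + value b q))) :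
    t'.density = t.density :=
  density_eq_of_sumPaths 1 (fun a => Function.update a y (a y + value a q)) (by rw [hs, one_mul])
    (fun g _ => by
      rw [Complex.ofReal_one, one_mul, hb, ← sumPaths_shift hy hq]
      simp only [hP]) hcontr

theorem density_eq_of_contributes {t t' : DSOP V n m} (hs : t'.s = t.s) (hb : t'.bound = t.bound)
    (hcontr : ∀ x₁ x₂ a b, t'.Contributes x₁ x₂ a b ↔ t.Contributes x₁ x₂ a b)
    (hP : ∀ x₁ x₂ a b, t.Contributes x₁ x₂ a b →
      evalBits a t'.P - evalBits b t'.P = evalBits a t.P - evalBits b t.P) :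
    t'.density = t.density := by
  funext x₁ x₂
  rw [density, density, hs, hb]
  congr 1
  refine sumPaths_congr fun a => sumPaths_congr fun b => ?_
  simp only [hcontr, phaseChar_mul_conj]
  split_ifs with h
  · rw [hP x₁ x₂ a b h]
  · rw [mul_zero, mul_zero]

theorem contributes_iff_of_insert {t t' : DSOP V n m} (hL : t'.legs = t.legs) {d : BPoly V}
    (hD : t'.D = insert d t.D) (x₁ x₂ : Fin (m + n) → ZMod 2) (a b : V → ZMod 2) :
    t'.Contributes x₁ x₂ a b ↔ value a d = value b d ∧ t.Contributes x₁ x₂ a b := by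
  rw [Contributes, Contributes, hL, hD, Finset.forall_mem_insert]
  tauto

end DensityInvariance

section SummationRules

variable {V : Type u} {n m : ℕ} {t t' : DSOP V n m}

theorem IsCliffordUpToScalar.elim (h : t.IsCliffordUpToScalar) {y₀ : V} (hy₀ : y₀ ∈ t.bound)
    (freshP : y₀ ∉ t.P.vars) (freshD : FreshD y₀ t.D) (freshL : ∀ i, y₀ ∉ vars (t.legs i))
    (s' : t'.s = 2 * t.s) (bound' : t'.bound = t.bound.erase y₀)
    (P' : t'.P = t.P) (L' : t'.legs = t.legs) (D' : t'.D = t.D) :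
    t'.IsCliffordUpToScalar ∧ t'.density = t.density := by
  refine ⟨⟨s' ▸ mul_pos two_pos h.scalar_pos, P' ▸ h.phase, L' ▸ h.legs, D' ▸ h.discards⟩,
    density_eq_of_splitsAt (Phase.SplitsAt.of_notMem_vars freshP) hy₀ freshL freshD 2 id s'
      (fun g => ?_) fun x₁ x₂ a b => by simp only [Contributes, L', D', id]⟩
  simp only [map_zero, add_zero, AddChar.map_zero_eq_one, one_add_one_eq_two, sumPaths_mul_left,
    bound', P', id, Complex.ofReal_ofNat]

theorem IsCliffordUpToScalar.hh (h : t.IsCliffordUpToScalar) {y₀ y₁ : V} {Q : BPoly V}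
    {R : Phase V} (hy₀ : y₀ ∈ t.bound) (hy₁ : y₁ ∈ t.bound) (hne : y₀ ≠ y₁)
    (hP : t.P = Phase.scale half (Poly.X y₀ * (Poly.X y₁ + BPoly.hat Q)) + R)
    (freshR : y₀ ∉ R.vars) (freshQ : y₀ ∉ vars Q) (freshD : FreshD y₀ t.D)
    (freshL : ∀ i, y₀ ∉ vars (t.legs i)) (freshQ₁ : y₁ ∉ vars Q)
    (s' : t'.s = 2 * t.s) (bound' : t'.bound = (t.bound.erase y₀).erase y₁)
    (P' : t'.P = R.subst y₁ (BPoly.hat Q))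
    (L' : ∀ i, t'.legs i = Poly.subst y₁ Q (t.legs i))
    (D' : t'.D = t.D.image (Poly.subst y₁ Q)) :
    t'.IsCliffordUpToScalar ∧ t'.density = t.density := by
  have hsplit : t.P.SplitsAt y₀ 0 (X y₁ + Q) R :=
    hP ▸ Phase.SplitsAt.scale_half_X_mul_X_add_hat_add hne freshQ freshR
  have hQ : DegreeLE Q 1 := by
    simpa only [← add_assoc, BPoly.add_self, zero_add] using
      (degreeLE_X y₁).add (hsplit.degreeLE h.phase)
  refine ⟨⟨s' ▸ mul_pos two_pos h.scalar_pos, P' ▸ (hsplit.isQuadratic h.phase).subst hQ y₁,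
    fun i => L' i ▸ (h.legs i).subst hQ y₁, ?_⟩,
    density_eq_of_splitsAt hsplit hy₀ freshL freshD 2 (fun a => Function.update a y₁ (value a Q))
      s' (fun g => ?_) fun x₁ x₂ a b => by
        simp only [Contributes, L', D', value_subst, Finset.forall_mem_image]⟩
  · rw [D', Finset.forall_mem_image]
    exact fun d hd => (h.discards d hd).subst hQ y₁
  · rw [bound', sumPaths_erase (Finset.mem_erase.2 ⟨hne.symm, hy₁⟩), ← sumPaths_mul_left]
    refine sumPaths_congr fun a => ?_
    simp only [zero_add, map_add (value _), value_X_bit, one_add_phaseChar_halfHom,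
      notMem_vars_iff.1 freshQ₁, Function.update_self, P', Phase.evalBits_subst]
    rcases bit_eq_zero_or_one (value a Q) with hq | hq <;>
      simp [hq, halfHom_one, phaseChar_half, one_add_one_eq_two]

theorem IsCliffordUpToScalar.omega (h : t.IsCliffordUpToScalar) {y₀ : V} {Q : BPoly V}
    {R : Phase V} (hy₀ : y₀ ∈ t.bound)
    (hP : t.P = Phase.scale quarter (Poly.X y₀) +
        Phase.scale half (Poly.X y₀ * BPoly.hat Q) + R)
    (freshQ : y₀ ∉ vars Q) (freshR : y₀ ∉ R.vars) (freshD : FreshD y₀ t.D)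
    (freshL : ∀ i, y₀ ∉ vars (t.legs i))
    (s' : t'.s = Real.sqrt 2 * t.s) (bound' : t'.bound = t.bound.erase y₀)
    (P' : t'.P = Phase.scale eighth 1 - Phase.scale quarter (BPoly.hat Q) + R)
    (L' : t'.legs = t.legs) (D' : t'.D = t.D) :
    t'.IsCliffordUpToScalar ∧ t'.density = t.density := by
  have hsplit : t.P.SplitsAt y₀ quarter Q R :=
    hP ▸ Phase.SplitsAt.scale_quarter_X_add_scale_half_X_mul_hat_add freshQ freshR
  refine ⟨⟨s' ▸ mul_pos (Real.sqrt_pos.2 two_pos) h.scalar_pos, P' ▸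
    ((Phase.IsQuadratic.constant eighth).sub (Phase.IsQuadratic.scale_hat
      (hsplit.degreeLE h.phase) four_nsmul_quarter)).add (hsplit.isQuadratic h.phase),
    L' ▸ h.legs, D' ▸ h.discards⟩,
    density_eq_of_splitsAt hsplit hy₀ freshL freshD (Real.sqrt 2) id s' (fun g => ?_)
      fun x₁ x₂ a b => by simp only [Contributes, L', D', id]⟩
  have heval : ∀ a, evalBits a t'.P = eighth - (value a Q).val • quarter + evalBits a R :=
    fun a => by
      rw [P', map_add, map_sub, Phase.evalBits_scale, Phase.evalBits_scale, map_one, one_smul,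
        BPoly.value_hat, natCast_zsmul]
  rw [bound', ← sumPaths_mul_left]
  refine sumPaths_congr fun a => ?_
  rw [one_add_phaseChar_quarter, heval, AddChar.map_add_eq_mul, id, mul_assoc, mul_assoc]

/-- If `y` is discarded, only two of the four terms of the sum over `y` in both copies remain. -/
theorem sum_phaseChar_of_discarded_X {P R : Phase V} {Q : BPoly V} {y : V}
    (hP : P.SplitsAt y 0 Q R) (a b : V → ZMod 2) :
    (phaseChar (evalBits (Function.update a y 0) P) *
        (starRingEnd ℂ) (phaseChar (evalBits (Function.update b y 0) P)) +
      phaseChar (evalBits (Function.update a y 1) P) *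
        (starRingEnd ℂ) (phaseChar (evalBits (Function.update b y 1) P))) =
      2 * (phaseChar (evalBits a R) * (starRingEnd ℂ) (phaseChar (evalBits b R)) *
        if value a Q = value b Q then 1 else 0) := by
  have hdiff : 0 + halfHom (value a Q) + evalBits a R - (0 + halfHom (value b Q) + evalBits b R) =
      halfHom (value a Q + value b Q) + (evalBits a R - evalBits b R) := by
    rw [← CharTwo.sub_eq_add, map_sub]
    abel
  simp only [hP.evalBits_update, if_neg zero_ne_one, if_true, phaseChar_mul_conj]
  rw [zero_add, zero_add, hdiff, AddChar.map_add_eq_mul, ← one_add_mul,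
    one_add_phaseChar_halfHom, ite_mul, zero_mul, mul_ite, mul_one, mul_zero, mul_ite, mul_zero]

theorem contributes_update_iff_of_discarded_X {t₀ : DSOP V n m} {y₀ : V} (L : t.legs = t₀.legs)
    (D : t.D = insert (Poly.X y₀) t₀.D) (freshL : ∀ i, y₀ ∉ vars (t₀.legs i))
    (freshD : FreshD y₀ t₀.D) (x₁ x₂ : Fin (m + n) → ZMod 2) (a b : V → ZMod 2) (x x' : ZMod 2) :
    t.Contributes x₁ x₂ (Function.update a y₀ x) (Function.update b y₀ x') ↔
      x = x' ∧ t₀.Contributes x₁ x₂ a b := by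
  rw [contributes_iff_of_insert L D, value_X_bit, value_X_bit, Function.update_self,
    Function.update_self, (indistinguishable_update freshL freshD a x).contributes_iff
      (indistinguishable_update freshL freshD b x')]

theorem density_eq_of_discarded_X {y₀ : V} {Q : BPoly V} {D₀ : Finset (BPoly V)}
    (hP : t.P.SplitsAt y₀ 0 Q t'.P) (hy₀ : y₀ ∈ t.bound) (hD : t.D = insert (Poly.X y₀) D₀)
    (freshL : ∀ i, y₀ ∉ vars (t.legs i)) (freshD : FreshD y₀ D₀)
    (s' : t'.s = Real.sqrt 2 * t.s) (bound' : t'.bound = t.bound.erase y₀)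
    (L' : t'.legs = t.legs) (D' : t'.D = insert Q D₀) : t'.density = t.density := by
  funext x₁ x₂
  let t₀ : DSOP V n m :=
    { t with D := D₀, vars_D := fun d hd => t.vars_D d (hD ▸ Finset.mem_insert_of_mem hd) }
  have hcontr := contributes_update_iff_of_discarded_X (t := t) (t₀ := t₀) rfl hD freshL freshD
    x₁ x₂
  have hcontr' := contributes_iff_of_insert (t := t₀) L' D' x₁ x₂
  have hs2 : (t'.s : ℂ) ^ 2 = (t.s : ℂ) ^ 2 * 2 := by
    rw [s', ← Complex.ofReal_pow, mul_pow, Real.sq_sqrt zero_le_two]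
    push_cast
    ring
  rw [density, density, hs2, mul_assoc, bound', sumPaths_erase hy₀, ← sumPaths_mul_left]
  congr 1
  refine sumPaths_congr fun a => ?_
  rw [sumPaths_erase hy₀, sumPaths_erase hy₀, ← sumPaths_mul_left, ← sumPaths_add]
  refine sumPaths_congr fun b => ?_
  simp only [hcontr, hcontr', zero_ne_one, one_ne_zero, false_and, true_and, if_false,
    mul_zero, add_zero, zero_add]
  by_cases h₀ : t₀.Contributes x₁ x₂ a b
  · simpa only [h₀, and_true, if_true, mul_one] using (sum_phaseChar_of_discarded_X hP a b).symm
  · simp only [h₀, and_false, if_false, mul_zero, add_zero]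

theorem IsCliffordUpToScalar.hGround (h : t.IsCliffordUpToScalar) {y₀ : V} {Q : BPoly V}
    {R : Phase V} {D₀ : Finset (BPoly V)} (hy₀ : y₀ ∈ t.bound)
    (hP : t.P = R + Phase.scale half (Poly.X y₀ * BPoly.hat Q))
    (hD : t.D = insert (Poly.X y₀) D₀)
    (freshQ : y₀ ∉ vars Q) (freshR : y₀ ∉ R.vars) (freshL : ∀ i, y₀ ∉ vars (t.legs i))
    (freshD : FreshD y₀ D₀)
    (s' : t'.s = Real.sqrt 2 * t.s) (bound' : t'.bound = t.bound.erase y₀)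
    (P' : t'.P = R) (L' : t'.legs = t.legs) (D' : t'.D = insert Q D₀) :
    t'.IsCliffordUpToScalar ∧ t'.density = t.density := by
  subst P'
  have hsplit : t.P.SplitsAt y₀ 0 Q t'.P := by
    rw [hP, add_comm]
    exact Phase.SplitsAt.scale_half_X_mul_hat_add freshQ freshR
  refine ⟨⟨s' ▸ mul_pos (Real.sqrt_pos.2 two_pos) h.scalar_pos, hsplit.isQuadratic h.phase,
    L' ▸ h.legs, ?_⟩, density_eq_of_discarded_X hsplit hy₀ hD freshL freshD s' bound' L' D'⟩
  rw [D', Finset.forall_mem_insert]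
  exact ⟨hsplit.degreeLE h.phase, fun d hd => h.discards d (hD ▸ Finset.mem_insert_of_mem hd)⟩

end SummationRules

section DiscardRules

variable {V : Type u} {n m : ℕ} {t t' : DSOP V n m}

theorem value_prod_eq_of_subset {D E : Finset (BPoly V)} (hE : E ⊆ D) {a b : V → ZMod 2}
    (h : ∀ d ∈ D, value a d = value b d) : value a (∏ d ∈ E, d) = value b (∏ d ∈ E, d) := by
  rw [map_prod, map_prod]
  exact Finset.prod_congr rfl fun d hd => h d (hE hd)

theorem IsCliffordUpToScalar.zGround (h : t.IsCliffordUpToScalar) {E : Finset (BPoly V)}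
    {α : UnitAddCircle} {R : Phase V} (hE : E ⊆ t.D)
    (hP : t.P = R + Phase.scale α (BPoly.hat (∏ d ∈ E, d)))
    (split : Disjoint R.support (Phase.scale α (BPoly.hat (∏ d ∈ E, d))).support)
    (s' : t'.s = t.s) (bound' : t'.bound = t.bound)
    (P' : t'.P = R) (L' : t'.legs = t.legs) (D' : t'.D = t.D) :
    t'.IsCliffordUpToScalar ∧ t'.density = t.density := by
  refine ⟨⟨s' ▸ h.scalar_pos, P' ▸ Phase.IsQuadratic.of_disjoint_add (hP ▸ h.phase) split,
    L' ▸ h.legs, D' ▸ h.discards⟩, density_eq_of_contributes s' bound'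
      (fun _ _ _ _ => by simp only [Contributes, L', D']) fun x₁ x₂ a b hab => ?_⟩
  rw [hP, P', map_add, map_add, Phase.evalBits_scale, Phase.evalBits_scale, BPoly.value_hat,
    BPoly.value_hat, value_prod_eq_of_subset hE hab.2.2, add_sub_add_right_eq_sub]

theorem IsCliffordUpToScalar.xorGround (h : t.IsCliffordUpToScalar) {E : Finset (BPoly V)}
    {d q : BPoly V} (hd : d ∈ t.D) (hE : E ⊆ t.D.erase d) (hsum : d = ∏ e ∈ E, e + q)
    (split : Disjoint (Poly.monomials (∏ e ∈ E, e)) (Poly.monomials q))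
    (s' : t'.s = t.s) (bound' : t'.bound = t.bound) (P' : t'.P = t.P) (L' : t'.legs = t.legs)
    (D' : t'.D = insert q (t.D.erase d)) :
    t'.IsCliffordUpToScalar ∧ t'.density = t.density := by
  have hq : DegreeLE q 1 := (hsum ▸ h.discards d hd).right_of_add split
  refine ⟨⟨s' ▸ h.scalar_pos, P' ▸ h.phase, L' ▸ h.legs, ?_⟩,
    density_eq_of_contributes s' bound' (fun x₁ x₂ a b => ?_) fun _ _ _ _ _ => by rw [P']⟩
  · rw [D', Finset.forall_mem_insert]
    exact ⟨hq, fun e he => h.discards e (Finset.mem_of_mem_erase he)⟩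
  · let t₀ : DSOP V n m := { t with
      D := t.D.erase d
      vars_D := fun e he => t.vars_D e (Finset.mem_of_mem_erase he) }
    rw [contributes_iff_of_insert (t := t₀) L' D', contributes_iff_of_insert (t := t₀) (t' := t)
      rfl (Finset.insert_erase hd).symm]
    refine and_congr_left fun hab => ?_
    rw [hsum, map_add, map_add, value_prod_eq_of_subset hE hab.2.2, add_right_inj]

theorem IsCliffordUpToScalar.cstGround (h : t.IsCliffordUpToScalar) {c : BPoly V}
    (hc : c = 0 ∨ c = 1) (hcD : c ∈ t.D) (s' : t'.s = t.s) (bound' : t'.bound = t.bound)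
    (P' : t'.P = t.P) (L' : t'.legs = t.legs) (D' : t'.D = t.D.erase c) :
    t'.IsCliffordUpToScalar ∧ t'.density = t.density := by
  refine ⟨⟨s' ▸ h.scalar_pos, P' ▸ h.phase, L' ▸ h.legs, fun d hd =>
    h.discards d (Finset.mem_of_mem_erase (D' ▸ hd))⟩,
    density_eq_of_contributes s' bound' (fun x₁ x₂ a b => ?_) fun _ _ _ _ _ => by rw [P']⟩
  have hvalue : value a c = value b c := by
    rcases hc with rfl | rfl <;> simp only [map_zero, map_one]
  rw [contributes_iff_of_insert (t := t') (t' := t) L'.symm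
    (by rw [D', Finset.insert_erase hcD]), and_iff_right hvalue]

end DiscardRules

section SubstitutionRules

variable {V : Type u} {n m : ℕ} {t t' : DSOP V n m}

theorem IsCliffordUpToScalar.disc (h : t.IsCliffordUpToScalar) {y₀ : V} {d q : BPoly V}
    (hy₀ : y₀ ∈ t.bound) (hd : d ∈ t.D) (hsum : d = Poly.X y₀ + q) (freshq : y₀ ∉ Poly.vars q)
    (s' : t'.s = t.s) (bound' : t'.bound = t.bound)
    (P' : t'.P = t.P.subst y₀ (BPoly.hat d))
    (L' : ∀ i, t'.legs i = Poly.subst y₀ d (t.legs i))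
    (D' : t'.D = t.D.image (Poly.subst y₀ d)) :
    t'.IsCliffordUpToScalar ∧ t'.density = t.density := by
  have hd₁ := h.discards d hd
  have hvalue : ∀ a, value a d = a y₀ + value a q := fun a => by rw [hsum, map_add, value_X_bit]
  refine ⟨⟨s' ▸ h.scalar_pos, P' ▸ h.phase.subst hd₁ y₀, fun i => L' i ▸ (h.legs i).subst hd₁ y₀,
    ?_⟩, density_eq_of_shift hy₀ freshq s' bound' (fun a => ?_) fun x₁ x₂ a b => ?_⟩
  · rw [D', Finset.forall_mem_image]
    exact fun e he => (h.discards e he).subst hd₁ y₀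
  · rw [P', Phase.evalBits_subst, hvalue]
  · simp only [Contributes, L', D', value_subst, Finset.forall_mem_image, hvalue]

/-- Both paths are translated by the same vector, and this changes the value of an affine polynomial
by an amount that does not depend on the path. -/
theorem value_shift_eq_iff {d q : BPoly V} (hd : DegreeLE d 1) (y : V) {a b : V → ZMod 2}
    (hq : value a q = value b q) :
    value (Function.update a y (a y + value a q)) d =
      value (Function.update b y (b y + value b q)) d ↔ value a d = value b d := by
  have hshift : ∀ (a : V → ZMod 2) (x : ZMod 2),
      Function.update a y (a y + x) = a + Pi.single y x := fun a x => by
    funext v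
    rcases eq_or_ne v y with rfl | hv <;> simp [*]
  rw [hshift, hshift, hd.value_add, hd.value_add b, hq, add_left_inj]

theorem IsCliffordUpToScalar.forall_value_shift_eq_iff (h : t.IsCliffordUpToScalar) {y₀ : V}
    {q : BPoly V} (freshq : y₀ ∉ Poly.vars q)
    (hD : FreshD y₀ t.D ∨ (Poly.X y₀ ∈ insert 1 t.D ∧ q ∈ insert 1 t.D)) (a b : V → ZMod 2) :
    (∀ d ∈ t.D, value (Function.update a y₀ (a y₀ + value a q)) d =
      value (Function.update b y₀ (b y₀ + value b q)) d) ↔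
      ∀ d ∈ t.D, value a d = value b d := by
  rcases hD with hD | ⟨-, hq⟩
  · exact forall₂_congr fun d hd => by
      rw [notMem_vars_iff.1 (hD d hd), notMem_vars_iff.1 (hD d hd)]
  have agree : ∀ {a b : V → ZMod 2}, (∀ d ∈ t.D, value a d = value b d) →
      value a q = value b q := fun {a b} hab => by
    rcases Finset.mem_insert.1 hq with rfl | hq
    · rw [map_one, map_one]
    · exact hab q hq
  refine ⟨fun hab d hd => (value_shift_eq_iff (h.discards d hd) y₀ ?_).1 (hab d hd),
    fun hab d hd => (value_shift_eq_iff (h.discards d hd) y₀ (agree hab)).2 (hab d hd)⟩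
  simpa only [notMem_vars_iff.1 freshq] using agree hab

theorem IsCliffordUpToScalar.leg_subst (h : t.IsCliffordUpToScalar) {y₀ : V} {q : BPoly V}
    (hq : DegreeLE q 1) (hy₀ : y₀ ∈ t.bound) (freshq : y₀ ∉ Poly.vars q)
    (hD : FreshD y₀ t.D ∨ (Poly.X y₀ ∈ insert 1 t.D ∧ q ∈ insert 1 t.D))
    (s' : t'.s = t.s) (bound' : t'.bound = t.bound)
    (P' : t'.P = t.P.subst y₀ (BPoly.hat (Poly.X y₀ + q)))
    (L' : ∀ i, t'.legs i = Poly.subst y₀ (Poly.X y₀ + q) (t.legs i)) (D' : t'.D = t.D) :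
    t'.IsCliffordUpToScalar ∧ t'.density = t.density := by
  have hq₁ := (degreeLE_X y₀).add hq
  have hvalue : ∀ a, value a (X y₀ + q) = a y₀ + value a q := fun a => by
    rw [map_add, value_X_bit]
  refine ⟨⟨s' ▸ h.scalar_pos, P' ▸ h.phase.subst hq₁ y₀, fun i => L' i ▸ (h.legs i).subst hq₁ y₀,
    D' ▸ h.discards⟩,
    density_eq_of_shift hy₀ freshq s' bound' (fun a => ?_) fun x₁ x₂ a b => ?_⟩
  · rw [P', Phase.evalBits_subst, hvalue]
  · simp only [Contributes, L', D', value_subst, hvalue, h.forall_value_shift_eq_iff freshq hD]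

theorem IsCliffordUpToScalar.degreeLE_O (h : t.IsCliffordUpToScalar) (i : Fin m) :
    DegreeLE (t.O i) 1 := t.legs_castAdd i ▸ h.legs _

theorem IsCliffordUpToScalar.degreeLE_I (h : t.IsCliffordUpToScalar) (i : Fin n) :
    DegreeLE (t.I i) 1 := t.legs_natAdd i ▸ h.legs _

theorem degreeLE_one_of_X_add {y : V} {p q r : BPoly V} (hp : DegreeLE p 1)
    (hsum : p = X y + q + r) (split : Disjoint (Poly.monomials q) (Poly.monomials r)) :
    DegreeLE q 1 := by
  have hrq : r + q = X y + p := by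
    rw [hsum, ← add_assoc, ← add_assoc, BPoly.add_self, zero_add, add_comm]
  exact (hrq ▸ (degreeLE_X y).add hp).right_of_add split.symm

theorem subst_eq_self {y : V} {p q : BPoly V} (h : y ∉ vars p) : subst y q p = p :=
  value_injective fun a => by rw [value_subst, notMem_vars_iff.1 h]

end SubstitutionRules

section ZeroForm

variable {V : Type u} {n m : ℕ} {t : DSOP V n m} {y : V}

/-- The terminal form of the morphisms whose interpretation is zero. -/
def IsZeroForm (t : DSOP V n m) (y : V) : Prop :=
  t.s = 1 ∧ t.bound = {y} ∧ t.P = Phase.scale half (X y) ∧ t.O = 0 ∧ t.D = ∅ ∧ t.I = 0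

theorem IsZeroForm.legs_eq_zero (h : t.IsZeroForm y) : ∀ i, t.legs i = 0 := by
  obtain ⟨-, -, -, hO, -, hI⟩ := h
  exact forall_legs (p := (· = 0)).2 ⟨congrFun hO, congrFun hI⟩

theorem IsZeroForm.isCliffordUpToScalar (h : t.IsZeroForm y) : t.IsCliffordUpToScalar where
  scalar_pos := h.1 ▸ one_pos
  phase := h.2.2.1 ▸ Phase.IsQuadratic.scale (degreeLE_X y) (by
    rw [show 2 ^ (3 - 1) = 2 * 2 from rfl, mul_smul, two_nsmul_half, smul_zero])
  legs i := h.legs_eq_zero i ▸ degreeLE_zero 1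
  discards d hd := absurd (h.2.2.2.2.1 ▸ hd) (Finset.notMem_empty d)

theorem IsZeroForm.density_eq_zero (h : t.IsZeroForm y) : t.density = 0 := by
  have hL := h.legs_eq_zero
  obtain ⟨-, hb, hP, -, hD, -⟩ := h
  refine density_eq_zero_of_splitsAt (y := y) (R := 0) ?_ (hb ▸ Finset.mem_singleton_self y)
    (fun i => hL i ▸ ?_) fun d hd => absurd (hD ▸ hd) (Finset.notMem_empty d)
  · rw [hP, ← add_zero (Phase.scale half (X y))]
    exact Phase.SplitsAt.scale_half_X_add (by simp [Phase.vars, coeffVars_zero])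
  · simp [vars, coeffVars_zero]

end ZeroForm

section Reduction

variable {V : Type u} {n m : ℕ} {t t' : DSOP V n m}

theorem Step.isCliffordUpToScalar_and_density_eq (hst : Step t t')
    (h : t.IsCliffordUpToScalar) : t'.IsCliffordUpToScalar ∧ t'.density = t.density := by
  cases hst with
  | elim y₀ hy₀ freshP freshD freshO freshI s' bound' P' O' D' I' =>
    exact h.elim hy₀ freshP freshD (notMem_vars_legs freshO freshI) s' bound' P' (legs_eq O' I') D'
  | hh y₀ y₁ Q R hy₀ hy₁ hne hP freshR freshQ freshD freshO freshI freshQ₁ s' bound' P' O' D' I' =>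
    exact h.hh hy₀ hy₁ hne hP freshR freshQ freshD (notMem_vars_legs freshO freshI) freshQ₁ s'
      bound' P' (legs_eq_map _ O' I') D'
  | omega y₀ Q R hy₀ hP freshQ freshR freshD freshO freshI s' bound' P' O' D' I' =>
    exact h.omega hy₀ hP freshQ freshR freshD (notMem_vars_legs freshO freshI) s' bound' P'
      (legs_eq O' I') D'
  | zGround E α R hE hP hne split s' bound' P' O' D' I' =>
    exact h.zGround hE hP split s' bound' P' (legs_eq O' I') D'
  | hGround y₀ Q R D₀ hy₀ hP hD freshQ freshR freshO freshI freshD s' bound' P' O' D' I' =>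
    exact h.hGround hy₀ hP hD freshQ freshR (notMem_vars_legs freshO freshI) freshD s' bound' P'
      (legs_eq O' I') D'
  | xorGround E d q hd hE hsum hne split s' bound' P' O' D' I' =>
    exact h.xorGround hd hE hsum split s' bound' P' (legs_eq O' I') D'
  | cstGround c hc hcD s' bound' P' O' D' I' =>
    exact h.cstGround hc hcD s' bound' P' (legs_eq O' I') D'
  | disc y₀ d q hy₀ hd hsum hne freshq hcount s' bound' P' O' D' I' =>
    exact h.disc hy₀ hd hsum freshq s' bound' P' (legs_eq_map _ O' I') D'
  | ket y₀ i q r hy₀ hsum hne split freshO freshq freshr hD s' bound' P' O' D' I' =>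
    exact h.leg_subst (degreeLE_one_of_X_add (h.degreeLE_O i) hsum split) hy₀ freshq hD s' bound' P'
      (legs_eq_map _ O' I') D'
  | bra y₀ i q r hy₀ hsum hne split freshO freshI freshq freshr hD s' bound' P' O' D' I' =>
    have O'' : t'.O = fun j => Poly.subst y₀ (Poly.X y₀ + q) (t.O j) :=
      O'.trans <| funext fun j => (subst_eq_self (freshO j)).symm
    exact h.leg_subst (degreeLE_one_of_X_add (h.degreeLE_I i) hsum split) hy₀ freshq hD s' bound' P'
      (legs_eq_map _ O'' I') D'
  | zero y₀ R hy₀ hP hne freshR freshD freshO freshI s' bound' P' O' D' I' =>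
    have hzero : t'.IsZeroForm y₀ := ⟨s', bound', P', O', D', I'⟩
    exact ⟨hzero.isCliffordUpToScalar, hzero.density_eq_zero.trans <| Eq.symm <|
      density_eq_zero_of_splitsAt (hP ▸ Phase.SplitsAt.scale_half_X_add freshR) hy₀
        (notMem_vars_legs freshO freshI) freshD⟩

theorem Reduces.isCliffordUpToScalar_and_density_eq (hr : t.Reduces t')
    (h : t.IsCliffordUpToScalar) : t'.IsCliffordUpToScalar ∧ t'.density = t.density := by
  induction hr with
  | refl => exact ⟨h, rfl⟩
  | tail _ hst ih =>
    obtain ⟨h', hdensity⟩ := hst.isCliffordUpToScalar_and_density_eq ih.1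
    exact ⟨h', hdensity.trans ih.2⟩

end Reduction

end DSOP

section PolynomialForms

variable {V : Type u}

theorem BPoly.add_add_cancel_left (p q : BPoly V) : p + (p + q) = q := by
  rw [← add_assoc, add_self, zero_add]

theorem BPoly.eq_of_add_eq_zero {p q : BPoly V} (h : p + q = 0) : p = q := by
  rw [← add_zero p, ← h, add_add_cancel_left]

theorem Poly.coeff_X_self (y : V) : (X y : BPoly V).coeff (Mon.of {y}) = 1 := by
  rw [X, MonoidAlgebra.coeff_single, Finsupp.single_eq_same]

theorem Poly.mem_vars_X (y : V) : y ∈ vars (X y : BPoly V) :=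
  mem_vars.2 ⟨Mon.of {y}, by rw [coeff_X_self]; exact one_ne_zero, Finset.mem_singleton_self y⟩

theorem Poly.X_injective : Function.Injective (X : V → BPoly V) := fun y z h =>
  Finset.mem_singleton.1 (vars_X z (h ▸ mem_vars_X y))

theorem Poly.vars_subset_of_coeff_ne_zero {p : BPoly V} {S : Mon V} (hS : p.coeff S ≠ 0) :
    S.vars ⊆ vars p := fun _ hv => mem_vars.2 ⟨S, hS, hv⟩

theorem Poly.disjoint_monomials_single {p : BPoly V} {S : Mon V} (hS : p.coeff S ≠ 0) :
    Disjoint (monomials (MonoidAlgebra.single S 1 : BPoly V))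
      (monomials (MonoidAlgebra.single S 1 + p)) := by
  have hsupp : monomials (MonoidAlgebra.single S 1 : BPoly V) ⊆ {S} := Finsupp.support_single_subset
  refine Finset.disjoint_of_subset_left hsupp (Finset.disjoint_singleton_left.2 ?_)
  rw [mem_monomials, not_not, MonoidAlgebra.coeff_add, Finsupp.add_apply, bit_ne_zero.1 hS,
    MonoidAlgebra.coeff_single, Finsupp.single_eq_same, CharTwo.add_self_eq_zero]

theorem Poly.vars_subst_subset (y : V) (q p : BPoly V) :
    vars (subst y q p) ⊆ (vars p).erase y ∪ vars q := by
  refine vars_subset_iff.2 fun a b hab => ?_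
  rw [value_subst, value_subst, value_congr fun v hv => hab v (Finset.mem_union_right _ hv)]
  refine value_congr fun v hv => ?_
  rcases eq_or_ne v y with rfl | hvy
  · rw [Function.update_self, Function.update_self]
  · rw [Function.update_of_ne hvy, Function.update_of_ne hvy,
      hab v (Finset.mem_union_left _ (Finset.mem_erase.2 ⟨hvy, hv⟩))]

theorem Phase.vars_subst_subset (y : V) (q : BPoly V) (P : Phase V) :
    (P.subst y (BPoly.hat q)).vars ⊆ P.vars.erase y ∪ Poly.vars q := by
  refine coeffVars_subset_iff.2 fun a b hab => ?_
  rw [evalBits_subst, evalBits_subst,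
    value_congr fun v hv => hab v (Finset.mem_union_right _ hv)]
  refine evalBits_congr fun v hv => ?_
  rcases eq_or_ne v y with rfl | hvy
  · rw [Function.update_self, Function.update_self]
  · rw [Function.update_of_ne hvy, Function.update_of_ne hvy,
      hab v (Finset.mem_union_left _ (Finset.mem_erase.2 ⟨hvy, hv⟩))]

theorem Poly.eq_zero_or_eq_one_of_vars_eq_empty {p : BPoly V} (h : vars p = ∅) :
    p = 0 ∨ p = 1 := by
  have hconst : ∀ a, value a p = value 0 p := fun a =>
    value_congr fun v hv => absurd (h ▸ hv) (Finset.notMem_empty v)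
  refine (bit_eq_zero_or_one (value 0 p)).imp (fun h0 => ?_) fun h1 => ?_
  · exact value_injective fun a => by rw [hconst, h0, map_zero]
  · exact value_injective fun a => by rw [hconst, h1, map_one]

theorem Poly.prod_image_X (S : Mon V) :
    ∏ d ∈ S.vars.image X, d = (MonoidAlgebra.single S 1 : BPoly V) := by
  rw [Finset.prod_image X_injective.injOn]
  exact value_injective fun a => (value_prod_eq_ite (value_X a) S).trans (value_single a S 1).symm

theorem Phase.scale_hat_single (S : Mon V) (α : UnitAddCircle) :
    Phase.scale α (BPoly.hat (MonoidAlgebra.single S 1)) = Finsupp.single S α :=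
  evalBits_injective fun a => by
    rw [evalBits_scale, BPoly.value_hat, value_single, evalBits_single]
    split_ifs <;> simp [ZMod.val_one]

end PolynomialForms

namespace Poly.DegreeLE

variable {V : Type u} {p : BPoly V}

theorem eq_of_mem_vars (hp : DegreeLE p 1) {S : Mon V} (hS : p.coeff S ≠ 0) {y : V}
    (hy : y ∈ S.vars) : S = Mon.of {y} :=
  Finset.eq_singleton_iff_unique_mem.2
    ⟨hy, fun z hz => Finset.card_le_one.1 (hp S (mem_monomials.2 hS)) z hz y hy⟩

theorem coeff_ne_zero_of_mem_vars (hp : DegreeLE p 1) {y : V} (hy : y ∈ vars p) :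
    p.coeff (Mon.of {y}) ≠ 0 := by
  obtain ⟨S, hS, hyS⟩ := mem_vars.1 hy
  rwa [← hp.eq_of_mem_vars hS hyS]

theorem notMem_vars_X_add (hp : DegreeLE p 1) {y : V} (hy : y ∈ vars p) : y ∉ vars (X y + p) :=
  fun h => by
    refine ((degreeLE_X y).add hp).coeff_ne_zero_of_mem_vars h ?_
    rw [MonoidAlgebra.coeff_add, Finsupp.add_apply, coeff_X_self,
      bit_ne_zero.1 (hp.coeff_ne_zero_of_mem_vars hy), CharTwo.add_self_eq_zero]

theorem eq_X_of_mon_lt_two (hp : DegreeLE p 1) {y : V} (hy : y ∈ vars p) (hmon : mon p < 2) :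
    p = X y := by
  have hmem := mem_monomials.2 (hp.coeff_ne_zero_of_mem_vars hy)
  have hmonomials : monomials p = {Mon.of {y}} := Finset.eq_singleton_iff_unique_mem.2
    ⟨hmem, fun S hS => Finset.card_le_one.1 (Nat.lt_succ_iff.1 hmon) S hS _ hmem⟩
  rw [BPoly.eq_sum_monomials p, hmonomials, Finset.sum_singleton]
  rfl

theorem eq_one_or_eq_of_singleton (hp : DegreeLE p 1) {S : Mon V} (hS : p.coeff S ≠ 0) :
    S = 1 ∨ ∃ v, S = Mon.of {v} :=
  S.vars.eq_empty_or_nonempty.imp id fun ⟨v, hv⟩ => ⟨v, hp.eq_of_mem_vars hS hv⟩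

end Poly.DegreeLE

section Splitting

variable {V : Type u} {P R : Phase V} {y : V} {c : UnitAddCircle} {Q : BPoly V}

theorem Phase.exists_halfHom_value_eq {f : Phase V} (hf : ∀ S, 2 • f S = 0) :
    ∃ Q : BPoly V, ∀ a, halfHom (value a Q) = evalBits a f := by
  refine ⟨∑ S ∈ f.support, MonoidAlgebra.single S 1, fun a => ?_⟩
  rw [map_sum, map_sum, evalBits_apply]
  refine Finset.sum_congr rfl fun S hS => ?_
  have hhalf := (eq_zero_or_eq_half (hf S)).resolve_left (Finsupp.mem_support_iff.1 hS)
  rw [value_single, apply_ite halfHom, map_zero, halfHom_one, hhalf]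

theorem Phase.IsQuadratic.two_nsmul_cofactor_sub (hP : P.IsQuadratic)
    (hc : 2 • (P (Mon.of {y}) - c) = 0) (S : Mon V) :
    2 • (cofactor y P - Finsupp.single 1 c : Phase V) S = 0 := by
  rcases eq_or_ne S 1 with rfl | hS
  · have hone : cofactor y P 1 = P (Mon.of {y}) :=
      (cofactor_apply _ _ _).trans (if_neg (Finset.notMem_empty y))
    rwa [Finsupp.sub_apply, hone, Finsupp.single_eq_same]
  rw [Finsupp.sub_apply, Finsupp.single_eq_of_ne hS, sub_zero, cofactor_apply]
  split_ifs with hy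
  · exact smul_zero _
  have hcard : 3 - (insert y S.vars).card ≤ 1 := by
    have hpos : 0 < S.vars.card := Finset.card_pos.2 (Finset.nonempty_iff_ne_empty.2 hS)
    rw [Finset.card_insert_of_notMem hy]
    lia
  obtain ⟨r, hr⟩ := pow_dvd_pow 2 hcard
  rw [pow_one] at hr
  rw [hr, mul_comm, mul_smul]
  exact (congrArg (r • ·) (hP _ (Finset.insert_nonempty y _))).trans (smul_zero r)

namespace Phase.SplitsAt

theorem halfHom_value_eq (h : P.SplitsAt y c Q R) (a : V → ZMod 2) :
    halfHom (value a Q) =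
      evalBits (Function.update a y 1) P - evalBits (Function.update a y 0) P - c := by
  rw [h.evalBits_update, h.evalBits_update, if_pos rfl, if_neg zero_ne_one]
  abel

theorem evalBits_rest_eq (h : P.SplitsAt y c Q R) (a : V → ZMod 2) :
    evalBits a R = evalBits (Function.update a y 0) P := by
  rw [h.evalBits_update, if_neg zero_ne_one, zero_add]

theorem of_halfHom_value_eq
    (h : ∀ a, halfHom (value a Q) =
      evalBits (Function.update a y 1) P - evalBits (Function.update a y 0) P - c) :
    P.SplitsAt y c Q (P.subst y (BPoly.hat 0)) where
  evalBits_eq a := by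
    rw [evalBits_subst, map_zero]
    rcases bit_eq_zero_or_one (a y) with hy | hy
    · rw [if_neg (hy ▸ zero_ne_one), zero_add, ← hy, Function.update_eq_self]
    · have ha : Function.update a y 1 = a := hy ▸ Function.update_eq_self y a
      rw [if_pos hy, h, ha]
      abel
  notMem_vars := notMem_vars_iff.2 fun a x => halfHom_injective <| by
    rw [h, h, Function.update_idem, Function.update_idem]
  notMem_rest := notMem_coeffVars_iff.2 fun a x => by
    rw [evalBits_subst, evalBits_subst, map_zero, map_zero, Function.update_idem]

theorem vars_subset (h : P.SplitsAt y c Q R) : Poly.vars Q ⊆ P.vars.erase y :=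
  Finset.subset_erase.2 ⟨vars_subset_iff.2 fun a b hab => halfHom_injective <| by
    have hupdate : ∀ x, evalBits (Function.update a y x) P = evalBits (Function.update b y x) P :=
      fun x => evalBits_congr fun v hv => by
        rcases eq_or_ne v y with rfl | hvy
        · rw [Function.update_self, Function.update_self]
        · rw [Function.update_of_ne hvy, Function.update_of_ne hvy, hab v hv]
    rw [h.halfHom_value_eq, h.halfHom_value_eq, hupdate, hupdate], h.notMem_vars⟩

theorem vars_rest_subset (h : P.SplitsAt y c Q R) : R.vars ⊆ P.vars.erase y :=
  Finset.subset_erase.2 ⟨coeffVars_subset_iff.2 fun a b hab => by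
    rw [h.evalBits_rest_eq, h.evalBits_rest_eq]
    exact evalBits_congr fun v hv => by
      rcases eq_or_ne v y with rfl | hvy
      · rw [Function.update_self, Function.update_self]
      · rw [Function.update_of_ne hvy, Function.update_of_ne hvy, hab v hv], h.notMem_rest⟩

theorem unique {P' : Phase V} (h : P.SplitsAt y c Q R) (h' : P'.SplitsAt y c Q R) : P = P' :=
  evalBits_injective fun a => (h.evalBits_eq a).trans (h'.evalBits_eq a).symm

end Phase.SplitsAt

theorem Phase.IsQuadratic.exists_splitsAt (hP : P.IsQuadratic)
    (hc : 2 • (P (Mon.of {y}) - c) = 0) : ∃ Q R, P.SplitsAt y c Q R := by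
  obtain ⟨Q, hQ⟩ := Phase.exists_halfHom_value_eq (hP.two_nsmul_cofactor_sub hc)
  refine ⟨Q, _, Phase.SplitsAt.of_halfHom_value_eq fun a => ?_⟩
  rw [hQ, map_sub, evalBits_cofactor, evalBits_single, if_pos (Mon.holds_one a)]

end Splitting

namespace DSOP

section TerminalDiscards

variable {V : Type u} {n m : ℕ} {t : DSOP V n m}

theorem vars_legs (t : DSOP V n m) : ∀ i, vars (t.legs i) ⊆ t.bound :=
  forall_legs (p := fun p => vars p ⊆ t.bound).2 ⟨t.vars_O, t.vars_I⟩

theorem compound_image_subst_le {D : Finset (BPoly V)} (hD : ∀ d ∈ D, DegreeLE d 1) {y : V}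
    (hy : X y ∉ D) (q : BPoly V) : compound (D.image (subst y q)) ≤ compound D := by
  have hfixed : ∀ d ∈ D, mon d < 2 → subst y q d = d := fun d hd hmon =>
    subst_eq_self fun hyd => hy ((hD d hd).eq_X_of_mon_lt_two hyd hmon ▸ hd)
  have hsub : (D.image (subst y q)).filter (fun d => 2 ≤ mon d) ⊆
      (D.filter fun d => 2 ≤ mon d).image (subst y q) := fun e he => by
    obtain ⟨hmem, hmon⟩ := Finset.mem_filter.1 he
    obtain ⟨d, hd, rfl⟩ := Finset.mem_image.1 hmem
    refine Finset.mem_image_of_mem _ (Finset.mem_filter.2 ⟨hd, ?_⟩)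
    by_contra! hlt
    exact (hfixed d hd hlt ▸ hmon).not_gt hlt
  exact (Finset.card_le_card hsub).trans Finset.card_image_le

theorem IsTerminal.const_notMem (ht : t.IsTerminal) {c : BPoly V} (hc : c = 0 ∨ c = 1) :
    c ∉ t.D := fun h =>
  ht ⟨t.s, t.bound, t.P, t.O, t.D.erase c, t.I, t.vars_P, t.vars_O,
    fun d hd => t.vars_D d (Finset.mem_of_mem_erase hd), t.vars_I⟩
    (Step.cstGround _ _ c hc h rfl rfl rfl rfl rfl rfl)

theorem IsTerminal.coeff_eq_zero_of_prod_eq (ht : t.IsTerminal) {E : Finset (BPoly V)}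
    {d : BPoly V} {S : Mon V} (hd : d ∈ t.D) (hE : E ⊆ t.D.erase d)
    (hS : ∏ e ∈ E, e = MonoidAlgebra.single S 1) : d.coeff S = 0 := by
  by_contra hne
  have hvars : vars (MonoidAlgebra.single S 1 + d) ⊆ t.bound :=
    (vars_add _ _).trans <| Finset.union_subset
      ((vars_single S 1).trans ((vars_subset_of_coeff_ne_zero hne).trans (t.vars_D d hd)))
      (t.vars_D d hd)
  refine ht ⟨t.s, t.bound, t.P, t.O, insert (MonoidAlgebra.single S 1 + d) (t.D.erase d), t.I,
    t.vars_P, t.vars_O, Finset.forall_mem_insert _ _ _ |>.2 ⟨hvars, fun e he =>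
      t.vars_D e (Finset.mem_of_mem_erase he)⟩, t.vars_I⟩
    (Step.xorGround _ _ E d (MonoidAlgebra.single S 1 + d) hd hE ?_ ?_ ?_ rfl rfl rfl rfl rfl rfl)
  · rw [hS, BPoly.add_add_cancel_left]
  · rw [hS]
    exact MonoidAlgebra.single_ne_zero.2 one_ne_zero
  · rw [hS]
    exact disjoint_monomials_single hne

theorem IsTerminal.eq_X_of_mem_vars (ht : t.IsTerminal) (hD : ∀ d ∈ t.D, DegreeLE d 1)
    {d : BPoly V} (hd : d ∈ t.D) {y : V} (hy : y ∈ vars d) : d = X y := by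
  by_contra hne
  have hX : X y ∉ t.D := fun h => (hD d hd).coeff_ne_zero_of_mem_vars hy <|
    ht.coeff_eq_zero_of_prod_eq (E := {X y}) hd
      (Finset.singleton_subset_iff.2 (Finset.mem_erase.2 ⟨Ne.symm hne, h⟩))
      (Finset.prod_singleton _ _)
  have hsubst : ∀ {p : BPoly V}, vars p ⊆ t.bound → vars (subst y d p) ⊆ t.bound := fun hp =>
    (vars_subst_subset _ _ _).trans
      (Finset.union_subset ((Finset.erase_subset _ _).trans hp) (t.vars_D d hd))
  exact ht ⟨t.s, t.bound, t.P.subst y (BPoly.hat d), fun i => subst y d (t.O i),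
    t.D.image (subst y d), fun i => subst y d (t.I i),
    (Phase.vars_subst_subset _ _ _).trans
      (Finset.union_subset ((Finset.erase_subset _ _).trans t.vars_P) (t.vars_D d hd)),
    fun i => hsubst (t.vars_O i), Finset.forall_mem_image.2 fun e he => hsubst (t.vars_D e he),
    fun i => hsubst (t.vars_I i)⟩
    (Step.disc _ _ y d (X y + d) (t.vars_D d hd hy) hd (BPoly.add_add_cancel_left _ _).symm
      (fun h => hne (BPoly.eq_of_add_eq_zero h).symm) ((hD d hd).notMem_vars_X_add hy)
      (compound_image_subst_le (fun e he => hD e (Finset.mem_of_mem_erase he))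
        (fun h => hX (Finset.mem_of_mem_erase h)) d) rfl rfl rfl rfl rfl rfl)

theorem IsTerminal.discard_eq_X (ht : t.IsTerminal) (hD : ∀ d ∈ t.D, DegreeLE d 1)
    {d : BPoly V} (hd : d ∈ t.D) : ∃ y, d = X y := by
  rcases (vars d).eq_empty_or_nonempty with hempty | ⟨y, hy⟩
  · exact absurd hd (ht.const_notMem (eq_zero_or_eq_one_of_vars_eq_empty hempty))
  · exact ⟨y, ht.eq_X_of_mem_vars hD hd hy⟩

theorem IsTerminal.freshD (ht : t.IsTerminal) (hD : ∀ d ∈ t.D, DegreeLE d 1)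
    {D : Finset (BPoly V)} (hsub : D ⊆ t.D) {y : V} (hy : X y ∉ D) : FreshD y D := fun _ hd h =>
  hy (ht.eq_X_of_mem_vars hD (hsub hd) h ▸ hd)

theorem IsTerminal.phase_eq_zero (ht : t.IsTerminal) {S : Mon V}
    (hS : ∀ v ∈ S.vars, X v ∈ t.D) : t.P S = 0 := by
  by_contra hne
  have hprod : Phase.scale (t.P S) (BPoly.hat (∏ d ∈ S.vars.image X, d)) =
      Finsupp.single S (t.P S) := by rw [prod_image_X, Phase.scale_hat_single]
  have hvars : Phase.vars (t.P.erase S) ⊆ t.bound := fun v hv => by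
    obtain ⟨T, hT, hvT⟩ := mem_coeffVars.1 hv
    rcases eq_or_ne T S with rfl | hTS
    · exact (hT Finsupp.erase_same).elim
    · rw [Finsupp.erase_ne hTS] at hT
      exact t.vars_P (mem_coeffVars.2 ⟨T, hT, hvT⟩)
  refine ht ⟨t.s, t.bound, t.P.erase S, t.O, t.D, t.I, hvars, t.vars_O, t.vars_D, t.vars_I⟩
    (Step.zGround _ _ (S.vars.image X) (t.P S) (t.P.erase S) (Finset.image_subset_iff.2 hS)
      ?_ ?_ ?_ rfl rfl rfl rfl rfl rfl)
  · rw [hprod, Finsupp.erase_add_single]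
  · rw [hprod]
    exact Finsupp.single_ne_zero.2 hne
  · rw [hprod, Finsupp.support_erase]
    exact Finset.disjoint_of_subset_right Finsupp.support_single_subset
      (Finset.disjoint_singleton_right.2 (Finset.notMem_erase S _))

theorem IsTerminal.exists_leg_of_discard (ht : t.IsTerminal) (h : t.IsCliffordUpToScalar) {y : V}
    (hy : X y ∈ t.D) : ∃ i, y ∈ vars (t.legs i) := by
  by_contra! hL
  obtain ⟨hO, hI⟩ := forall_legs (p := fun p => y ∉ vars p).1 hL
  have hcoeff : t.P (Mon.of {y}) = 0 := ht.phase_eq_zero fun v hv => by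
    rwa [Finset.mem_singleton.1 hv]
  obtain ⟨Q, R, hsplit⟩ := h.phase.exists_splitsAt (y := y) (c := 0)
    (by rw [hcoeff, sub_zero, smul_zero])
  have hP := hsplit.unique
    (Phase.SplitsAt.scale_half_X_mul_hat_add hsplit.notMem_vars hsplit.notMem_rest)
  have hD := ht.freshD h.discards (Finset.erase_subset _ _) (Finset.notMem_erase (X y) t.D)
  have hbound := Finset.erase_subset_erase y t.vars_P
  exact ht ⟨Real.sqrt 2 * t.s, t.bound.erase y, R, t.O, insert Q (t.D.erase (X y)), t.I,
    hsplit.vars_rest_subset.trans hbound, fun i => Finset.subset_erase.2 ⟨t.vars_O i, hO i⟩,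
    Finset.forall_mem_insert _ _ _ |>.2 ⟨hsplit.vars_subset.trans hbound, fun d hd =>
      Finset.subset_erase.2 ⟨t.vars_D d (Finset.mem_of_mem_erase hd), hD d hd⟩⟩,
    fun i => Finset.subset_erase.2 ⟨t.vars_I i, hI i⟩⟩
    (Step.hGround _ _ y Q R (t.D.erase (X y)) (t.vars_D _ hy (mem_vars_X y))
      (hP.trans (add_comm _ _)) (Finset.insert_erase hy).symm hsplit.notMem_vars
      hsplit.notMem_rest hO hI hD rfl rfl rfl rfl rfl rfl)

end TerminalDiscards

section InternalVariables

variable {V : Type u} {n m : ℕ} {t : DSOP V n m} {y : V}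

/-- The summation variable `y` occurs in no leg and in no discarded polynomial. -/
structure IsInternal (t : DSOP V n m) (y : V) : Prop where
  mem_bound : y ∈ t.bound
  notMem_legs : ∀ i, y ∉ vars (t.legs i)
  freshD : FreshD y t.D

namespace IsInternal

theorem freshO (hy : t.IsInternal y) : FreshL y t.O :=
  (forall_legs (p := fun p => y ∉ vars p).1 hy.notMem_legs).1

theorem freshI (hy : t.IsInternal y) : FreshL y t.I :=
  (forall_legs (p := fun p => y ∉ vars p).1 hy.notMem_legs).2

theorem vars_O_subset (hy : t.IsInternal y) (i : Fin m) : vars (t.O i) ⊆ t.bound.erase y :=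
  Finset.subset_erase.2 ⟨t.vars_O i, hy.freshO i⟩

theorem vars_I_subset (hy : t.IsInternal y) (i : Fin n) : vars (t.I i) ⊆ t.bound.erase y :=
  Finset.subset_erase.2 ⟨t.vars_I i, hy.freshI i⟩

theorem vars_D_subset (hy : t.IsInternal y) : ∀ d ∈ t.D, vars d ⊆ t.bound.erase y := fun d hd =>
  Finset.subset_erase.2 ⟨t.vars_D d hd, hy.freshD d hd⟩

end IsInternal

theorem IsTerminal.mem_phase_vars (ht : t.IsTerminal) (hy : t.IsInternal y) : y ∈ t.P.vars := by
  by_contra hP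
  exact ht ⟨2 * t.s, t.bound.erase y, t.P, t.O, t.D, t.I, Finset.subset_erase.2 ⟨t.vars_P, hP⟩,
    hy.vars_O_subset, hy.vars_D_subset, hy.vars_I_subset⟩
    (Step.elim _ _ y hy.mem_bound hP hy.freshD hy.freshO hy.freshI rfl rfl rfl rfl rfl rfl)

theorem IsTerminal.not_splitsAt_quarter (ht : t.IsTerminal) (hy : t.IsInternal y) {Q : BPoly V}
    {R : Phase V} : ¬ t.P.SplitsAt y quarter Q R := fun hsplit => by
  have hbound := Finset.erase_subset_erase y t.vars_P
  have hQ := vars_subset_iff.1 (hsplit.vars_subset.trans hbound)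
  have hR := coeffVars_subset_iff.1 (hsplit.vars_rest_subset.trans hbound)
  have hvars : (Phase.scale eighth 1 - Phase.scale quarter (BPoly.hat Q) + R).vars ⊆
      t.bound.erase y := coeffVars_subset_iff.2 fun a b hab => by
    simp only [map_add, map_sub, Phase.evalBits_scale, map_one, BPoly.value_hat, hQ a b hab,
      hR a b hab]
  exact ht ⟨Real.sqrt 2 * t.s, t.bound.erase y, _, t.O, t.D, t.I, hvars,
    hy.vars_O_subset, hy.vars_D_subset, hy.vars_I_subset⟩
    (Step.omega _ _ y Q R hy.mem_bound
      (hsplit.unique (Phase.SplitsAt.scale_quarter_X_add_scale_half_X_mul_hat_add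
        hsplit.notMem_vars hsplit.notMem_rest))
      hsplit.notMem_vars hsplit.notMem_rest hy.freshD hy.freshO hy.freshI rfl rfl rfl rfl rfl rfl)

theorem IsTerminal.two_nsmul_phase_eq_zero (ht : t.IsTerminal) (h : t.IsCliffordUpToScalar)
    (hy : t.IsInternal y) : 2 • t.P (Mon.of {y}) = 0 := by
  have hfour : 2 • 2 • t.P (Mon.of {y}) = 0 := by
    rw [← mul_smul]
    exact h.phase (Mon.of {y}) (Finset.singleton_nonempty y)
  refine (eq_zero_or_eq_half hfour).resolve_right fun hhalf => ?_
  obtain ⟨Q, R, hsplit⟩ := h.phase.exists_splitsAt (y := y) (c := quarter)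
    (by rw [smul_sub, hhalf, two_nsmul_quarter, sub_self])
  exact ht.not_splitsAt_quarter hy hsplit

theorem IsTerminal.vars_eq_empty_of_splitsAt (ht : t.IsTerminal) (h : t.IsCliffordUpToScalar)
    (hy : t.IsInternal y) {Q : BPoly V} {R : Phase V} (hsplit : t.P.SplitsAt y 0 Q R) :
    vars Q = ∅ := by
  refine Finset.eq_empty_of_forall_notMem fun y₁ hy₁ => ?_
  have hbound := Finset.erase_subset_erase y t.vars_P
  have hy₁b := hsplit.vars_subset.trans hbound hy₁
  have hne : y ≠ y₁ := (Finset.ne_of_mem_erase hy₁b).symm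
  have hQ₁ : y₁ ∉ vars (X y₁ + Q) := (hsplit.degreeLE h.phase).notMem_vars_X_add hy₁
  have hQ : vars (X y₁ + Q) ⊆ t.bound.erase y := (vars_add _ _).trans <| Finset.union_subset
    ((vars_X y₁).trans (Finset.singleton_subset_iff.2 hy₁b)) (hsplit.vars_subset.trans hbound)
  have hQ' := Finset.subset_erase.2 ⟨hQ, hQ₁⟩
  have hQ₀ : y ∉ vars (X y₁ + Q) := fun hmem => Finset.notMem_erase y _ (hQ hmem)
  have hsubst : ∀ {p : BPoly V}, vars p ⊆ t.bound.erase y →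
      vars (subst y₁ (X y₁ + Q) p) ⊆ (t.bound.erase y).erase y₁ := fun hp =>
    (vars_subst_subset _ _ _).trans (Finset.union_subset (Finset.erase_subset_erase y₁ hp) hQ')
  have hP := Phase.SplitsAt.scale_half_X_mul_X_add_hat_add hne hQ₀ hsplit.notMem_rest
  rw [BPoly.add_add_cancel_left] at hP
  exact ht ⟨2 * t.s, (t.bound.erase y).erase y₁, R.subst y₁ (BPoly.hat (X y₁ + Q)),
    fun i => subst y₁ (X y₁ + Q) (t.O i), t.D.image (subst y₁ (X y₁ + Q)),
    fun i => subst y₁ (X y₁ + Q) (t.I i),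
    (Phase.vars_subst_subset _ _ _).trans (Finset.union_subset
      (Finset.erase_subset_erase y₁ (hsplit.vars_rest_subset.trans hbound)) hQ'),
    fun i => hsubst (hy.vars_O_subset i),
    Finset.forall_mem_image.2 fun d hd => hsubst (hy.vars_D_subset d hd),
    fun i => hsubst (hy.vars_I_subset i)⟩
    (Step.hh _ _ y y₁ (X y₁ + Q) R hy.mem_bound (Finset.mem_of_mem_erase hy₁b) hne
      (hsplit.unique hP) hsplit.notMem_rest hQ₀ hy.freshD hy.freshO hy.freshI hQ₁
      rfl rfl rfl rfl rfl rfl)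

theorem IsTerminal.exists_splitsAt_one (ht : t.IsTerminal) (h : t.IsCliffordUpToScalar)
    (hy : t.IsInternal y) : ∃ R, t.P.SplitsAt y 0 1 R := by
  obtain ⟨Q, R, hsplit⟩ := h.phase.exists_splitsAt (y := y) (c := 0)
    (by rw [sub_zero, ht.two_nsmul_phase_eq_zero h hy])
  rcases eq_zero_or_eq_one_of_vars_eq_empty (ht.vars_eq_empty_of_splitsAt h hy hsplit) with
    rfl | rfl
  · refine absurd (ht.mem_phase_vars hy) ?_
    rw [hsplit.unique (Phase.SplitsAt.of_notMem_vars hsplit.notMem_rest)]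
    exact hsplit.notMem_rest
  · exact ⟨R, hsplit⟩

theorem IsTerminal.eq_zero_of_splitsAt_one (ht : t.IsTerminal) (hy : t.IsInternal y)
    {R : Phase V} (hsplit : t.P.SplitsAt y 0 1 R) :
    t.s = 1 ∧ R = 0 ∧ t.O = 0 ∧ t.I = 0 := by
  by_contra hne
  have hvars : ∀ B : Finset V, vars (0 : BPoly V) ⊆ B := fun B => by simp [vars, coeffVars_zero]
  exact ht ⟨1, {y}, Phase.scale half (X y), 0, ∅, 0, (Phase.vars_scale _ _).trans (vars_X y),
    fun _ => hvars _, fun d hd => absurd hd (Finset.notMem_empty d), fun _ => hvars _⟩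
    (Step.zero _ _ y R hy.mem_bound
      (hsplit.unique (Phase.SplitsAt.scale_half_X_add hsplit.notMem_rest)) (by tauto)
      hsplit.notMem_rest hy.freshD hy.freshO hy.freshI rfl rfl rfl rfl rfl rfl)

theorem IsTerminal.isZeroForm (ht : t.IsTerminal) (h : t.IsCliffordUpToScalar)
    (hy : t.IsInternal y) : t.IsZeroForm y := by
  obtain ⟨R, hsplit⟩ := ht.exists_splitsAt_one h hy
  obtain ⟨hs, rfl, hO, hI⟩ := ht.eq_zero_of_splitsAt_one hy hsplit
  have hP : t.P = Phase.scale half (X y) := by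
    rw [hsplit.unique (Phase.SplitsAt.scale_half_X_add hsplit.notMem_rest), add_zero]
  have hlegs : ∀ i z, z ∉ vars (t.legs i) := fun i z => by
    rw [forall_legs (p := (· = 0)).2 ⟨congrFun hO, congrFun hI⟩ i]
    simp [vars, coeffVars_zero]
  have hD : t.D = ∅ := Finset.eq_empty_of_forall_notMem fun d hd => by
    obtain ⟨z, rfl⟩ := ht.discard_eq_X h.discards hd
    obtain ⟨i, hi⟩ := ht.exists_leg_of_discard h hd
    exact hlegs i z hi
  refine ⟨hs, Finset.eq_singleton_iff_unique_mem.2 ⟨hy.mem_bound, fun z hz => ?_⟩, hP, hO, hD, hI⟩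
  have hzP := ht.mem_phase_vars
    ⟨hz, (hlegs · z), hD ▸ fun d hd => absurd hd (Finset.notMem_empty d)⟩
  exact Finset.mem_singleton.1 (vars_X y (Phase.vars_scale _ _ (hP ▸ hzP)))

theorem IsTerminal.exists_leg (ht : t.IsTerminal) (h : t.IsCliffordUpToScalar)
    (hz : ∀ y, ¬ t.IsZeroForm y) (hy : y ∈ t.bound) : ∃ i, y ∈ vars (t.legs i) := by
  by_contra! hL
  refine hz y (ht.isZeroForm h ⟨hy, hL, ht.freshD h.discards subset_rfl fun hyD => ?_⟩)
  obtain ⟨i, hi⟩ := ht.exists_leg_of_discard h hyD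
  exact hL i hi

end InternalVariables

section TerminalLegs

variable {V : Type u} {n m : ℕ} {t : DSOP V n m} {y : V} {i : Fin (m + n)}

/-- The leg `i` is the first one in which `y` occurs. -/
def IsFirstLeg (t : DSOP V n m) (y : V) (i : Fin (m + n)) : Prop :=
  y ∈ vars (t.legs i) ∧ ∀ j < i, y ∉ vars (t.legs j)

theorem IsTerminal.not_leg_eq_add (ht : t.IsTerminal) (hy : t.IsFirstLeg y i) {q r : BPoly V}
    (hsum : t.legs i = X y + q + r) (hne : q ≠ 0)
    (split : Disjoint (monomials q) (monomials r)) (hq : vars q ⊆ t.bound)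
    (freshq : y ∉ vars q) (freshr : y ∉ vars r) :
    ¬ (FreshD y t.D ∨ (X y ∈ insert 1 t.D ∧ q ∈ insert 1 t.D)) := fun hD => by
  have hyb : y ∈ t.bound := t.vars_legs i hy.1
  have hq' : vars (X y + q) ⊆ t.bound := (vars_add _ _).trans <| Finset.union_subset
    ((vars_X y).trans (Finset.singleton_subset_iff.2 hyb)) hq
  have hP : (t.P.subst y (BPoly.hat (X y + q))).vars ⊆ t.bound :=
    (Phase.vars_subst_subset _ _ _).trans
      (Finset.union_subset ((Finset.erase_subset _ _).trans t.vars_P) hq')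
  have hsubst : ∀ {p : BPoly V}, vars p ⊆ t.bound → vars (subst y (X y + q) p) ⊆ t.bound :=
    fun hp => (vars_subst_subset _ _ _).trans
      (Finset.union_subset ((Finset.erase_subset _ _).trans hp) hq')
  induction i using Fin.addCases with
  | left k =>
    rw [legs_castAdd] at hsum
    exact ht ⟨t.s, t.bound, t.P.subst y (BPoly.hat (X y + q)),
      fun j => subst y (X y + q) (t.O j), t.D, fun j => subst y (X y + q) (t.I j), hP,
      fun i => hsubst (t.vars_O i), t.vars_D, fun i => hsubst (t.vars_I i)⟩
      (Step.ket _ _ y k q r hyb hsum hne split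
        (fun j hj => t.legs_castAdd j ▸ hy.2 (Fin.castAdd n j) hj) freshq freshr hD
        rfl rfl rfl rfl rfl rfl)
  | right k =>
    rw [legs_natAdd] at hsum
    exact ht ⟨t.s, t.bound, t.P.subst y (BPoly.hat (X y + q)),
      t.O, t.D, fun j => subst y (X y + q) (t.I j), hP,
      t.vars_O, t.vars_D, fun i => hsubst (t.vars_I i)⟩
      (Step.bra _ _ y k q r hyb hsum hne split
        (fun j => t.legs_castAdd j ▸
          hy.2 (Fin.castAdd n j) (Fin.lt_def.2 (Nat.lt_add_right _ j.isLt)))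
        (fun j hj => t.legs_natAdd j ▸ hy.2 (Fin.natAdd m j) (by simpa using hj))
        freshq freshr hD rfl rfl rfl rfl rfl rfl)

theorem IsTerminal.leg_eq_X (ht : t.IsTerminal) (h : t.IsCliffordUpToScalar)
    (hy : t.IsFirstLeg y i) (hyD : X y ∉ t.D) : t.legs i = X y := by
  by_contra hne
  refine ht.not_leg_eq_add hy (q := X y + t.legs i) (r := 0) ?_
    (fun h0 => hne (BPoly.eq_of_add_eq_zero h0).symm) ?_ ?_ ((h.legs i).notMem_vars_X_add hy.1)
    ?_ (Or.inl (ht.freshD h.discards subset_rfl hyD))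
  · rw [add_zero, BPoly.add_add_cancel_left]
  · simp [monomials]
  · exact (vars_add _ _).trans <| Finset.union_subset ((vars_X y).trans
      (Finset.singleton_subset_iff.2 (t.vars_legs i hy.1))) (t.vars_legs i)
  · simp [vars, coeffVars_zero]

theorem IsTerminal.notMem_discards_of_coeff_ne_zero (ht : t.IsTerminal)
    (h : t.IsCliffordUpToScalar) (hy : t.IsFirstLeg y i) (hyD : X y ∈ t.D) {S : Mon V}
    (hS : (t.legs i).coeff S ≠ 0) (hSy : S ≠ Mon.of {y}) :
    (MonoidAlgebra.single S 1 : BPoly V) ∉ insert 1 t.D := fun hSD => by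
  have hyS : y ∉ vars (MonoidAlgebra.single S 1 : BPoly V) := fun hmem =>
    hSy ((h.legs i).eq_of_mem_vars hS (vars_single S 1 hmem))
  have hcoeff : (X y + t.legs i).coeff S ≠ 0 := by
    rwa [MonoidAlgebra.coeff_add, Finsupp.add_apply, X, MonoidAlgebra.coeff_single,
      Finsupp.single_eq_of_ne hSy, zero_add]
  refine ht.not_leg_eq_add hy (r := MonoidAlgebra.single S 1 + (X y + t.legs i)) ?_
    (MonoidAlgebra.single_ne_zero.2 one_ne_zero) (disjoint_monomials_single hcoeff)
    ((vars_single S 1).trans ((vars_subset_of_coeff_ne_zero hS).trans (t.vars_legs i))) hyS ?_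
    (Or.inr ⟨Finset.mem_insert_of_mem hyD, hSD⟩)
  · rw [add_assoc, BPoly.add_add_cancel_left, BPoly.add_add_cancel_left]
  · exact fun hmem => (Finset.mem_union.1 (vars_add _ _ hmem)).elim hyS
      ((h.legs i).notMem_vars_X_add hy.1)

/-- The shape of the terminal terms with a nonzero interpretation: every bound variable occurs in a
leg, and the first leg containing `y` is `y` itself or, if `y` is discarded, the sum of `y` and of
variables that are not discarded. -/
structure IsNormal (t : DSOP V n m) : Prop where
  scalar_pos : 0 < t.s
  legs : ∀ i, DegreeLE (t.legs i) 1
  discard_eq_X : ∀ d ∈ t.D, ∃ y, d = X y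
  phase_eq_zero : ∀ S : Mon V, (∀ v ∈ S.vars, X v ∈ t.D) → t.P S = 0
  exists_leg : ∀ y ∈ t.bound, ∃ i, y ∈ vars (t.legs i)
  leg_eq_X : ∀ y i, t.IsFirstLeg y i → X y ∉ t.D → t.legs i = X y
  exists_eq_singleton : ∀ y i, t.IsFirstLeg y i → X y ∈ t.D → ∀ S, (t.legs i).coeff S ≠ 0 →
    S ≠ Mon.of {y} → ∃ z, S = Mon.of {z} ∧ X z ∉ t.D

theorem IsTerminal.isNormal (ht : t.IsTerminal) (h : t.IsCliffordUpToScalar)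
    (hz : ∀ y, ¬ t.IsZeroForm y) : t.IsNormal where
  scalar_pos := h.scalar_pos
  legs := h.legs
  discard_eq_X _ := ht.discard_eq_X h.discards
  phase_eq_zero _ := ht.phase_eq_zero
  exists_leg _ := ht.exists_leg h hz
  leg_eq_X _ _ := ht.leg_eq_X h
  exists_eq_singleton y i hy hyD S hS hSy := by
    have hSD := ht.notMem_discards_of_coeff_ne_zero h hy hyD hS hSy
    rcases (h.legs i).eq_one_or_eq_of_singleton hS with rfl | ⟨z, rfl⟩
    · exact absurd (Finset.mem_insert_self _ _) hSD
    · exact ⟨z, rfl, fun hzD => hSD (Finset.mem_insert_of_mem hzD)⟩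

end TerminalLegs

end DSOP

theorem exists_perm_eqOn_of_injOn {V : Type u} {A : Finset V} {f : V → V} (hf : Set.InjOn f A) :
    ∃ σ : Equiv.Perm V, Set.EqOn σ f A := by
  obtain ⟨g, hg⟩ := Finset.exists_equiv_extend_of_card_eq (t := A ∪ A.image f)
    (s := Finset.univ.filter fun x : ↥(A ∪ A.image f) => x.1 ∈ A) (f := fun x => f x)
    (Fintype.card_coe _)
    (Finset.image_subset_iff.2 fun x hx => Finset.mem_union_right _
      (Finset.mem_image_of_mem f (Finset.mem_filter.1 hx).2))
    fun x hx y hy hxy => Subtype.ext <| hf (Finset.mem_filter.1 hx).2 (Finset.mem_filter.1 hy).2 hxy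
  refine ⟨Equiv.Perm.ofSubtype g, fun v hv => ?_⟩
  have hv' : v ∈ A ∪ A.image f := Finset.mem_union_left _ hv
  exact (Equiv.Perm.ofSubtype_apply_of_mem g hv').trans
    (hg ⟨v, hv'⟩ (Finset.mem_filter.2 ⟨Finset.mem_univ _, hv⟩))

namespace DSOP

variable {V : Type u} {n m : ℕ} {t t₁ t₂ : DSOP V n m}

section FirstLegs

variable {y : V} {i j : Fin (m + n)}

theorem IsFirstLeg.mem_bound (h : t.IsFirstLeg y i) : y ∈ t.bound := t.vars_legs i h.1

theorem IsFirstLeg.index_unique (hi : t.IsFirstLeg y i) (hj : t.IsFirstLeg y j) : i = j :=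
  le_antisymm (not_lt.1 fun h => hi.2 j h hj.1) (not_lt.1 fun h => hj.2 i h hi.1)

theorem exists_isFirstLeg_le (h : y ∈ vars (t.legs i)) : ∃ j ≤ i, t.IsFirstLeg y j := by
  obtain ⟨j, hji, hj⟩ := exists_minimal_le_of_wellFoundedLT (fun k => y ∈ vars (t.legs k)) i h
  exact ⟨j, hji, hj.prop, fun k hk hyk => hk.not_ge (hj.le_of_le hyk hk.le)⟩

end FirstLegs

/-- The bits of the legs along a path. -/
def legValues (t : DSOP V n m) (a : V → ZMod 2) : Fin (m + n) → ZMod 2 :=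
  fun i => value a (t.legs i)

/-- Two paths agree on the discarded variables. -/
def AgreeOnDiscards (t : DSOP V n m) (a b : V → ZMod 2) : Prop := ∀ y, X y ∈ t.D → a y = b y

theorem legValues_congr {a b : V → ZMod 2} (h : Set.EqOn a b t.bound) :
    t.legValues a = t.legValues b :=
  funext fun i => value_congr fun _ hv => h (t.vars_legs i hv)

theorem contributes_congr {x₁ x₂ : Fin (m + n) → ZMod 2} {a a' b b' : V → ZMod 2}
    (ha : Set.EqOn a a' t.bound) (hb : Set.EqOn b b' t.bound) :
    t.Contributes x₁ x₂ a b ↔ t.Contributes x₁ x₂ a' b' := by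
  have hD : ∀ d ∈ t.D, (value a d = value b d ↔ value a' d = value b' d) := fun d hd => by
    rw [value_congr fun v hv => ha (t.vars_D d hd hv),
      value_congr fun v hv => hb (t.vars_D d hd hv)]
  have hlegs := congrFun (legValues_congr ha)
  have hlegs' := congrFun (legValues_congr hb)
  simp only [legValues] at hlegs hlegs'
  simp only [Contributes, hlegs, hlegs', forall₂_congr hD]

namespace IsNormal

section SingleTerm

theorem isFirstLeg_unique (h : t.IsNormal) {y z : V} {i : Fin (m + n)} (hy : t.IsFirstLeg y i)
    (hz : t.IsFirstLeg z i) : y = z := by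
  have eq_of_notMem : ∀ {y z}, t.IsFirstLeg y i → t.IsFirstLeg z i → X y ∉ t.D → y = z :=
    fun {y z} hy hz hyD => (Finset.mem_singleton.1
      (vars_X y (h.leg_eq_X y i hy hyD ▸ hz.1))).symm
  by_cases hyD : X y ∈ t.D
  · by_cases hzD : X z ∈ t.D
    · by_contra hne
      obtain ⟨w, hw, hwD⟩ := h.exists_eq_singleton y i hy hyD _
        ((h.legs i).coeff_ne_zero_of_mem_vars hz.1)
        fun hzy => hne (Finset.singleton_injective hzy).symm
      exact hwD (Finset.singleton_injective hw ▸ hzD)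
    · exact (eq_of_notMem hz hy hzD).symm
  · exact eq_of_notMem hy hz hyD

theorem exists_isFirstLeg (h : t.IsNormal) {y : V} (hy : y ∈ t.bound) : ∃ i, t.IsFirstLeg y i := by
  obtain ⟨i, hi⟩ := h.exists_leg y hy
  obtain ⟨j, -, hj⟩ := exists_isFirstLeg_le hi
  exact ⟨j, hj⟩

theorem apply_eq_of_legValues_eq (h : t.IsNormal) {a b : V → ZMod 2} {i : Fin (m + n)}
    (hab : ∀ j ≤ i, t.legValues a j = t.legValues b j) {v : V} (hv : t.IsFirstLeg v i) :
    a v = b v := by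
  induction i using WellFoundedLT.induction generalizing v with
  | ind i ih =>
    have hrest : value a (X v + t.legs i) = value b (X v + t.legs i) := by
      refine value_congr fun w hw => ?_
      have hwv : w ≠ v := fun hwv => (h.legs i).notMem_vars_X_add hv.1 (hwv ▸ hw)
      have hwi : w ∈ vars (t.legs i) := (Finset.mem_union.1 (vars_add _ _ hw)).resolve_left
        fun hwX => hwv (Finset.mem_singleton.1 (vars_X v hwX))
      obtain ⟨j, hj, hwj⟩ := exists_isFirstLeg_le hwi
      have hne : j ≠ i := by
        rintro rfl
        exact hwv (h.isFirstLeg_unique hwj hv)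
      exact ih j (lt_of_le_of_ne hj hne) (fun k hk => hab k (hk.trans hj)) hwj
    rw [map_add, map_add, value_X_bit, value_X_bit, show value a (t.legs i) = value b (t.legs i)
      from hab i le_rfl] at hrest
    exact add_right_cancel hrest

theorem eqOn_bound (h : t.IsNormal) {a b : V → ZMod 2} (hab : t.legValues a = t.legValues b) :
    Set.EqOn a b t.bound := fun v hv => by
  obtain ⟨i, hi⟩ := h.exists_isFirstLeg hv
  exact h.apply_eq_of_legValues_eq (fun j _ => congrFun hab j) hi

theorem contributes_legValues_iff (h : t.IsNormal) {a b : V → ZMod 2} :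
    t.Contributes (t.legValues a) (t.legValues b) a b ↔ t.AgreeOnDiscards a b := by
  refine ⟨fun hc y hy => by simpa only [value_X_bit] using hc.2.2 _ hy,
    fun hab => ⟨fun _ => rfl, fun _ => rfl, fun d hd => ?_⟩⟩
  obtain ⟨y, rfl⟩ := h.discard_eq_X d hd
  rw [value_X_bit, value_X_bit, hab y hd]

theorem density_legValues (h : t.IsNormal) (a b : V → ZMod 2) :
    t.density (t.legValues a) (t.legValues b) = (t.s : ℂ) ^ 2 *
      if t.AgreeOnDiscards a b then phaseChar (evalBits a t.P - evalBits b t.P) else 0 := by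
  have hphase : ∀ {a a'}, Set.EqOn a' a t.bound → evalBits a' t.P = evalBits a t.P :=
    fun ha => evalBits_congr fun v hv => ha (t.vars_P hv)
  rw [density]
  congr 1
  rw [sumPaths_eq_single (a := a), sumPaths_eq_single (a := b)]
  · simp only [h.contributes_legValues_iff, phaseChar_mul_conj, mul_ite, mul_one, mul_zero]
  · exact fun b' hb' => by rw [if_neg fun hc => hb' (h.eqOn_bound (funext hc.2.1)), mul_zero]
  · exact fun b' hb' => by simp only [hphase hb', contributes_congr (Set.eqOn_refl a _) hb']
  · refine fun a' ha' => (sumPaths_congr fun b' => ?_).trans (sumPaths_zero _)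
    rw [if_neg fun hc => ha' (h.eqOn_bound (funext hc.1)), mul_zero]
  · refine fun a' ha' => sumPaths_congr fun b' => ?_
    simp only [hphase ha', contributes_congr ha' (Set.eqOn_refl b' _)]

theorem scalar_sq_ne_zero (h : t.IsNormal) : (t.s : ℂ) ^ 2 ≠ 0 :=
  pow_ne_zero 2 (Complex.ofReal_ne_zero.2 h.scalar_pos.ne')

theorem density_legValues_self (h : t.IsNormal) (a : V → ZMod 2) :
    t.density (t.legValues a) (t.legValues a) = (t.s : ℂ) ^ 2 := by
  have hagree : t.AgreeOnDiscards a a := fun _ _ => rfl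
  rw [h.density_legValues, if_pos hagree, sub_self, AddChar.map_zero_eq_one, mul_one]

theorem density_ne_zero (h : t.IsNormal) : t.density ≠ 0 := fun hd => h.scalar_sq_ne_zero <| by
  rw [← h.density_legValues_self 0, hd, Pi.zero_apply, Pi.zero_apply]

theorem exists_isFirstLeg_notMem_iff (h : t.IsNormal) (K : Set V) (i : Fin (m + n)) :
    (∃ v, t.IsFirstLeg v i ∧ v ∉ K) ↔ ∃ a b : V → ZMod 2, Set.EqOn a b K ∧
      (∀ j < i, t.legValues a j = t.legValues b j) ∧ t.legValues a i ≠ t.legValues b i := by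
  constructor
  · rintro ⟨v, hv, hvK⟩
    refine ⟨0, Function.update 0 v 1, fun w hw => ?_,
      fun j hj => (notMem_vars_iff.1 (hv.2 j hj) 0 1).symm, fun heq => ?_⟩
    · rw [Function.update_of_ne (ne_of_mem_of_not_mem hw hvK)]
    · have hrest := notMem_vars_iff.1 ((h.legs i).notMem_vars_X_add hv.1) 0 1
      rw [map_add, map_add, value_X_bit, value_X_bit, Function.update_self,
        ← show value 0 (t.legs i) = value (Function.update 0 v 1) (t.legs i) from heq] at hrest
      exact one_ne_zero (add_right_cancel hrest)
  · rintro ⟨a, b, hK, hlt, hne⟩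
    by_contra! hno
    refine hne (value_congr fun v hv => ?_)
    obtain ⟨j, hj, hvj⟩ := exists_isFirstLeg_le hv
    rcases hj.lt_or_eq with hj | rfl
    · exact h.apply_eq_of_legValues_eq (fun k hk => hlt k (hk.trans_lt hj)) hvj
    · exact hK (hno v hvj)

theorem legValues_eq_apply (h : t.IsNormal) {y : V} {i : Fin (m + n)} (hy : t.IsFirstLeg y i)
    (hyD : X y ∈ t.D) {a : V → ZMod 2} (ha : ∀ z ∈ vars (t.legs i), X z ∉ t.D → a z = 0) :
    t.legValues a i = a y := by
  have hrest : value a (X y + t.legs i) = 0 := by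
    rw [value_eq_evalBits]
    refine evalBits_eq_zero_of_forall_holds fun S hold => ?_
    by_contra hS
    have hSy : S ≠ Mon.of {y} := fun hSy => (h.legs i).notMem_vars_X_add hy.1
      (mem_vars.2 ⟨S, hS, hSy ▸ Finset.mem_singleton_self y⟩)
    rw [MonoidAlgebra.coeff_add, Finsupp.add_apply, X, MonoidAlgebra.coeff_single,
      Finsupp.single_eq_of_ne hSy, zero_add] at hS
    obtain ⟨z, rfl, hzD⟩ := h.exists_eq_singleton y i hy hyD S hS hSy
    have hz : z ∈ (Mon.of {z}).vars := Finset.mem_singleton_self z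
    exact zero_ne_one ((ha z (mem_vars.2 ⟨_, hS, hz⟩) hzD).symm.trans (hold z hz))
  rw [map_add, value_X_bit] at hrest
  exact (CharTwo.add_eq_zero.1 hrest).symm

end SingleTerm

section EqualDensities

theorem exists_legValues_eq (h₂ : t₂.IsNormal) (hd : t₁.density = t₂.density) (a : V → ZMod 2) :
    ∃ c, t₁.legValues c = t₂.legValues a := by
  by_contra! hno
  refine h₂.scalar_sq_ne_zero ?_
  rw [← h₂.density_legValues_self a, ← hd, density]
  refine mul_eq_zero_of_right _ <| (sumPaths_congr fun c => (sumPaths_congr fun e => ?_).trans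
    (sumPaths_zero _)).trans (sumPaths_zero _)
  rw [if_neg fun hc => hno c (funext hc.1), mul_zero]

theorem scalar_eq (h₁ : t₁.IsNormal) (h₂ : t₂.IsNormal) (hd : t₁.density = t₂.density) :
    t₁.s = t₂.s := by
  obtain ⟨c, hc⟩ := h₂.exists_legValues_eq hd 0
  have hsq := h₁.density_legValues_self c
  rw [hc, hd, h₂.density_legValues_self] at hsq
  exact ((pow_left_inj₀ h₂.scalar_pos.le h₁.scalar_pos.le two_ne_zero).1
    (by exact_mod_cast hsq)).symm

theorem ite_agreeOnDiscards_eq (h₁ : t₁.IsNormal) (h₂ : t₂.IsNormal)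
    (hd : t₁.density = t₂.density) {a b c e : V → ZMod 2}
    (hc : t₁.legValues c = t₂.legValues a) (he : t₁.legValues e = t₂.legValues b) :
    (if t₁.AgreeOnDiscards c e then phaseChar (evalBits c t₁.P - evalBits e t₁.P) else 0) =
      if t₂.AgreeOnDiscards a b then phaseChar (evalBits a t₂.P - evalBits b t₂.P) else 0 := by
  refine mul_left_cancel₀ h₂.scalar_sq_ne_zero ?_
  rw [← h₂.density_legValues, ← hc, ← he, ← hd, h₁.density_legValues, h₁.scalar_eq h₂ hd]

theorem agreeOnDiscards_iff (h₁ : t₁.IsNormal) (h₂ : t₂.IsNormal) (hd : t₁.density = t₂.density)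
    {a b c e : V → ZMod 2} (hc : t₁.legValues c = t₂.legValues a)
    (he : t₁.legValues e = t₂.legValues b) :
    t₁.AgreeOnDiscards c e ↔ t₂.AgreeOnDiscards a b := by
  have hite := h₁.ite_agreeOnDiscards_eq h₂ hd hc he
  by_cases h : t₁.AgreeOnDiscards c e <;> by_cases h' : t₂.AgreeOnDiscards a b <;>
    simp_all [phaseChar_ne_zero, (phaseChar_ne_zero _).symm]

theorem phase_sub_eq (h₁ : t₁.IsNormal) (h₂ : t₂.IsNormal) (hd : t₁.density = t₂.density)
    {a b c e : V → ZMod 2} (hc : t₁.legValues c = t₂.legValues a)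
    (he : t₁.legValues e = t₂.legValues b) (hab : t₂.AgreeOnDiscards a b) :
    evalBits c t₁.P - evalBits e t₁.P = evalBits a t₂.P - evalBits b t₂.P := by
  have hite := h₁.ite_agreeOnDiscards_eq h₂ hd hc he
  rw [if_pos hab, if_pos ((h₁.agreeOnDiscards_iff h₂ hd hc he).2 hab)] at hite
  exact phaseChar_injective hite

theorem exists_isFirstLeg_of_density_eq (h₁ : t₁.IsNormal) (h₂ : t₂.IsNormal)
    (hd : t₁.density = t₂.density) {v : V} {i : Fin (m + n)} (hv : t₁.IsFirstLeg v i) :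
    ∃ w, t₂.IsFirstLeg w i := by
  obtain ⟨a, b, -, hlt, hne⟩ := (h₁.exists_isFirstLeg_notMem_iff ∅ i).1 ⟨v, hv, id⟩
  obtain ⟨c, hc⟩ := h₁.exists_legValues_eq hd.symm a
  obtain ⟨e, he⟩ := h₁.exists_legValues_eq hd.symm b
  rw [← hc, ← he] at hlt hne
  obtain ⟨w, hw, -⟩ := (h₂.exists_isFirstLeg_notMem_iff ∅ i).2
    ⟨c, e, Set.eqOn_empty _ _, hlt, hne⟩
  exact ⟨w, hw⟩

theorem exists_isFirstLeg_notMem_discards (h₁ : t₁.IsNormal) (h₂ : t₂.IsNormal)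
    (hd : t₁.density = t₂.density) {v : V} {i : Fin (m + n)} (hv : t₁.IsFirstLeg v i)
    (hvD : X v ∉ t₁.D) : ∃ w, t₂.IsFirstLeg w i ∧ X w ∉ t₂.D := by
  obtain ⟨a, b, hab, hlt, hne⟩ :=
    (h₁.exists_isFirstLeg_notMem_iff {y | X y ∈ t₁.D} i).1 ⟨v, hv, hvD⟩
  obtain ⟨c, hc⟩ := h₁.exists_legValues_eq hd.symm a
  obtain ⟨e, he⟩ := h₁.exists_legValues_eq hd.symm b
  have hce := (h₂.agreeOnDiscards_iff h₁ hd.symm hc he).2 hab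
  rw [← hc, ← he] at hlt hne
  exact (h₂.exists_isFirstLeg_notMem_iff {y | X y ∈ t₂.D} i).2 ⟨c, e, hce, hlt, hne⟩

end EqualDensities

end IsNormal

section Renaming

variable {σ : Equiv.Perm V}

/-- The renaming `σ` carries every variable of `t₁` to a variable of `t₂` with the same first
leg. -/
def PreservesFirstLegs (σ : Equiv.Perm V) (t₁ t₂ : DSOP V n m) : Prop :=
  ∀ v i, t₁.IsFirstLeg v i → t₂.IsFirstLeg (σ v) i

namespace IsNormal

theorem exists_preservesFirstLegs (h₁ : t₁.IsNormal) (h₂ : t₂.IsNormal)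
    (hd : t₁.density = t₂.density) : ∃ σ : Equiv.Perm V, PreservesFirstLegs σ t₁ t₂ := by
  have hex : ∀ v, ∃ w, ∀ i, t₁.IsFirstLeg v i → t₂.IsFirstLeg w i := fun v => by
    by_cases hv : ∃ i, t₁.IsFirstLeg v i
    · obtain ⟨i, hi⟩ := hv
      obtain ⟨w, hw⟩ := h₁.exists_isFirstLeg_of_density_eq h₂ hd hi
      exact ⟨w, fun j hj => hi.index_unique hj ▸ hw⟩
    · exact ⟨v, fun i hi => absurd ⟨i, hi⟩ hv⟩
  choose f hf using hex
  have hinj : Set.InjOn f t₁.bound := fun v hv w hw hvw => by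
    obtain ⟨i, hi⟩ := h₁.exists_isFirstLeg hv
    obtain ⟨j, hj⟩ := h₁.exists_isFirstLeg hw
    obtain rfl := (hf v i hi).index_unique (hvw ▸ hf w j hj)
    exact h₁.isFirstLeg_unique hi hj
  obtain ⟨σ, hσ⟩ := exists_perm_eqOn_of_injOn hinj
  exact ⟨σ, fun v i hi => hσ hi.mem_bound ▸ hf v i hi⟩

theorem bound_eq_image (h₁ : t₁.IsNormal) (h₂ : t₂.IsNormal) (hd : t₁.density = t₂.density)
    (hσ : PreservesFirstLegs σ t₁ t₂) : t₂.bound = t₁.bound.image σ := by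
  refine Finset.Subset.antisymm (fun w hw => ?_) (Finset.image_subset_iff.2 fun v hv => ?_)
  · obtain ⟨i, hi⟩ := h₂.exists_isFirstLeg hw
    obtain ⟨v, hv⟩ := h₂.exists_isFirstLeg_of_density_eq h₁ hd.symm hi
    exact Finset.mem_image.2 ⟨v, hv.mem_bound, h₂.isFirstLeg_unique (hσ v i hv) hi⟩
  · obtain ⟨i, hi⟩ := h₁.exists_isFirstLeg hv
    exact (hσ v i hi).mem_bound

theorem X_mem_discards_iff (h₁ : t₁.IsNormal) (h₂ : t₂.IsNormal) (hd : t₁.density = t₂.density)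
    (hσ : PreservesFirstLegs σ t₁ t₂) (v : V) : X v ∈ t₁.D ↔ X (σ v) ∈ t₂.D := by
  have mem_bound : ∀ {t : DSOP V n m} {v}, X v ∈ t.D → v ∈ t.bound := fun {t v} h =>
    t.vars_D _ h (mem_vars_X v)
  by_cases hv : v ∈ t₁.bound
  · obtain ⟨i, hi⟩ := h₁.exists_isFirstLeg hv
    refine not_iff_not.1 ⟨fun hvD => ?_, fun hvD => ?_⟩
    · obtain ⟨w, hw, hwD⟩ := h₁.exists_isFirstLeg_notMem_discards h₂ hd hi hvD
      exact h₂.isFirstLeg_unique hw (hσ v i hi) ▸ hwD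
    · obtain ⟨w, hw, hwD⟩ := h₂.exists_isFirstLeg_notMem_discards h₁ hd.symm (hσ v i hi) hvD
      exact h₁.isFirstLeg_unique hw hi ▸ hwD
  · refine iff_of_false (fun h => hv (mem_bound h)) fun h => hv ?_
    obtain ⟨w, hw, hwv⟩ := Finset.mem_image.1 (h₁.bound_eq_image h₂ hd hσ ▸ mem_bound h)
    exact σ.injective hwv ▸ hw

theorem apply_eq_of_notMem_discards (h₁ : t₁.IsNormal) (h₂ : t₂.IsNormal)
    (hd : t₁.density = t₂.density) (hσ : PreservesFirstLegs σ t₁ t₂) {a c : V → ZMod 2}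
    (hc : t₁.legValues c = t₂.legValues a) {v : V} (hv : v ∈ t₁.bound) (hvD : X v ∉ t₁.D) :
    c v = a (σ v) := by
  obtain ⟨i, hi⟩ := h₁.exists_isFirstLeg hv
  have hleg := congrFun hc i
  rwa [legValues, legValues, h₁.leg_eq_X v i hi hvD,
    h₂.leg_eq_X _ i (hσ v i hi) (mt (h₁.X_mem_discards_iff h₂ hd hσ v).2 hvD), value_X_bit,
    value_X_bit] at hleg

end IsNormal

/-- The assignment that agrees with `a` on the discarded variables and vanishes elsewhere. -/
def restrictToDiscards (t : DSOP V n m) (a : V → ZMod 2) : V → ZMod 2 :=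
  fun v => if X v ∈ t.D then a v else 0

theorem agreeOnDiscards_restrictToDiscards (t : DSOP V n m) (a : V → ZMod 2) :
    t.AgreeOnDiscards a (t.restrictToDiscards a) := fun _ hy => (if_pos hy).symm

namespace IsNormal

theorem evalBits_restrictToDiscards (h : t.IsNormal) (a : V → ZMod 2) :
    evalBits (t.restrictToDiscards a) t.P = 0 :=
  evalBits_eq_zero_of_forall_holds fun S hold => h.phase_eq_zero S fun v hv => by
    by_contra hvD
    exact zero_ne_one ((if_neg hvD).symm.trans (hold v hv))

theorem restrictToDiscards_comp (h₁ : t₁.IsNormal) (h₂ : t₂.IsNormal)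
    (hd : t₁.density = t₂.density) (hσ : PreservesFirstLegs σ t₁ t₂) (a : V → ZMod 2) :
    t₂.restrictToDiscards a ∘ σ = t₁.restrictToDiscards (a ∘ σ) := funext fun v => by
  simp only [restrictToDiscards, Function.comp_apply, h₁.X_mem_discards_iff h₂ hd hσ v]

/- Discarded variables are compared through a path that vanishes on the others: there the first
leg of `v` takes the value of `v`. -/
theorem apply_eq_of_mem_discards (h₁ : t₁.IsNormal) (h₂ : t₂.IsNormal)
    (hd : t₁.density = t₂.density) (hσ : PreservesFirstLegs σ t₁ t₂) {a c : V → ZMod 2}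
    (hc : t₁.legValues c = t₂.legValues a) {v : V} (hv : v ∈ t₁.bound) (hvD : X v ∈ t₁.D) :
    c v = a (σ v) := by
  have hD := h₁.X_mem_discards_iff h₂ hd hσ
  obtain ⟨i, hi⟩ := h₁.exists_isFirstLeg hv
  obtain ⟨e, he⟩ := h₂.exists_legValues_eq hd (t₂.restrictToDiscards a)
  have hce : t₁.AgreeOnDiscards c e := (h₁.agreeOnDiscards_iff h₂ hd hc he).2
    (t₂.agreeOnDiscards_restrictToDiscards a)
  have hzero : ∀ z ∈ vars (t₁.legs i), X z ∉ t₁.D → e z = 0 := fun z hz hzD =>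
    (h₁.apply_eq_of_notMem_discards h₂ hd hσ he (t₁.vars_legs i hz) hzD).trans
      (if_neg (mt (hD z).2 hzD))
  calc c v = e v := hce v hvD
    _ = t₁.legValues e i := (h₁.legValues_eq_apply hi hvD hzero).symm
    _ = t₂.legValues (t₂.restrictToDiscards a) i := congrFun he i
    _ = t₂.restrictToDiscards a (σ v) :=
      h₂.legValues_eq_apply (hσ v i hi) ((hD v).1 hvD) fun _ _ hzD => if_neg hzD
    _ = a (σ v) := if_pos ((hD v).1 hvD)

theorem legValues_comp (h₁ : t₁.IsNormal) (h₂ : t₂.IsNormal) (hd : t₁.density = t₂.density)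
    (hσ : PreservesFirstLegs σ t₁ t₂) (a : V → ZMod 2) :
    t₁.legValues (a ∘ σ) = t₂.legValues a := by
  obtain ⟨c, hc⟩ := h₂.exists_legValues_eq hd a
  refine (legValues_congr fun v hv => ?_).trans hc
  by_cases hvD : X v ∈ t₁.D
  · exact (h₁.apply_eq_of_mem_discards h₂ hd hσ hc hv hvD).symm
  · exact (h₁.apply_eq_of_notMem_discards h₂ hd hσ hc hv hvD).symm

theorem legs_eq_rename (h₁ : t₁.IsNormal) (h₂ : t₂.IsNormal) (hd : t₁.density = t₂.density)
    (hσ : PreservesFirstLegs σ t₁ t₂) (i : Fin (m + n)) :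
    t₂.legs i = rename σ (t₁.legs i) := value_injective fun a => by
  rw [value_rename]
  exact (congrFun (h₁.legValues_comp h₂ hd hσ a) i).symm

theorem phase_eq_rename (h₁ : t₁.IsNormal) (h₂ : t₂.IsNormal) (hd : t₁.density = t₂.density)
    (hσ : PreservesFirstLegs σ t₁ t₂) : t₂.P = t₁.P.rename σ := evalBits_injective fun a => by
  have hsub := h₁.phase_sub_eq h₂ hd (h₁.legValues_comp h₂ hd hσ a)
    (h₁.legValues_comp h₂ hd hσ (t₂.restrictToDiscards a))
    (t₂.agreeOnDiscards_restrictToDiscards a)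
  rw [h₁.restrictToDiscards_comp h₂ hd hσ, h₁.evalBits_restrictToDiscards,
    h₂.evalBits_restrictToDiscards, sub_zero, sub_zero] at hsub
  rw [Phase.evalBits_rename]
  exact hsub.symm

theorem discards_eq_image_rename (h₁ : t₁.IsNormal) (h₂ : t₂.IsNormal)
    (hd : t₁.density = t₂.density) (hσ : PreservesFirstLegs σ t₁ t₂) :
    t₂.D = t₁.D.image (rename σ) := by
  have hD := h₁.X_mem_discards_iff h₂ hd hσ
  have hX : ∀ v, rename σ (X v : BPoly V) = X (σ v) := fun v => value_injective fun a => by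
    rw [value_rename, value_X, value_X]
  refine Finset.Subset.antisymm (fun d hdD => ?_) (Finset.image_subset_iff.2 fun d hdD => ?_)
  · obtain ⟨w, rfl⟩ := h₂.discard_eq_X d hdD
    refine Finset.mem_image.2 ⟨X (σ.symm w), (hD _).2 ?_, ?_⟩ <;> simp [hX, hdD]
  · obtain ⟨v, rfl⟩ := h₁.discard_eq_X d hdD
    exact hX v ▸ (hD v).1 hdD

theorem alphaEq (h₁ : t₁.IsNormal) (h₂ : t₂.IsNormal) (hd : t₁.density = t₂.density) :
    t₁.AlphaEq t₂ := by
  obtain ⟨σ, hσ⟩ := h₁.exists_preservesFirstLegs h₂ hd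
  have hlegs := h₁.legs_eq_rename h₂ hd hσ
  refine ⟨σ, (h₁.scalar_eq h₂ hd).symm, h₁.bound_eq_image h₂ hd hσ, h₁.phase_eq_rename h₂ hd hσ,
    funext fun i => ?_, h₁.discards_eq_image_rename h₂ hd hσ, funext fun i => ?_⟩
  · simpa only [legs_castAdd] using hlegs (Fin.castAdd n i)
  · simpa only [legs_natAdd] using hlegs (Fin.natAdd m i)

end IsNormal

end Renaming

theorem IsZeroForm.alphaEq {y₁ y₂ : V} (h₁ : t₁.IsZeroForm y₁) (h₂ : t₂.IsZeroForm y₂) :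
    t₁.AlphaEq t₂ := by
  obtain ⟨s₁, b₁, P₁, O₁, D₁, I₁⟩ := h₁
  obtain ⟨s₂, b₂, P₂, O₂, D₂, I₂⟩ := h₂
  have hzero : (0 : BPoly V) = rename (Equiv.swap y₁ y₂) 0 := value_injective fun a => by
    rw [value_rename, map_zero, map_zero]
  refine ⟨Equiv.swap y₁ y₂, by rw [s₁, s₂], by simp [b₁, b₂], evalBits_injective fun a => ?_,
    by rw [O₁, O₂]; exact funext fun _ => hzero, by simp [D₁, D₂],
    by rw [I₁, I₂]; exact funext fun _ => hzero⟩
  rw [P₁, P₂, Phase.evalBits_rename, Phase.evalBits_scale, Phase.evalBits_scale, value_X, value_X,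
    Equiv.swap_apply_left]

theorem IsTerminal.exists_isZeroForm_iff (ht : t.IsTerminal) (h : t.IsCliffordUpToScalar) :
    (∃ y, t.IsZeroForm y) ↔ t.density = 0 :=
  ⟨fun ⟨_, hz⟩ => hz.density_eq_zero, fun hd => by
    by_contra! hz
    exact (ht.isNormal h hz).density_ne_zero hd⟩

theorem IsTerminal.alphaEq (ht₁ : t₁.IsTerminal) (ht₂ : t₂.IsTerminal)
    (h₁ : t₁.IsCliffordUpToScalar) (h₂ : t₂.IsCliffordUpToScalar)
    (hd : t₁.density = t₂.density) : t₁.AlphaEq t₂ := by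
  by_cases hzero : t₁.density = 0
  · obtain ⟨y₁, hz₁⟩ := (ht₁.exists_isZeroForm_iff h₁).2 hzero
    obtain ⟨y₂, hz₂⟩ := (ht₂.exists_isZeroForm_iff h₂).2 (hd ▸ hzero)
    exact hz₁.alphaEq hz₂
  · have hz₁ := mt (ht₁.exists_isZeroForm_iff h₁).1 hzero
    have hz₂ := mt (ht₂.exists_isZeroForm_iff h₂).1 (hd ▸ hzero)
    exact (ht₁.isNormal h₁ (not_exists.1 hz₁)).alphaEq (ht₂.isNormal h₂ (not_exists.1 hz₂)) hd

end DSOP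

end SumOverPaths

end

theorem mainTheorem2_general {V : Type*} {n m : ℕ} (t₁ t₂ t₁' t₂' : SumOverPaths.DSOP V n m)
    (h₁ : t₁.IsCliffordUpToScalar) (h₂ : t₂.IsCliffordUpToScalar) (h : t₁.interp = t₂.interp)
    (r₁ : t₁.Reduces t₁') (r₂ : t₂.Reduces t₂')
    (e₁ : t₁'.IsTerminal) (e₂ : t₂'.IsTerminal) :
    t₁'.AlphaEq t₂' := by
  obtain ⟨h₁', hd₁⟩ := r₁.isCliffordUpToScalar_and_density_eq h₁
  obtain ⟨h₂', hd₂⟩ := r₂.isCliffordUpToScalar_and_density_eq h₂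
  exact e₁.alphaEq e₂ h₁' h₂'
    (hd₁.trans <| (SumOverPaths.DSOP.density_eq_of_interp_eq h).trans hd₂.symm)

theorem mainTheorem2 {V : Type*} {n m : ℕ} (t₁ t₂ t₁' t₂' : SumOverPaths.DSOP V n m)
    (h₁ : t₁.IsClifford) (h₂ : t₂.IsClifford) (h : t₁.interp = t₂.interp)
    (r₁ : t₁.Reduces t₁') (r₂ : t₂.Reduces t₂')
    (e₁ : t₁'.IsTerminal) (e₂ : t₂'.IsTerminal) :
    t₁'.AlphaEq t₂' :=
  mainTheorem2_general t₁ t₂ t₁' t₂' h₁.isCliffordUpToScalar h₂.isCliffordUpToScalar h r₁ r₂ e₁ e₂
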